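/- Let $\langle a,b\rangle=-\frac12\operatorname{tr}(\operatorname{adj}(a)\,b)$ on the real $2\times2$ matrices. Tangent vectors of $M=\mathrm{SL}(2,\mathbb R)\times\mathrm{SL}(2,\mathbb R)$ at $(p,q)$ are the pairs $(p\alpha,q\beta)$ with $\alpha,\beta\in\mathfrak{sl}(2,\mathbb R)$. Equip $M$ with the pseudo-nearly Kähler structure $$g\big((p\alpha,q\beta),(p\gamma,q\delta)\big)=\tfrac23\big(\langle\alpha,\gamma\rangle+\langle\beta,\delta\rangle\big)-\tfrac13\big(\langle\beta,\gamma\rangle+\langle\alpha,\delta\rangle\big),\qquad J(p\alpha,q\beta)=\tfrac1{\sqrt3}\big(p(\alpha-2\beta),q(2\alpha-\beta)\big).$$ Let $\operatorname{Iso}(M)$ be the group of all smooth diffeomorphisms $F$ of $M$ that preserve $g$ and satisfy $F_*J=JF_*$ or $F_*J=-JF_*$. Let $\mathbf i=\operatorname{diag}(1,-1)$, and let $\mathbb Z_2\times S_3$ act on $\mathrm{SL}(2,\mathbb R)^3$ by letting $S_3$ permute the three factors and the generator of $\mathbb Z_2$ conjugate all three entries by $\mathbf i$. **Theorem.** The isometry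 group of the pseudo-nearly Kähler $\mathrm{SL}(2,\mathbb R)\times\mathrm{SL}(2,\mathbb R)$ is $\big(\mathrm{SL}(2,\mathbb R)\times\mathrm{SL}(2,\mathbb R)\times\mathrm{SL}(2,\mathbb R)\big)\rtimes(\mathbb Z_2\times S_3)$, up to the kernel $\{\pm(1,1,1)\}$ of its action. Precisely, there is a group homomorphism $$\Phi:\mathrm{SL}(2,\mathbb R)^3\rtimes(\mathbb Z_2\times S_3)\to\operatorname{Iso}(M)$$ such that $(a,b,c)\in \mathrm{SL}(2,\mathbb R)^3$ acts by $(p,q)\mapsto(apc^{-1},bqc^{-1})$, the generator of $\mathbb Z_2$ acts by $(p,q)\mapsto(\mathbf ip\mathbf i^{-1},\mathbf iq\mathbf i^{-1})$, and the transpositions $(1\,2)$ and $(1\,3)$ of $S_3$ act by $(p,q)\mapsto(q,p)$ and $(p,q)\mapsto(p^{-1},qp^{-1})$ respectively. This homomorphism is surjective, and its kernel consists exactly of the identity and the element $(-1,-1,-1)$ of $\mathrm{SL}(2,\mathbb R)^3$. -/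

import Mathlib

open scoped MatrixGroups ContDiff Matrix.Norms.Elementwise

noncomputable section

namespace SLNearlyKahler

/-- The space `M(2, ℝ)` of real `2 × 2` matrices. -/
abbrev Mat : Type := Matrix (Fin 2) (Fin 2) ℝ

/-- The manifold `SL(2, ℝ) × SL(2, ℝ)`, a submanifold of `M(2, ℝ) × M(2, ℝ)`. -/
abbrev Space : Type := SL(2, ℝ) × SL(2, ℝ)

/-- The inclusion of `SL(2, ℝ) × SL(2, ℝ)` into `M(2, ℝ) × M(2, ℝ)`. -/
def emb (x : Space) : Mat × Mat := ((x.1 : Mat), (x.2 : Mat))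

/-- The indefinite inner product `⟨a, b⟩ = -1/2 tr (adj a · b)` on `M(2, ℝ)`. -/
def inn (a b : Mat) : ℝ := -(1 / 2) * (a.adjugate * b).trace

lemma inn_eq (a b : Mat) :
    inn a b = -(1 / 2) * (a 1 1 * b 0 0 - a 0 1 * b 1 0 - a 1 0 * b 0 1 + a 0 0 * b 1 1) := by
  simp only [inn, Matrix.adjugate_fin_two, Matrix.trace_fin_two, Matrix.mul_apply,
    Fin.sum_univ_two, Matrix.of_apply, Matrix.cons_val_zero, Matrix.cons_val_one]
  ring

/-- The tangent space at `(p, q)`: the pairs `(X, Y)` of matrices with `X ∈ p^⊥` and `Y ∈ q^⊥`,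
equivalently `X = p α` and `Y = q β` with `α`, `β` of trace zero. -/
def tangentSpace (x : Space) : Submodule ℝ (Mat × Mat) where
  carrier := {v | inn x.1 v.1 = 0 ∧ inn x.2 v.2 = 0}
  zero_mem' := by simp [inn]
  add_mem' := by
    rintro v w ⟨h1, h2⟩ ⟨h3, h4⟩
    simp only [inn_eq, Set.mem_ofPred_eq, Prod.fst_add, Prod.snd_add, Matrix.add_apply] at *
    constructor <;> linarith
  smul_mem' := by
    rintro c v ⟨h1, h2⟩
    simp only [inn, Set.mem_ofPred_eq, Prod.smul_fst, Prod.smul_snd, Matrix.mul_smul,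
      Matrix.trace_smul, smul_eq_mul] at *
    constructor
    · linear_combination c * h1
    · linear_combination c * h2

lemma mem_tangentSpace {x : Space} {v : Mat × Mat} :
    v ∈ tangentSpace x ↔ inn x.1 v.1 = 0 ∧ inn x.2 v.2 = 0 := Iff.rfl

/-- The map `(p α, q β) ↦ (p β, q α)` (the almost product structure `P`). -/
def prodStr (x : Space) : (Mat × Mat) →ₗ[ℝ] (Mat × Mat) where
  toFun v := ((x.1 * x.2⁻¹ : SL(2, ℝ)) * v.2, (x.2 * x.1⁻¹ : SL(2, ℝ)) * v.1)
  map_add' v w := by simp [mul_add]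
  map_smul' c v := by simp

/-- The almost complex structure
`(p α, q β) ↦ (1 / √3) (p (α - 2 β), q (2 α - β))`, as a map on pairs of matrices. -/
def acsAux (x : Space) : (Mat × Mat) →ₗ[ℝ] (Mat × Mat) where
  toFun v := (1 / Real.sqrt 3) •
    (v.1 - (2 : ℝ) • (prodStr x v).1, (2 : ℝ) • (prodStr x v).2 - v.2)
  map_add' v w := by
    rw [← smul_add]
    congr 1
    ext1 <;> simp only [map_add, Prod.fst_add, Prod.snd_add, Prod.mk_add_mk, smul_add] <;> abel
  map_smul' c v := by
    rw [RingHom.id_apply, smul_comm c]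
    congr 1
    ext1 <;> simp only [map_smul, Prod.smul_fst, Prod.smul_snd, Prod.smul_mk, smul_sub,
      smul_comm c (2 : ℝ)]

lemma inn_translate (p q : SL(2, ℝ)) (v : Mat) :
    inn p ((p * q⁻¹ : SL(2, ℝ)) * v) = inn q v := by
  unfold inn
  rw [Matrix.SpecialLinearGroup.coe_mul, Matrix.SpecialLinearGroup.coe_inv, Matrix.mul_assoc,
    ← Matrix.mul_assoc (Matrix.adjugate _), Matrix.adjugate_mul]
  simp

lemma prodStr_mem (x : Space) (v : Mat × Mat) (hv : v ∈ tangentSpace x) :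
    prodStr x v ∈ tangentSpace x :=
  ⟨(inn_translate x.1 x.2 v.2).trans hv.2, (inn_translate x.2 x.1 v.1).trans hv.1⟩

lemma acsAux_mem (x : Space) (v : Mat × Mat) (hv : v ∈ tangentSpace x) :
    acsAux x v ∈ tangentSpace x := by
  have hP : prodStr x v ∈ tangentSpace x := prodStr_mem x v hv
  refine (tangentSpace x).smul_mem _ ?_
  obtain ⟨h1, h2⟩ := hv
  obtain ⟨h3, h4⟩ := hP
  rw [mem_tangentSpace]
  simp only [inn_eq, Matrix.sub_apply, Matrix.smul_apply, smul_eq_mul] at *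
  constructor <;> linarith

/-- The almost complex structure `J` on the tangent space at `x`. -/
def acs (x : Space) : tangentSpace x →ₗ[ℝ] tangentSpace x :=
  (acsAux x).restrict (acsAux_mem x)

/-- The nearly Kähler metric: for `v = (p α, q β)` and `w` tangent at `(p, q)`,
`g(v, w) = 2/3 ⟨(p α, q β), w⟩ - 1/3 ⟨(p β, q α), w⟩`, where `⟨ , ⟩` is the product metric. -/
def metric (x : Space) (v w : tangentSpace x) : ℝ :=
  2 / 3 * (inn v.1.1 w.1.1 + inn v.1.2 w.1.2)
    - 1 / 3 * (inn (prodStr x v).1 w.1.1 + inn (prodStr x v).2 w.1.2)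

/-- Smooth maps between submanifolds of vector spaces: those which extend, near each point, to
smooth maps of the ambient spaces. -/
def IsSmooth (F : Space → Space) : Prop :=
  ∀ x, ∃ (U : Set (Mat × Mat)) (f : Mat × Mat → Mat × Mat), IsOpen U ∧ emb x ∈ U ∧
    ContDiffOn ℝ ∞ f U ∧ ∀ y, emb y ∈ U → f (emb y) = emb (F y)

/-- The linear map `L` is the differential of `F` at `x`: it sends the velocity of any curve
through `x` to the velocity of its image under `F`. -/
def IsDifferentialAt (F : Space → Space) (x : Space)
    (L : tangentSpace x →ₗ[ℝ] tangentSpace (F x)) : Prop :=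
  ∀ (γ : ℝ → Space) (v : tangentSpace x), γ 0 = x →
    HasDerivAt (fun t => emb (γ t)) (v : Mat × Mat) 0 →
    HasDerivAt (fun t => emb (F (γ t))) (L v : Mat × Mat) 0

/-- `F` preserves the metric, and `F_* J = ε J F_*`. -/
def Preserves (ε : ℝ) (F : Space → Space) : Prop :=
  ∀ x, ∃ L : tangentSpace x →ₗ[ℝ] tangentSpace (F x), IsDifferentialAt F x L ∧
    (∀ v w, metric (F x) (L v) (L w) = metric x v w) ∧
    (∀ v, L (acs x v) = ε • acs (F x) (L v))

lemma velocity_det {γ : ℝ → SL(2, ℝ)} {v : Mat}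
    (h : HasDerivAt (fun t => (γ t : Mat)) v 0) : inn (γ 0) v = 0 := by
  have he : ∀ i j, HasDerivAt (fun t => (γ t : Mat) i j) (v i j) 0 := fun i j =>
    (hasDerivAt_pi.1 ((hasDerivAt_pi.1 h) i)) j
  have h1 := ((he 0 0).mul (he 1 1)).sub ((he 0 1).mul (he 1 0))
  have h2 : (fun t => (γ t : Mat) 0 0 * (γ t : Mat) 1 1 - (γ t : Mat) 0 1 * (γ t : Mat) 1 0)
      = fun _ => (1 : ℝ) := by
    funext t
    rw [← Matrix.det_fin_two]
    exact (γ t).2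
  have h3 := (show HasDerivAt (fun t => (γ t : Mat) 0 0 * (γ t : Mat) 1 1
      - (γ t : Mat) 0 1 * (γ t : Mat) 1 0) _ 0 from h1)
  rw [h2] at h3
  have h4 := h3.unique (hasDerivAt_const (0 : ℝ) (1 : ℝ))
  rw [inn_eq]
  linarith

lemma velocity_mem {γ : ℝ → Space} {v : Mat × Mat}
    (h : HasDerivAt (fun t => emb (γ t)) v 0) : v ∈ tangentSpace (γ 0) :=
  ⟨velocity_det (γ := fun t => (γ t).1)
      ((hasFDerivAt_fst (𝕜 := ℝ) (E := Mat) (F := Mat)).comp_hasDerivAt (0 : ℝ) h),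
    velocity_det (γ := fun t => (γ t).2)
      ((hasFDerivAt_snd (𝕜 := ℝ) (E := Mat) (F := Mat)).comp_hasDerivAt (0 : ℝ) h)⟩

lemma exists_curve_factor (p : SL(2, ℝ)) (v : Mat) (hv : inn p v = 0) :
    ∃ γ : ℝ → SL(2, ℝ), γ 0 = p ∧ HasDerivAt (fun t => (γ t : Mat)) v 0 := by
  have hp : (p : Mat).det = 1 := p.2
  have hdet : ∀ t : ℝ, ((p : Mat) + t • v).det = 1 + t ^ 2 * v.det := by
    intro t
    rw [inn_eq] at hv
    rw [Matrix.det_fin_two] at hp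
    simp only [Matrix.det_fin_two, Matrix.add_apply, Matrix.smul_apply, smul_eq_mul]
    linear_combination hp - 2 * t * hv
  let γ : ℝ → SL(2, ℝ) := fun t =>
    if h : 0 < 1 + t ^ 2 * v.det then
      ⟨(Real.sqrt (1 + t ^ 2 * v.det))⁻¹ • ((p : Mat) + t • v), by
        rw [Matrix.det_smul, hdet, Fintype.card_fin, inv_pow, Real.sq_sqrt h.le,
          inv_mul_cancel₀ h.ne']⟩
    else p
  refine ⟨γ, ?_, ?_⟩
  · ext i j
    simp [γ]
  · have h0 : HasDerivAt (fun t : ℝ => 1 + t ^ 2 * v.det) 0 0 := by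
      simpa using (((hasDerivAt_id (0 : ℝ)).pow 2).mul_const v.det).const_add 1
    have h1 : HasDerivAt (fun t : ℝ => (Real.sqrt (1 + t ^ 2 * v.det))⁻¹) 0 0 := by
      have h := (h0.sqrt (by simp)).fun_inv (by simp)
      exact h.congr_deriv (by simp)
    have h2 : HasDerivAt (fun t : ℝ => (p : Mat) + t • v) v 0 := by
      have h := ((hasDerivAt_id (0 : ℝ)).smul_const v).const_add (p : Mat)
      rw [one_smul] at h
      exact h
    have h3 : HasDerivAt (fun t : ℝ => (Real.sqrt (1 + t ^ 2 * v.det))⁻¹ • ((p : Mat) + t • v))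
        v 0 := by
      have h := HasDerivAt.fun_smul h1 h2
      exact h.congr_deriv (by simp)
    refine h3.congr_of_eventuallyEq ?_
    have hpos : ∀ᶠ t in nhds (0 : ℝ), 0 < 1 + t ^ 2 * v.det :=
      h0.continuousAt.eventually (lt_mem_nhds (by simp))
    filter_upwards [hpos] with t ht
    have hγ : γ t = ⟨_, _⟩ := dif_pos ht
    rw [hγ]

/-- Every tangent vector is the velocity of a curve. -/
lemma exists_curve {x : Space} (v : tangentSpace x) :
    ∃ γ : ℝ → Space, γ 0 = x ∧ HasDerivAt (fun t => emb (γ t)) (v : Mat × Mat) 0 := by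
  obtain ⟨γ, h1, h2⟩ := exists_curve_factor x.1 _ v.2.1
  obtain ⟨δ, h3, h4⟩ := exists_curve_factor x.2 _ v.2.2
  exact ⟨fun t => (γ t, δ t), Prod.ext h1 h3, h2.prodMk h4⟩

lemma IsSmooth.velocity {F : Space → Space} (hF : IsSmooth F) {γ : ℝ → Space} {v : Mat × Mat}
    (h : HasDerivAt (fun t => emb (γ t)) v 0) :
    ∃ w : tangentSpace (F (γ 0)), HasDerivAt (fun t => emb (F (γ t))) (w : Mat × Mat) 0 := by
  obtain ⟨U, f, hU, hx, hf, hfF⟩ := hF (γ 0)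
  have hd : DifferentiableAt ℝ f (emb (γ 0)) :=
    (hf.contDiffAt (hU.mem_nhds hx)).differentiableAt (by simp)
  have h1 : HasDerivAt (fun t => f (emb (γ t))) (fderiv ℝ f (emb (γ 0)) v) 0 :=
    hd.hasFDerivAt.comp_hasDerivAt (0 : ℝ) h
  have h2 : HasDerivAt (fun t => emb (F (γ t))) (fderiv ℝ f (emb (γ 0)) v) 0 := by
    refine h1.congr_of_eventuallyEq ?_
    filter_upwards [h.continuousAt.eventually (hU.mem_nhds hx)] with t ht
    exact (hfF _ ht).symm
  exact ⟨⟨_, velocity_mem (γ := fun t => F (γ t)) h2⟩, h2⟩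

lemma IsSmooth.id : IsSmooth id := fun _ =>
  ⟨Set.univ, fun z => z, isOpen_univ, Set.mem_univ _, contDiffOn_id, fun _ _ => rfl⟩

lemma IsSmooth.comp {F G : Space → Space} (hG : IsSmooth G) (hF : IsSmooth F) :
    IsSmooth (G ∘ F) := by
  intro x
  obtain ⟨U, f, hU, hx, hf, hfF⟩ := hF x
  obtain ⟨V, g, hV, hy, hg, hgG⟩ := hG (F x)
  refine ⟨U ∩ f ⁻¹' V, g ∘ f, hf.continuousOn.isOpen_inter_preimage hU hV, ⟨hx, ?_⟩,
    hg.comp (hf.mono Set.inter_subset_left) fun z hz => hz.2, ?_⟩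
  · rw [Set.mem_preimage, hfF x hx]
    exact hy
  · rintro y ⟨hy1, hy2⟩
    rw [Set.mem_preimage, hfF y hy1] at hy2
    rw [Function.comp_apply, hfF y hy1, hgG _ hy2, Function.comp_apply]

lemma Preserves.id : Preserves 1 id := fun _ =>
  ⟨LinearMap.id, fun _ _ _ h => h, fun _ _ => rfl, fun _ => (one_smul ℝ _).symm⟩

lemma Preserves.comp {ε δ : ℝ} {F G : Space → Space} (hG : Preserves δ G) (hF : Preserves ε F) :
    Preserves (δ * ε) (G ∘ F) := by
  intro x
  obtain ⟨L, h1, h2, h3⟩ := hF x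
  obtain ⟨K, k1, k2, k3⟩ := hG (F x)
  refine ⟨K ∘ₗ L, ?_, ?_, ?_⟩
  · intro γ v hγ hv
    exact k1 (fun t => F (γ t)) (L v) (congrArg F hγ) (h1 γ v hγ hv)
  · intro v w
    exact (k2 _ _).trans (h2 _ _)
  · intro v
    change K (L (acs x v)) = (δ * ε) • acs (G (F x)) (K (L v))
    rw [h3, map_smul, k3, smul_smul, mul_comm]

lemma inn_nondeg (p : SL(2, ℝ)) (z : Mat) (hz : inn p z = 0)
    (h : ∀ w, inn p w = 0 → inn z w = 0) : z = 0 := by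
  have hp : (p : Mat) 0 0 * (p : Mat) 1 1 - (p : Mat) 0 1 * (p : Mat) 1 0 = 1 := by
    rw [← Matrix.det_fin_two]
    exact p.2
  have hall : ∀ w, inn z w = 0 := by
    intro w
    have h1 := h (w + inn p w • (p : Mat)) (by
      simp only [inn_eq, Matrix.add_apply, Matrix.smul_apply, smul_eq_mul]
      linear_combination (1 / 2) * ((p : Mat) 1 1 * w 0 0 - (p : Mat) 0 1 * w 1 0
        - (p : Mat) 1 0 * w 0 1 + (p : Mat) 0 0 * w 1 1) * hp)
    have h2 : inn z (w + inn p w • (p : Mat)) = inn z w + inn p w * inn p z := by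
      simp only [inn_eq, Matrix.add_apply, Matrix.smul_apply, smul_eq_mul]
      ring
    rw [h2, hz, mul_zero, add_zero] at h1
    exact h1
  have h00 := hall !![0, 0; 0, 1]
  have h01 := hall !![0, 0; 1, 0]
  have h10 := hall !![0, 1; 0, 0]
  have h11 := hall !![1, 0; 0, 0]
  simp [inn_eq] at h00 h01 h10 h11
  ext i j
  fin_cases i <;> fin_cases j <;> simp [h00, h01, h10, h11]

lemma prodStr_prodStr (x : Space) (v : Mat × Mat) : prodStr x (prodStr x v) = v := by
  change (((x.1 * x.2⁻¹ : SL(2, ℝ)) : Mat) * (((x.2 * x.1⁻¹ : SL(2, ℝ)) : Mat) * v.1),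
    ((x.2 * x.1⁻¹ : SL(2, ℝ)) : Mat) * (((x.1 * x.2⁻¹ : SL(2, ℝ)) : Mat) * v.2)) = v
  rw [← mul_assoc, ← mul_assoc, ← Matrix.SpecialLinearGroup.coe_mul,
    ← Matrix.SpecialLinearGroup.coe_mul]
  simp

lemma metric_nondeg {x : Space} {u : tangentSpace x} (h : ∀ w, metric x u w = 0) : u = 0 := by
  have hz : (2 : ℝ) • (u : Mat × Mat) - prodStr x u ∈ tangentSpace x :=
    (tangentSpace x).sub_mem ((tangentSpace x).smul_mem _ u.2) (prodStr_mem x _ u.2)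
  have h1 : (2 : ℝ) • u.1.1 - (prodStr x u.1).1 = 0 := by
    refine inn_nondeg x.1 _ hz.1 fun w hw => ?_
    have := h ⟨(w, 0), hw, by simp [inn]⟩
    simp only [metric, inn_eq, Matrix.sub_apply, Matrix.smul_apply, smul_eq_mul,
      Matrix.zero_apply] at this ⊢
    linarith
  have h2 : (2 : ℝ) • u.1.2 - (prodStr x u.1).2 = 0 := by
    refine inn_nondeg x.2 _ hz.2 fun w hw => ?_
    have := h ⟨(0, w), by simp [inn], hw⟩
    simp only [metric, inn_eq, Matrix.sub_apply, Matrix.smul_apply, smul_eq_mul,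
      Matrix.zero_apply] at this ⊢
    linarith
  have h3 : prodStr x u.1 = (2 : ℝ) • u.1 := (sub_eq_zero.1 (Prod.ext h1 h2)).symm
  have h4 := prodStr_prodStr x u.1
  rw [h3, map_smul, h3, smul_smul] at h4
  have h5 : (3 : ℝ) • u.1 = 0 := by
    have : (3 : ℝ) • u.1 = ((2 : ℝ) * 2) • u.1 - u.1 := by module
    rw [this, h4, sub_self]
  exact Subtype.ext ((smul_eq_zero.1 h5).resolve_left (by norm_num))

lemma Preserves.symm {ε : ℝ} (hε : ε * ε = 1) {F : Equiv.Perm Space} (hs : IsSmooth F.symm)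
    (hF : Preserves ε F) : Preserves ε F.symm := by
  intro y
  obtain ⟨x, rfl⟩ := F.surjective y
  obtain ⟨L, h1, h2, h3⟩ := hF x
  have hinj : Function.Injective L := by
    rw [← LinearMap.ker_eq_bot, LinearMap.ker_eq_bot']
    intro u hu
    refine metric_nondeg fun w => ?_
    rw [← h2, hu]
    simp [metric, inn]
  have key : ∀ (γ : ℝ → Space) (v : tangentSpace (F x)), γ 0 = F x →
      HasDerivAt (fun t => emb (γ t)) (v : Mat × Mat) 0 →
      ∃ u : tangentSpace x, L u = v ∧
        HasDerivAt (fun t => emb (F.symm (γ t))) (u : Mat × Mat) 0 := by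
    intro γ v hγ hv
    have hγ' : F.symm (γ 0) = x := by rw [hγ, F.symm_apply_apply]
    obtain ⟨u, hu⟩ := hs.velocity hv
    refine ⟨⟨u.1, hγ' ▸ u.2⟩, ?_, hu⟩
    have := h1 (fun t => F.symm (γ t)) ⟨u.1, hγ' ▸ u.2⟩ hγ' hu
    simp only [F.apply_symm_apply] at this
    exact Subtype.ext (this.unique hv)
  have hsurj : Function.Surjective L := by
    intro v
    obtain ⟨γ, hγ, hv⟩ := exists_curve v
    obtain ⟨u, hu, -⟩ := key γ v hγ hv
    exact ⟨u, hu⟩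
  let E := LinearEquiv.ofBijective L ⟨hinj, hsurj⟩
  have hE : ∀ u, E u = L u := fun _ => rfl
  have main : ∃ K : tangentSpace (F x) →ₗ[ℝ] tangentSpace x,
      (∀ (γ : ℝ → Space) (v : tangentSpace (F x)), γ 0 = F x →
        HasDerivAt (fun t => emb (γ t)) (v : Mat × Mat) 0 →
        HasDerivAt (fun t => emb (F.symm (γ t))) (K v : Mat × Mat) 0) ∧
      (∀ v w, metric x (K v) (K w) = metric (F x) v w) ∧
      (∀ v, K (acs (F x) v) = ε • acs x (K v)) := by
    refine ⟨E.symm.toLinearMap, ?_, ?_, ?_⟩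
    · intro γ v hγ hv
      obtain ⟨u, hu, hd⟩ := key γ v hγ hv
      rw [← hu, ← hE]
      simpa using hd
    · intro v w
      obtain ⟨v, rfl⟩ := E.surjective v
      obtain ⟨w, rfl⟩ := E.surjective w
      change metric x (E.symm (E v)) (E.symm (E w)) = _
      rw [E.symm_apply_apply, E.symm_apply_apply]
      exact (h2 v w).symm
    · intro v
      obtain ⟨v, rfl⟩ := E.surjective v
      apply E.injective
      change E (E.symm (acs (F x) (E v))) = E (ε • acs x (E.symm (E v)))
      rw [E.apply_symm_apply, E.symm_apply_apply, map_smul, hE, hE, h3, smul_smul, hε, one_smul]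
  have hx : F.symm (F x) = x := F.symm_apply_apply x
  unfold IsDifferentialAt
  rw [hx]
  exact main

/-- The isometry group of the pseudo-nearly Kähler `SL(2, ℝ) × SL(2, ℝ)`: the diffeomorphisms
which preserve the metric `g` and satisfy `F_* J = J F_*` or `F_* J = - J F_*`. -/
def isometryGroup : Subgroup (Equiv.Perm Space) where
  carrier := {F | IsSmooth F ∧ IsSmooth F.symm ∧ (Preserves 1 F ∨ Preserves (-1) F)}
  one_mem' := ⟨IsSmooth.id, IsSmooth.id, Or.inl Preserves.id⟩
  mul_mem' := by
    rintro G F ⟨hG, hG', hG''⟩ ⟨hF, hF', hF''⟩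
    refine ⟨hG.comp hF, hF'.comp hG', ?_⟩
    rcases hG'' with h | h <;> rcases hF'' with k | k
    · left; simpa using h.comp k
    · right; simpa using h.comp k
    · right; simpa using h.comp k
    · left; simpa using h.comp k
  inv_mem' := by
    rintro F ⟨hF, hF', hF''⟩
    refine ⟨hF', hF, ?_⟩
    exact hF''.imp (Preserves.symm (by norm_num) hF') (Preserves.symm (by norm_num) hF')

/-- The matrix `i = diag(1, -1)`, of determinant `-1` and square `1`. -/
def iMat : Mat := !![1, 0; 0, -1]

lemma iMat_sq : iMat * iMat = 1 := by
  simp [iMat, Matrix.one_fin_two]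

/-- Conjugation `a ↦ i a i⁻¹ = i a i` on `SL(2, ℝ)`. -/
def iConj : MulAut SL(2, ℝ) where
  toFun a := ⟨iMat * a * iMat, by
    rw [Matrix.det_mul, Matrix.det_mul, a.2]
    simp [iMat, Matrix.det_fin_two]⟩
  invFun a := ⟨iMat * a * iMat, by
    rw [Matrix.det_mul, Matrix.det_mul, a.2]
    simp [iMat, Matrix.det_fin_two]⟩
  left_inv a := by
    apply Subtype.ext
    change iMat * (iMat * (a : Mat) * iMat) * iMat = a
    rw [← mul_assoc, ← mul_assoc, iMat_sq, one_mul, mul_assoc, iMat_sq, mul_one]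
  right_inv a := by
    apply Subtype.ext
    change iMat * (iMat * (a : Mat) * iMat) * iMat = a
    rw [← mul_assoc, ← mul_assoc, iMat_sq, one_mul, mul_assoc, iMat_sq, mul_one]
  map_mul' a b := by
    apply Subtype.ext
    change iMat * ((a : Mat) * (b : Mat)) * iMat = iMat * a * iMat * (iMat * b * iMat)
    rw [show iMat * (a : Mat) * iMat * (iMat * b * iMat)
      = iMat * a * (iMat * iMat) * b * iMat by simp only [mul_assoc], iMat_sq]
    simp only [mul_assoc, one_mul]

lemma iConj_iConj (a : SL(2, ℝ)) : iConj (iConj a) = a := iConj.left_inv a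

lemma iConj_pow_two : iConj ^ 2 = 1 := by
  ext1 a
  rw [pow_two]
  exact iConj_iConj a

/-- The group `SL(2, ℝ) × SL(2, ℝ) × SL(2, ℝ)`. -/
abbrev TripleSL : Type := Fin 3 → SL(2, ℝ)

/-- The group `ℤ₂ × S₃`. -/
abbrev FinGroup : Type := Multiplicative (ZMod 2) × Equiv.Perm (Fin 3)

/-- The action of `ℤ₂ × S₃` on `SL(2, ℝ) × SL(2, ℝ) × SL(2, ℝ)`: `S₃` permutes the three factors
and the generator of `ℤ₂` conjugates every entry by `i`. -/
def tripleAut : FinGroup →* MulAut TripleSL where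
  toFun s :=
    { toFun := fun n j => (iConj ^ (s.1.toAdd).val) (n (s.2⁻¹ j))
      invFun := fun n j => (iConj ^ (s.1.toAdd).val)⁻¹ (n (s.2 j))
      left_inv := fun n => by funext j; simp
      right_inv := fun n => by funext j; simp
      map_mul' := fun n m => by funext j; simp }
  map_one' := by ext1 n; funext j; simp
  map_mul' s t := by
    have h : iConj ^ ((s * t).1.toAdd).val
        = iConj ^ (s.1.toAdd).val * iConj ^ (t.1.toAdd).val := by
      rw [← pow_add, Prod.fst_mul, toAdd_mul, ZMod.val_add]
      conv_rhs => rw [← Nat.mod_add_div (ZMod.val s.1.toAdd + ZMod.val t.1.toAdd) 2, pow_add,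
        pow_mul, iConj_pow_two, one_pow, mul_one]
    ext1 n
    funext j
    change (iConj ^ ((s * t).1.toAdd).val) (n ((s * t).2⁻¹ j)) = _
    rw [h]
    simp

end SLNearlyKahler
end

open scoped MatrixGroups ContDiff Matrix.Norms.Elementwise

noncomputable section

namespace SLNearlyKahler

/-! ### Derivatives along left-invariant vector fields. -/

section LieDerivative

variable {E F G : Type*} [NormedAddCommGroup E] [NormedSpace ℝ E] [NormedAddCommGroup F]
  [NormedSpace ℝ F] [NormedAddCommGroup G] [NormedSpace ℝ G]

/-! Write a tangent vector as x ξ with ξ = (α, β) traceless, and read (α, β) as α + ω β in ℂ ⊗ sl(2,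
ℝ), where ω is a primitive cube root of unity. Then `rot` is multiplication by ω, √3 J is
multiplication by 1 + 2ω, and g is 2/3 of the real part of the Hermitian extension of `inn`. Both
have constant coefficients in the left-invariant frame. A map F preserving g and J thus gives linear
maps A_x (`leftDer`) preserving these fixed structures, and A_x satisfies a Maurer–Cartan equation
(`leftDer_structure`).

The space is SL(2, ℝ)³ modulo the diagonal, (p, q) being the class of (p, q, 1), and the diagonal
component of (α, β, 0) is (α + β) / 3. Hence the canonical Hermitian connection is the frame
derivative plus the bracket with `diagPart`. It preserves g and J, and its torsion is J-antilinear.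
These properties make every isometry commuting with J affine for it (`FrameIsometry.first_order`),
so A_x preserves torsion and curvature (`leftDer_curv`).

Curvature acts by brackets with diagonal elements, so A_x intertwines the adjoint action of sl(2, ℝ)
with a twist of it. By a Schur argument A_x is z · Ad(h) with h in GL(2, ℝ) and z complex; metric
and torsion force z³ = 1 (`FrameIsometry.classify`). The group realizes all such maps at the
identity: triples (c, c, c) and conjugation by i give Ad(h), the 3-cycles give z. A transposition
corrects the sign of J, and translations move any point to the identity.

It remains to see that F with F 1 = 1 and A_1 = id is the identity. The root z is constant
(`cubeRoot_invariant`). Once z = 1 everywhere, A_x has zero derivative and so is the identity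
(`leftDer_eq_self`). Then F(x) x⁻¹ is constant (`eq_self_of_leftDer`). The kernel is a separate
computation with triples (`actHom_eq_one_iff`). -/

/-- Right multiplication by `ξ` as a continuous linear map; this is the left-invariant vector field
with value `ξ` at the identity. -/
def leftField (ξ : Mat × Mat) : (Mat × Mat) →L[ℝ] (Mat × Mat) :=
  LinearMap.toContinuousLinearMap (LinearMap.mulRight ℝ ξ)

@[simp] lemma leftField_apply (ξ x : Mat × Mat) : leftField ξ x = x * ξ := rfl

/-- The derivative of `φ` along the left-invariant vector field `x ↦ x ξ`. -/
def lieD (ξ : Mat × Mat) (φ : Mat × Mat → E) (x : Mat × Mat) : E := fderiv ℝ φ x (x * ξ)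

lemma lieD_congr {U : Set (Mat × Mat)} (hU : IsOpen U) {φ ψ : Mat × Mat → E}
    (h : Set.EqOn φ ψ U) {x : Mat × Mat} (hx : x ∈ U) (ξ : Mat × Mat) :
    lieD ξ φ x = lieD ξ ψ x := by
  unfold lieD
  rw [(h.eventuallyEq_of_mem (hU.mem_nhds hx)).fderiv_eq]

lemma lieD_const (ξ : Mat × Mat) (c : E) (x : Mat × Mat) : lieD ξ (fun _ => c) x = 0 := by
  simp [lieD]

lemma contDiffOn_lieD {U : Set (Mat × Mat)} (hU : IsOpen U) {φ : Mat × Mat → E}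
    (h : ContDiffOn ℝ ∞ φ U) (ξ : Mat × Mat) : ContDiffOn ℝ ∞ (lieD ξ φ) U :=
  (h.fderiv_of_isOpen hU (by simp)).clm_apply (leftField ξ).contDiff.contDiffOn

lemma lieD_lieD {U : Set (Mat × Mat)} (hU : IsOpen U) {φ : Mat × Mat → E}
    (h : ContDiffOn ℝ ∞ φ U) {x : Mat × Mat} (hx : x ∈ U) (ζ ξ : Mat × Mat) :
    lieD ζ (lieD ξ φ) x
      = fderiv ℝ (fderiv ℝ φ) x (x * ζ) (x * ξ) + fderiv ℝ φ x (x * ζ * ξ) := by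
  have h1 : DifferentiableAt ℝ (fderiv ℝ φ) x :=
    (((h.fderiv_of_isOpen hU (m := ∞) (by simp)).contDiffAt (hU.mem_nhds hx)).differentiableAt
      (by simp))
  have h2 := h1.hasFDerivAt.clm_apply (leftField ξ).hasFDerivAt (x := x)
  unfold lieD
  erw [h2.fderiv]
  exact add_comm _ _

/-- The commutator of left-invariant derivatives is the derivative along the bracket. -/
lemma lieD_comm {U : Set (Mat × Mat)} (hU : IsOpen U) {φ : Mat × Mat → E}
    (h : ContDiffOn ℝ ∞ φ U) {x : Mat × Mat} (hx : x ∈ U) (ζ ξ : Mat × Mat) :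
    lieD ζ (lieD ξ φ) x - lieD ξ (lieD ζ φ) x = lieD (ζ * ξ - ξ * ζ) φ x := by
  have hs : IsSymmSndFDerivAt ℝ φ x :=
    (h.contDiffAt (hU.mem_nhds hx)).isSymmSndFDerivAt (by simp; norm_cast)
  have h2 : fderiv ℝ (fderiv ℝ φ) x (x * ζ) (x * ξ) = fderiv ℝ (fderiv ℝ φ) x (x * ξ) (x * ζ) :=
    hs.eq (x * ζ) (x * ξ)
  -- The Hessian terms cancel by symmetry; only the derivatives of the linear fields x ↦ x ξ and x ↦
  -- x ζ are left.
  rw [lieD_lieD hU h hx, lieD_lieD hU h hx, h2, lieD, mul_sub, map_sub, mul_assoc, mul_assoc]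
  abel

lemma lieD_linear [FiniteDimensional ℝ E] (T : E →ₗ[ℝ] F) {φ : Mat × Mat → E} {x : Mat × Mat}
    (h : DifferentiableAt ℝ φ x) (ξ : Mat × Mat) :
    lieD ξ (fun y => T (φ y)) x = T (lieD ξ φ x) := by
  have := ((LinearMap.toContinuousLinearMap T).hasFDerivAt (x := φ x)).comp x h.hasFDerivAt
  unfold lieD
  erw [this.fderiv]
  rfl

lemma lieD_bilinear [FiniteDimensional ℝ E] [FiniteDimensional ℝ F] (B : E →ₗ[ℝ] F →ₗ[ℝ] G)
    {φ : Mat × Mat → E} {ψ : Mat × Mat → F} {x : Mat × Mat}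
    (h : DifferentiableAt ℝ φ x) (k : DifferentiableAt ℝ ψ x) (ξ : Mat × Mat) :
    lieD ξ (fun y => B (φ y) (ψ y)) x = B (φ x) (lieD ξ ψ x) + B (lieD ξ φ x) (ψ x) := by
  have := B.toContinuousBilinearMap.hasFDerivAt_of_bilinear h.hasFDerivAt k.hasFDerivAt
  unfold lieD
  erw [this.fderiv]
  rfl

lemma contDiffOn_bilinear [FiniteDimensional ℝ E] [FiniteDimensional ℝ F]
    (B : E →ₗ[ℝ] F →ₗ[ℝ] G) {U : Set (Mat × Mat)} {φ : Mat × Mat → E} {ψ : Mat × Mat → F}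
    (h : ContDiffOn ℝ ∞ φ U) (k : ContDiffOn ℝ ∞ ψ U) :
    ContDiffOn ℝ ∞ (fun y => B (φ y) (ψ y)) U :=
  B.toContinuousBilinearMap.isBoundedBilinearMap.contDiff.comp_contDiffOn (h.prodMk k)

lemma contDiffOn_linear [FiniteDimensional ℝ E]
    (T : E →ₗ[ℝ] F) {U : Set (Mat × Mat)} {φ : Mat × Mat → E}
    (h : ContDiffOn ℝ ∞ φ U) : ContDiffOn ℝ ∞ (fun y => T (φ y)) U :=
  (LinearMap.toContinuousLinearMap T).contDiff.comp_contDiffOn h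

lemma lieD_mul {φ ψ : Mat × Mat → Mat × Mat} {x : Mat × Mat}
    (h : DifferentiableAt ℝ φ x) (k : DifferentiableAt ℝ ψ x) (ξ : Mat × Mat) :
    lieD ξ (fun y => φ y * ψ y) x = φ x * lieD ξ ψ x + lieD ξ φ x * ψ x :=
  lieD_bilinear (LinearMap.mul ℝ (Mat × Mat)) h k ξ

end LieDerivative

/-! ### Vanishing left-invariant derivatives imply constancy. -/

section Constancy

variable {E : Type*} [NormedAddCommGroup E] [NormedSpace ℝ E]

lemma emb_mul (x y : Space) : emb (x * y) = emb x * emb y := by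
  simp [emb]

lemma emb_one : emb 1 = 1 := by
  simp [emb]

lemma emb_injective : Function.Injective emb := by
  intro x y h
  exact Prod.ext (Subtype.ext (congrArg Prod.fst h)) (Subtype.ext (congrArg Prod.snd h))

/-- Because N² = 0, the affine line x(1 + tN) is an integral curve of the left-invariant field of N,
so no matrix exponential is needed. -/
lemma const_along_unipotent {φ : Mat × Mat → E}
    (hd : ∀ x, DifferentiableAt ℝ φ (emb x)) {N : Mat × Mat} (hN : N * N = 0)
    (h : ∀ x, lieD N φ (emb x) = 0) (u : ℝ → Space) (hu : ∀ t, emb (u t) = 1 + t • N)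
    (x : Space) (t : ℝ) : φ (emb (x * u t)) = φ (emb x) := by
  have h1 : ∀ s, HasDerivAt (fun s => φ (emb (x * u s))) 0 s := by
    intro s
    have h2 : HasDerivAt (fun s : ℝ => emb (x * u s)) (emb (x * u s) * N) s := by
      have h3 : (fun s : ℝ => emb (x * u s)) = fun s : ℝ => emb x + s • (emb x * N) := by
        funext s
        rw [emb_mul, hu, mul_add, mul_one, mul_smul_comm]
      have h4 : emb (x * u s) * N = emb x * N := by
        rw [emb_mul, hu, mul_assoc, add_mul, smul_mul_assoc, hN, smul_zero, one_mul, add_zero]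
      rw [h3, h4]
      exact (((hasDerivAt_id s).smul_const (emb x * N)).const_add (emb x)).congr_deriv
        (one_smul _ _)
    have h5 := (hd (x * u s)).hasFDerivAt.comp_hasDerivAt s h2
    have h6 := h (x * u s)
    exact h5.congr_deriv h6
  have h0 : u 0 = 1 := emb_injective (by rw [hu, emb_one]; simp)
  have := is_const_of_deriv_eq_zero (fun s => (h1 s).differentiableAt) (fun s => (h1 s).deriv) t 0
  rwa [h0, mul_one] at this

/-- The unipotent matrix with upper right entry `t`. -/
def upper (t : ℝ) : SL(2, ℝ) := ⟨!![1, t; 0, 1], by simp [Matrix.det_fin_two]⟩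

/-- The unipotent matrix with lower left entry `t`. -/
def lower (t : ℝ) : SL(2, ℝ) := ⟨!![1, 0; t, 1], by simp [Matrix.det_fin_two]⟩

/-- Unipotents generate SL(2, ℝ): a matrix with nonzero lower left entry is upper · lower · upper,
and any other acquires such an entry after one lower factor. This replaces a connectedness argument.
-/
lemma const_of_unipotent {X : Type*} {φ : SL(2, ℝ) → X}
    (hU : ∀ x t, φ (x * upper t) = φ x) (hL : ∀ x t, φ (x * lower t) = φ x) (x : SL(2, ℝ)) :
    φ x = φ 1 := by
  have main : ∀ y : SL(2, ℝ), (y : Mat) 1 0 ≠ 0 → φ y = φ 1 := by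
    intro y hy
    have hdet : (y : Mat) 0 0 * (y : Mat) 1 1 - (y : Mat) 0 1 * (y : Mat) 1 0 = 1 := by
      rw [← Matrix.det_fin_two]
      exact y.2
    have : y = 1 * upper (((y : Mat) 0 0 - 1) / (y : Mat) 1 0) * lower ((y : Mat) 1 0)
        * upper (((y : Mat) 1 1 - 1) / (y : Mat) 1 0) := by
      ext i j
      rw [Matrix.SpecialLinearGroup.coe_mul, Matrix.SpecialLinearGroup.coe_mul,
        Matrix.SpecialLinearGroup.coe_mul, Matrix.SpecialLinearGroup.coe_one, one_mul]
      fin_cases i <;> fin_cases j <;>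
        simp [upper, lower, Matrix.mul_apply, Fin.sum_univ_two] <;> field_simp
      · ring
      · linear_combination -hdet
      · ring
    rw [this, hU, hL, hU]
  by_cases hx : (x : Mat) 1 0 = 0
  · rw [← hL x 1]
    apply main
    have hdet : (x : Mat) 0 0 * (x : Mat) 1 1 - (x : Mat) 0 1 * (x : Mat) 1 0 = 1 := by
      rw [← Matrix.det_fin_two]
      exact x.2
    rw [Matrix.SpecialLinearGroup.coe_mul]
    simp [lower, Matrix.mul_apply, Fin.sum_univ_two, hx]
    intro h
    simp [h, hx] at hdet
  · exact main x hx

/-- Pairs of traceless matrices. -/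
def Traceless (ξ : Mat × Mat) : Prop := ξ.1.trace = 0 ∧ ξ.2.trace = 0

lemma const_of_lieD_eq_zero {φ : Mat × Mat → E} (hd : ∀ x, DifferentiableAt ℝ φ (emb x))
    (h : ∀ ξ, Traceless ξ → ∀ x, lieD ξ φ (emb x) = 0) (x : Space) : φ (emb x) = φ 1 := by
  have hN : ∀ N : Mat × Mat, Traceless N → N * N = 0 → ∀ (u : ℝ → Space),
      (∀ t, emb (u t) = 1 + t • N) → ∀ x t, φ (emb (x * u t)) = φ (emb x) :=
    fun N hN hNN u hu x t => const_along_unipotent hd hNN (h N hN) u hu x t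
  have key : ∀ N : Mat, N.trace = 0 → N * N = 0 → ∀ u : ℝ → SL(2, ℝ),
      (∀ t, (u t : Mat) = 1 + t • N) →
      (∀ (p q : SL(2, ℝ)) t, φ (emb (p * u t, q)) = φ (emb (p, q))) ∧
      (∀ (p q : SL(2, ℝ)) t, φ (emb (p, q * u t)) = φ (emb (p, q))) := by
    intro N htr hNN u hu
    constructor
    · intro p q t
      have := hN (N, 0) ⟨htr, by simp⟩ (by ext1 <;> simp [hNN]) (fun t => (u t, 1))
        (fun t => by ext1 <;> simp [emb, hu]) (p, q) t
      simpa using this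
    · intro p q t
      have := hN (0, N) ⟨by simp, htr⟩ (by ext1 <;> simp [hNN]) (fun t => (1, u t))
        (fun t => by ext1 <;> simp [emb, hu]) (p, q) t
      simpa using this
  have kU := key !![0, 1; 0, 0] (by simp [Matrix.trace_fin_two])
    (by ext i j; fin_cases i <;> fin_cases j <;> simp) upper (fun t => by
    ext i j; fin_cases i <;> fin_cases j <;> simp [upper])
  have kL := key !![0, 0; 1, 0] (by simp [Matrix.trace_fin_two])
    (by ext i j; fin_cases i <;> fin_cases j <;> simp) lower (fun t => by
    ext i j; fin_cases i <;> fin_cases j <;> simp [lower])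
  obtain ⟨p, q⟩ := x
  rw [const_of_unipotent (φ := fun p => φ (emb (p, q))) (fun x t => kU.1 x q t)
    (fun x t => kL.1 x q t) p, const_of_unipotent (φ := fun q => φ (emb (1, q)))
    (fun x t => kU.2 1 x t) (fun x t => kL.2 1 x t) q]
  exact congrArg φ emb_one

end Constancy

/-! ### The metric, J and differentials in the left-invariant frame. -/

section Frames

lemma inn_mul_left (p : SL(2, ℝ)) (a b : Mat) : inn (p * a) (p * b) = inn a b := by
  unfold inn
  rw [Matrix.adjugate_mul_distrib, Matrix.mul_assoc, ← Matrix.mul_assoc (Matrix.adjugate (p : Mat)),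
    Matrix.adjugate_mul]
  simp

lemma inn_self_mul (p : SL(2, ℝ)) (a : Mat) : inn p (p * a) = -(1 / 2) * a.trace := by
  have := inn_mul_left p 1 a
  rw [mul_one] at this
  rw [this]
  simp [inn]

/-- `inn` as a bilinear map. -/
def innB : Mat →ₗ[ℝ] Mat →ₗ[ℝ] ℝ :=
  LinearMap.mk₂ ℝ inn (fun a b c => by simp only [inn_eq, Matrix.add_apply]; ring)
    (fun r a b => by simp only [inn_eq, Matrix.smul_apply, smul_eq_mul]; ring)
    (fun a b c => by simp only [inn_eq, Matrix.add_apply]; ring)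
    (fun r a b => by simp only [inn_eq, Matrix.smul_apply, smul_eq_mul]; ring)

@[simp] lemma innB_apply (a b : Mat) : innB a b = inn a b := rfl

/-- The metric in a left-invariant frame. -/
def frameMetric : (Mat × Mat) →ₗ[ℝ] (Mat × Mat) →ₗ[ℝ] ℝ :=
  LinearMap.mk₂ ℝ (fun ξ η => 2 / 3 * (innB ξ.1 η.1 + innB ξ.2 η.2)
      - 1 / 3 * (innB ξ.2 η.1 + innB ξ.1 η.2))
    (fun a b c => by
      simp only [map_add, LinearMap.add_apply, Prod.fst_add, Prod.snd_add]; ring)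
    (fun r a b => by
      simp only [map_smul, LinearMap.smul_apply, Prod.smul_fst, Prod.smul_snd, smul_eq_mul]; ring)
    (fun a b c => by
      simp only [map_add, Prod.fst_add, Prod.snd_add]; ring)
    (fun r a b => by
      simp only [map_smul, Prod.smul_fst, Prod.smul_snd, smul_eq_mul]; ring)

lemma frameMetric_apply (ξ η : Mat × Mat) : frameMetric ξ η =
    2 / 3 * (inn ξ.1 η.1 + inn ξ.2 η.2) - 1 / 3 * (inn ξ.2 η.1 + inn ξ.1 η.2) := rfl

/-- The rotation of order three `(α, β) ↦ (-β, α - β)`. -/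
def rot : (Mat × Mat) →ₗ[ℝ] (Mat × Mat) where
  toFun ξ := (-ξ.2, ξ.1 - ξ.2)
  map_add' ξ η := by ext1 <;> simp only [Prod.fst_add, Prod.snd_add] <;> abel
  map_smul' c ξ := by ext1 <;> simp [smul_sub]

@[simp] lemma rot_apply (ξ : Mat × Mat) : rot ξ = (-ξ.2, ξ.1 - ξ.2) := rfl

/-- `√3` times the almost complex structure in a left-invariant frame. -/
def frameJ : (Mat × Mat) →ₗ[ℝ] (Mat × Mat) := LinearMap.id + (2 : ℝ) • rot

lemma frameJ_apply (ξ : Mat × Mat) :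
    frameJ ξ = (ξ.1 - (2 : ℝ) • ξ.2, (2 : ℝ) • ξ.1 - ξ.2) := by
  simp only [frameJ, LinearMap.add_apply, LinearMap.id_apply, LinearMap.smul_apply, rot_apply]
  ext1
  · change ξ.1 + (2 : ℝ) • (-ξ.2) = _
    module
  · change ξ.2 + (2 : ℝ) • (ξ.1 - ξ.2) = _
    module

lemma frameJ_frameJ (ξ : Mat × Mat) : frameJ (frameJ ξ) = (-3 : ℝ) • ξ := by
  simp only [frameJ_apply]
  ext1
  · change ξ.1 - (2 : ℝ) • ξ.2 - (2 : ℝ) • ((2 : ℝ) • ξ.1 - ξ.2) = (-3 : ℝ) • ξ.1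
    module
  · change (2 : ℝ) • (ξ.1 - (2 : ℝ) • ξ.2) - ((2 : ℝ) • ξ.1 - ξ.2) = (-3 : ℝ) • ξ.2
    module

lemma Traceless.add {ξ η : Mat × Mat} (h : Traceless ξ) (k : Traceless η) :
    Traceless (ξ + η) := by
  simp [Traceless, h.1, h.2, k.1, k.2]

lemma Traceless.sub {ξ η : Mat × Mat} (h : Traceless ξ) (k : Traceless η) :
    Traceless (ξ - η) := by
  simp [Traceless, h.1, h.2, k.1, k.2]

lemma Traceless.smul {ξ : Mat × Mat} (h : Traceless ξ) (c : ℝ) : Traceless (c • ξ) := by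
  simp [Traceless, h.1, h.2]

lemma Traceless.rot {ξ : Mat × Mat} (h : Traceless ξ) : Traceless (rot ξ) := by
  simp [Traceless, h.1, h.2]

lemma Traceless.frameJ {ξ : Mat × Mat} (h : Traceless ξ) : Traceless (frameJ ξ) :=
  h.add (h.rot.smul 2)

lemma traceless_commutator (ξ η : Mat × Mat) : Traceless (ξ * η - η * ξ) := by
  constructor
  · change (ξ.1 * η.1 - η.1 * ξ.1).trace = 0
    rw [Matrix.trace_sub, Matrix.trace_mul_comm, sub_self]
  · change (ξ.2 * η.2 - η.2 * ξ.2).trace = 0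
    rw [Matrix.trace_sub, Matrix.trace_mul_comm, sub_self]

lemma emb_inv_mul (x : Space) : emb x⁻¹ * emb x = 1 := by
  rw [← emb_mul, inv_mul_cancel, emb_one]

lemma emb_mul_inv (x : Space) : emb x * emb x⁻¹ = 1 := by
  rw [← emb_mul, mul_inv_cancel, emb_one]

lemma mul_mem_tangentSpace_iff (x : Space) (ξ : Mat × Mat) :
    emb x * ξ ∈ tangentSpace x ↔ Traceless ξ := by
  rw [mem_tangentSpace]
  change inn x.1 (x.1 * ξ.1) = 0 ∧ inn x.2 (x.2 * ξ.2) = 0 ↔ _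
  rw [inn_self_mul, inn_self_mul, Traceless]
  simp

lemma exists_frame (x : Space) (v : Mat × Mat) : v = emb x * (emb x⁻¹ * v) := by
  rw [← mul_assoc, emb_mul_inv, one_mul]

lemma prodStr_frame (x : Space) (ξ : Mat × Mat) :
    prodStr x (emb x * ξ) = emb x * (ξ.2, ξ.1) := by
  change (((x.1 * x.2⁻¹ : SL(2, ℝ)) : Mat) * ((x.2 : Mat) * ξ.2),
    ((x.2 * x.1⁻¹ : SL(2, ℝ)) : Mat) * ((x.1 : Mat) * ξ.1)) =
      ((x.1 : Mat) * ξ.2, (x.2 : Mat) * ξ.1)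
  rw [← mul_assoc, ← mul_assoc, ← Matrix.SpecialLinearGroup.coe_mul,
    ← Matrix.SpecialLinearGroup.coe_mul]
  simp

/-- Left multiplication by SL(2, ℝ) preserves `inn`, so the coefficients of g do not depend on x. -/
lemma metric_frame (x : Space) (v w : tangentSpace x) (ξ η : Mat × Mat)
    (hv : (v : Mat × Mat) = emb x * ξ) (hw : (w : Mat × Mat) = emb x * η) :
    metric x v w = frameMetric ξ η := by
  unfold metric
  rw [hv, hw, prodStr_frame, frameMetric_apply]
  change 2 / 3 * (inn (x.1 * ξ.1) (x.1 * η.1) + inn (x.2 * ξ.2) (x.2 * η.2))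
    - 1 / 3 * (inn (x.1 * ξ.2) (x.1 * η.1) + inn (x.2 * ξ.1) (x.2 * η.2)) = _
  simp only [inn_mul_left]

lemma acs_frame (x : Space) (v : tangentSpace x) (ξ : Mat × Mat)
    (hv : (v : Mat × Mat) = emb x * ξ) :
    (acs x v : Mat × Mat) = (1 / Real.sqrt 3) • (emb x * frameJ ξ) := by
  change (1 / Real.sqrt 3) • ((v : Mat × Mat).1 - (2 : ℝ) • (prodStr x v).1,
    (2 : ℝ) • (prodStr x v).2 - (v : Mat × Mat).2) = _
  rw [hv, prodStr_frame, frameJ_apply]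
  congr 1
  ext1
  · change (x.1 : Mat) * ξ.1 - (2 : ℝ) • ((x.1 : Mat) * ξ.2)
      = (x.1 : Mat) * (ξ.1 - (2 : ℝ) • ξ.2)
    rw [mul_sub, mul_smul_comm]
  · change (2 : ℝ) • ((x.2 : Mat) * ξ.1) - (x.2 : Mat) * ξ.2
      = (x.2 : Mat) * ((2 : ℝ) • ξ.1 - ξ.2)
    rw [mul_sub, mul_smul_comm]

/-- `A` is the differential of `F` at `x`, read in the left-invariant frames at `x` and `F x`. -/
def HasLeftDeriv (F : Space → Space) (x : Space) (A : (Mat × Mat) →ₗ[ℝ] (Mat × Mat)) : Prop :=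
  ∀ (γ : ℝ → Space) (ξ : Mat × Mat), γ 0 = x → Traceless ξ →
    HasDerivAt (fun t => emb (γ t)) (emb x * ξ) 0 →
    HasDerivAt (fun t => emb (F (γ t))) (emb (F x) * A ξ) 0

/-- `A` preserves the traceless pairs and the metric, and `A J = ε J A`. -/
structure FrameIsometry (ε : ℝ) (A : (Mat × Mat) →ₗ[ℝ] (Mat × Mat)) : Prop where
  traceless_map : ∀ ξ, Traceless ξ → Traceless (A ξ)
  metric_map : ∀ ξ η, Traceless ξ → Traceless η →
    frameMetric (A ξ) (A η) = frameMetric ξ η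
  frameJ_map : ∀ ξ, Traceless ξ → A (frameJ ξ) = ε • frameJ (A ξ)

lemma exists_curve_left (x : Space) {ξ : Mat × Mat} (h : Traceless ξ) :
    ∃ γ : ℝ → Space, γ 0 = x ∧ HasDerivAt (fun t => emb (γ t)) (emb x * ξ) 0 :=
  exists_curve (x := x) ⟨emb x * ξ, (mul_mem_tangentSpace_iff x ξ).2 h⟩

lemma HasLeftDeriv.unique {F : Space → Space} {x : Space} {A B : (Mat × Mat) →ₗ[ℝ] (Mat × Mat)}
    (hA : HasLeftDeriv F x A) (hB : HasLeftDeriv F x B) {ξ : Mat × Mat} (h : Traceless ξ) :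
    A ξ = B ξ := by
  obtain ⟨γ, h0, hγ⟩ := exists_curve_left x h
  have h1 := (hA γ ξ h0 h hγ).unique (hB γ ξ h0 h hγ)
  have h2 := congrArg (fun v => emb (F x)⁻¹ * v) h1
  simpa only [← mul_assoc, emb_inv_mul, one_mul] using h2

lemma HasLeftDeriv.comp {F G : Space → Space} {x : Space}
    {A B : (Mat × Mat) →ₗ[ℝ] (Mat × Mat)} (hB : HasLeftDeriv G (F x) B)
    (hA : HasLeftDeriv F x A) (ht : ∀ ξ, Traceless ξ → Traceless (A ξ)) :
    HasLeftDeriv (G ∘ F) x (B ∘ₗ A) := fun γ ξ h0 h hγ =>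
  hB (fun t => F (γ t)) (A ξ) (congrArg F h0) (ht ξ h) (hA γ ξ h0 h hγ)

/-- Used to check the generators: it reduces the geometric condition to linear algebra on traceless
pairs. The converse is `Preserves.exists_frameIsometry`. -/
lemma FrameIsometry.preserves {ε : ℝ} {F : Space → Space}
    (h : ∀ x, ∃ A, HasLeftDeriv F x A ∧ FrameIsometry ε A) : Preserves ε F := by
  intro x
  obtain ⟨A, hA, hi⟩ := h x
  have hfr : ∀ v : tangentSpace x, Traceless (emb x⁻¹ * v) := fun v => by
    rw [← mul_mem_tangentSpace_iff x, ← exists_frame]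
    exact v.2
  let L0 : (Mat × Mat) →ₗ[ℝ] (Mat × Mat) :=
    LinearMap.mulLeft ℝ (emb (F x)) ∘ₗ A ∘ₗ LinearMap.mulLeft ℝ (emb x⁻¹)
  let L : tangentSpace x →ₗ[ℝ] tangentSpace (F x) := L0.restrict (fun v hv =>
    (mul_mem_tangentSpace_iff (F x) _).2 (hi.traceless_map _ (hfr ⟨v, hv⟩)))
  have hL : ∀ v, (L v : Mat × Mat) = emb (F x) * A (emb x⁻¹ * v) := fun v => rfl
  refine ⟨L, ?_, ?_, ?_⟩
  · intro γ v h0 hγ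
    rw [hL]
    refine hA γ _ h0 (hfr v) ?_
    rwa [← exists_frame]
  · intro v w
    rw [metric_frame (F x) _ _ _ _ (hL v) (hL w), hi.metric_map _ _ (hfr v) (hfr w),
      metric_frame x v w _ _ (exists_frame x v) (exists_frame x w)]
  · intro v
    apply Subtype.ext
    rw [hL, acs_frame x v _ (exists_frame x v), Submodule.coe_smul,
      acs_frame (F x) (L v) _ (hL v), mul_smul_comm, ← mul_assoc, emb_inv_mul, one_mul, map_smul,
      hi.frameJ_map _ (hfr v), mul_smul_comm, mul_smul_comm, smul_comm]

/-- The projection to the traceless pairs. -/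
def tracelessPart : (Mat × Mat) →ₗ[ℝ] (Mat × Mat) where
  toFun ξ := (ξ.1 - (ξ.1.trace / 2) • 1, ξ.2 - (ξ.2.trace / 2) • 1)
  map_add' ξ η := by
    ext1 <;> simp only [Prod.fst_add, Prod.snd_add, Matrix.trace_add] <;> module
  map_smul' c ξ := by
    ext1 <;> simp only [Prod.smul_fst, Prod.smul_snd, Matrix.trace_smul, RingHom.id_apply,
      smul_eq_mul] <;> module

lemma traceless_tracelessPart (ξ : Mat × Mat) : Traceless (tracelessPart ξ) := by
  constructor <;> simp [tracelessPart]

lemma tracelessPart_eq {ξ : Mat × Mat} (h : Traceless ξ) : tracelessPart ξ = ξ := by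
  ext1 <;> simp [tracelessPart, h.1, h.2]

lemma Preserves.exists_frameIsometry {ε : ℝ} {F : Space → Space} (h : Preserves ε F)
    (x : Space) : ∃ A, HasLeftDeriv F x A ∧ FrameIsometry ε A := by
  obtain ⟨L, h1, h2, h3⟩ := h x
  -- The differential lives on the tangent space only. Projecting to traceless pairs first extends
  -- it linearly to all pairs; the values off the traceless pairs play no role.
  let T : (Mat × Mat) →ₗ[ℝ] tangentSpace x :=
    LinearMap.codRestrict (tangentSpace x) (LinearMap.mulLeft ℝ (emb x) ∘ₗ tracelessPart)
      (fun ξ => (mul_mem_tangentSpace_iff x _).2 (traceless_tracelessPart ξ))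
  have hT : ∀ ξ, Traceless ξ → (T ξ : Mat × Mat) = emb x * ξ := fun ξ hξ => by
    change emb x * tracelessPart ξ = _
    rw [tracelessPart_eq hξ]
  let A : (Mat × Mat) →ₗ[ℝ] (Mat × Mat) :=
    LinearMap.mulLeft ℝ (emb (F x)⁻¹) ∘ₗ (tangentSpace (F x)).subtype ∘ₗ L ∘ₗ T
  have hA : ∀ ξ, (L (T ξ) : Mat × Mat) = emb (F x) * A ξ := fun ξ => exists_frame (F x) _
  refine ⟨A, ?_, ?_, ?_, ?_⟩
  · intro γ ξ h0 hξ hγ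
    rw [← hA]
    refine h1 γ _ h0 ?_
    rwa [hT ξ hξ]
  · intro ξ _
    rw [← mul_mem_tangentSpace_iff (F x), ← hA]
    exact (L (T ξ)).2
  · intro ξ η hξ hη
    rw [← metric_frame (F x) _ _ _ _ (hA ξ) (hA η), h2, metric_frame x _ _ _ _ (hT ξ hξ) (hT η hη)]
  · intro ξ hξ
    have h4 : acs x (T ξ) = (1 / Real.sqrt 3) • T (frameJ ξ) := by
      apply Subtype.ext
      rw [acs_frame x _ _ (hT ξ hξ), Submodule.coe_smul, hT _ hξ.frameJ]
    have h5 := congrArg Subtype.val (h3 (T ξ))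
    rw [h4, map_smul, Submodule.coe_smul, hA, Submodule.coe_smul, acs_frame (F x) _ _ (hA ξ),
      smul_comm ε] at h5
    have h6 := smul_right_injective _ (by positivity : (1 / Real.sqrt 3) ≠ 0) h5
    have h7 := congrArg (fun v => emb (F x)⁻¹ * v) h6
    simpa only [mul_smul_comm, ← mul_assoc, emb_inv_mul, one_mul] using h7

end Frames

/-! ### Extension of maps to an open set of matrix pairs. -/

section Lift

/-- The pairs of matrices of positive determinant. -/
def posDet : Set (Mat × Mat) := {x | 0 < x.1.det ∧ 0 < x.2.det}

lemma contDiff_entry (i j : Fin 2) : ContDiff ℝ ∞ (fun a : Mat => a i j) := by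
  let T : Mat →ₗ[ℝ] ℝ :=
    { toFun := fun a => a i j, map_add' := fun _ _ => rfl, map_smul' := fun _ _ => rfl }
  exact (LinearMap.toContinuousLinearMap T).contDiff

lemma contDiff_det : ContDiff ℝ ∞ (fun a : Mat => a.det) := by
  simp only [Matrix.det_fin_two]
  exact ((contDiff_entry 0 0).mul (contDiff_entry 1 1)).sub
    ((contDiff_entry 0 1).mul (contDiff_entry 1 0))

lemma isOpen_posDet : IsOpen posDet :=
  (isOpen_lt continuous_const (contDiff_det.comp contDiff_fst).continuous).inter
    (isOpen_lt continuous_const (contDiff_det.comp contDiff_snd).continuous)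

lemma emb_mem_posDet (x : Space) : emb x ∈ posDet := by
  constructor
  · change 0 < (x.1 : Mat).det
    rw [x.1.2]; exact one_pos
  · change 0 < (x.2 : Mat).det
    rw [x.2.2]; exact one_pos

/-- Rescaling of a matrix of positive determinant to determinant one. -/
def rescaleFactor (a : Mat) : SL(2, ℝ) :=
  if h : 0 < a.det then ⟨(Real.sqrt a.det)⁻¹ • a, by
    rw [Matrix.det_smul, Fintype.card_fin, inv_pow, Real.sq_sqrt h.le, inv_mul_cancel₀ h.ne']⟩
  else 1

lemma coe_rescaleFactor {a : Mat} (h : 0 < a.det) :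
    (rescaleFactor a : Mat) = (Real.sqrt a.det)⁻¹ • a := by
  have : rescaleFactor a = ⟨_, _⟩ := dif_pos h
  rw [this]

/-- Rescaling of both components to determinant one. -/
def rescale (x : Mat × Mat) : Space := (rescaleFactor x.1, rescaleFactor x.2)

lemma rescale_emb (x : Space) : rescale (emb x) = x := by
  apply emb_injective
  ext1
  · change (rescaleFactor (x.1 : Mat) : Mat) = x.1
    have h : (x.1 : Mat).det = 1 := x.1.2
    rw [coe_rescaleFactor (by rw [h]; exact one_pos), h]
    simp
  · change (rescaleFactor (x.2 : Mat) : Mat) = x.2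
    have h : (x.2 : Mat).det = 1 := x.2.2
    rw [coe_rescaleFactor (by rw [h]; exact one_pos), h]
    simp

lemma contDiffOn_emb_rescale : ContDiffOn ℝ ∞ (fun x => emb (rescale x)) posDet := by
  have h1 : ContDiffOn ℝ ∞ (fun a : Mat => (Real.sqrt a.det)⁻¹ • a) {a | 0 < a.det} :=
    ((contDiff_det.contDiffOn.sqrt fun a (ha : 0 < a.det) => ha.ne').inv
      fun a ha => (Real.sqrt_pos.2 ha).ne').smul contDiffOn_id
  have h2 : ContDiffOn ℝ ∞ (fun x : Mat × Mat => ((Real.sqrt x.1.det)⁻¹ • x.1,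
      (Real.sqrt x.2.det)⁻¹ • x.2)) posDet :=
    (h1.comp contDiffOn_fst fun x hx => hx.1).prodMk (h1.comp contDiffOn_snd fun x hx => hx.2)
  exact h2.congr fun x hx => Prod.ext (coe_rescaleFactor hx.1) (coe_rescaleFactor hx.2)

/-- The extension of `F` to pairs of matrices of positive determinant. -/
def lift (F : Space → Space) (x : Mat × Mat) : Mat × Mat := emb (F (rescale x))

lemma contDiffOn_lift {F : Space → Space} (hF : IsSmooth F) : ContDiffOn ℝ ∞ (lift F) posDet := by
  intro x hx
  obtain ⟨U, f, hU, hxU, hf, hfF⟩ := hF (rescale x)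
  have h1 : ContDiffAt ℝ ∞ (fun x => emb (rescale x)) x :=
    contDiffOn_emb_rescale.contDiffAt (isOpen_posDet.mem_nhds hx)
  have h2 : ContDiffAt ℝ ∞ (fun y => f (emb (rescale y))) x :=
    ContDiffAt.comp x (hf.contDiffAt (hU.mem_nhds hxU)) h1
  refine (h2.congr_of_eventuallyEq ?_).contDiffWithinAt
  filter_upwards [h1.continuousAt.preimage_mem_nhds (hU.mem_nhds hxU)] with y hy
  exact (hfF _ hy).symm

/-- For traceless v, det(1 + tv) = 1 + t² det v, so the scale factor is stationary at t = 0.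
Rescaling therefore carries left-invariant fields to left-invariant fields. -/
lemma hasDerivAt_rescaleFactor {a : Mat} (ha : 0 < a.det) {v : Mat} (hv : v.trace = 0) :
    HasDerivAt (fun t : ℝ => (rescaleFactor (a + t • (a * v)) : Mat)) (rescaleFactor a * v) 0 := by
  have hdet : ∀ t : ℝ, (a + t • (a * v)).det = a.det * (1 + t ^ 2 * v.det) := by
    intro t
    have : a + t • (a * v) = a * (1 + t • v) := by rw [mul_add, mul_one, mul_smul_comm]
    rw [this, Matrix.det_mul]
    congr 1
    rw [Matrix.trace_fin_two] at hv
    simp only [Matrix.det_fin_two, Matrix.add_apply, Matrix.smul_apply, smul_eq_mul,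
      Matrix.one_apply]
    simp
    linear_combination t * hv
  have h0 : HasDerivAt (fun t : ℝ => (a + t • (a * v)).det) 0 0 := by
    simp only [hdet]
    have := ((((hasDerivAt_id (0 : ℝ)).pow 2).mul_const v.det).const_add 1).const_mul a.det
    exact this.congr_deriv (by simp)
  have hpos : 0 < (a + (0 : ℝ) • (a * v)).det := by simpa using ha
  have h1 : HasDerivAt (fun t : ℝ => (Real.sqrt (a + t • (a * v)).det)⁻¹) 0 0 :=
    ((h0.sqrt hpos.ne').fun_inv (Real.sqrt_pos.2 hpos).ne').congr_deriv (by simp)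
  have h2 : HasDerivAt (fun t : ℝ => a + t • (a * v)) (a * v) 0 :=
    (((hasDerivAt_id (0 : ℝ)).smul_const (a * v)).const_add a).congr_deriv (one_smul _ _)
  have h3 := (HasDerivAt.fun_smul h1 h2)
  refine (h3.congr_deriv ?_).congr_of_eventuallyEq ?_
  · rw [coe_rescaleFactor ha]
    simp
  · filter_upwards [h0.continuousAt.eventually (lt_mem_nhds hpos)] with t ht
    exact coe_rescaleFactor ht

lemma hasDerivAt_emb_rescale {x : Mat × Mat} (hx : x ∈ posDet) {ξ : Mat × Mat}
    (hξ : Traceless ξ) :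
    HasDerivAt (fun t : ℝ => emb (rescale (x + t • (x * ξ)))) (emb (rescale x) * ξ) 0 :=
  (hasDerivAt_rescaleFactor hx.1 hξ.1).prodMk (hasDerivAt_rescaleFactor hx.2 hξ.2)

/-- The adjugate on both components, as a linear map. -/
def adjPair : (Mat × Mat) →ₗ[ℝ] (Mat × Mat) where
  toFun ξ := (ξ.1.trace • 1 - ξ.1, ξ.2.trace • 1 - ξ.2)
  map_add' ξ η := by
    ext1 <;> simp only [Prod.fst_add, Prod.snd_add, Matrix.trace_add] <;> module
  map_smul' c ξ := by
    ext1 <;> simp only [Prod.smul_fst, Prod.smul_snd, Matrix.trace_smul, RingHom.id_apply,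
      smul_eq_mul] <;> module

lemma adjugate_eq (a : Mat) : a.adjugate = a.trace • 1 - a := by
  rw [Matrix.adjugate_fin_two]
  ext i j
  fin_cases i <;> fin_cases j <;> simp [Matrix.trace_fin_two]

lemma adjPair_apply (ξ : Mat × Mat) : adjPair ξ = (ξ.1.adjugate, ξ.2.adjugate) := by
  rw [adjugate_eq, adjugate_eq]; rfl

lemma emb_inv (x : Space) : emb x⁻¹ = adjPair (emb x) := by
  rw [adjPair_apply]
  simp [emb]

lemma adjPair_mul (ξ η : Mat × Mat) : adjPair (ξ * η) = adjPair η * adjPair ξ := by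
  simp only [adjPair_apply, Prod.fst_mul, Prod.snd_mul, Matrix.adjugate_mul_distrib, Prod.mk_mul_mk]

lemma adjPair_traceless {ξ : Mat × Mat} (h : Traceless ξ) : adjPair ξ = -ξ := by
  ext1 <;> simp [adjPair, h.1, h.2]

/-- The differential of the extension of `F`, in the left-invariant frames. -/
def leftDer (F : Space → Space) (x : Mat × Mat) : (Mat × Mat) →ₗ[ℝ] (Mat × Mat) where
  toFun ξ := adjPair (lift F x) * lieD ξ (lift F) x
  map_add' ξ η := by simp only [lieD, mul_add]; erw [map_add]; rw [mul_add]
  map_smul' c ξ := by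
    simp only [lieD, mul_smul_comm, RingHom.id_apply]
    erw [map_smul]
    rw [mul_smul_comm]

lemma lift_mul_leftDer (F : Space → Space) (x ξ : Mat × Mat) :
    lift F x * leftDer F x ξ = lieD ξ (lift F) x := by
  change lift F x * (adjPair (lift F x) * lieD ξ (lift F) x) = _
  unfold lift
  rw [← mul_assoc, ← emb_inv, emb_mul_inv, one_mul]

lemma contDiffOn_leftDer {F : Space → Space} (hF : IsSmooth F) (ξ : Mat × Mat) :
    ContDiffOn ℝ ∞ (fun x => leftDer F x ξ) posDet :=
  contDiffOn_bilinear (LinearMap.mul ℝ (Mat × Mat))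
    (contDiffOn_linear adjPair (contDiffOn_lift hF))
    (contDiffOn_lieD isOpen_posDet (contDiffOn_lift hF) ξ)

lemma leftDer_eq {F : Space → Space} (hF : IsSmooth F) {x : Mat × Mat} (hx : x ∈ posDet)
    {A : (Mat × Mat) →ₗ[ℝ] (Mat × Mat)} (hA : HasLeftDeriv F (rescale x) A) {ξ : Mat × Mat}
    (hξ : Traceless ξ) : leftDer F x ξ = A ξ := by
  have h1 := hA (fun t => rescale (x + t • (x * ξ))) ξ (by simp) hξ (hasDerivAt_emb_rescale hx hξ)
  have h2 : HasDerivAt (fun t : ℝ => x + t • (x * ξ)) (x * ξ) 0 :=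
    (((hasDerivAt_id (0 : ℝ)).smul_const (x * ξ)).const_add x).congr_deriv (one_smul _ _)
  have h3 : DifferentiableAt ℝ (lift F) (x + (0 : ℝ) • (x * ξ)) := by
    rw [zero_smul, add_zero]
    exact ((contDiffOn_lift hF).contDiffAt (isOpen_posDet.mem_nhds hx)).differentiableAt (by simp)
  have h4 := h3.hasFDerivAt.comp_hasDerivAt (0 : ℝ) h2
  rw [zero_smul, add_zero] at h4
  have h5 : lieD ξ (lift F) x = emb (F (rescale x)) * A ξ := h4.unique h1
  change adjPair (lift F x) * lieD ξ (lift F) x = _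
  unfold lift at *
  rw [h5, ← emb_inv, ← mul_assoc, emb_inv_mul, one_mul]

/-- The point is that this holds on the whole open set `posDet`, so that the identities can be
differentiated in the ambient space. -/
lemma frameIsometry_leftDer {ε : ℝ} {F : Space → Space} (hF : IsSmooth F) (hP : Preserves ε F)
    {x : Mat × Mat} (hx : x ∈ posDet) : FrameIsometry ε (leftDer F x) := by
  obtain ⟨A, hA, h⟩ := hP.exists_frameIsometry (rescale x)
  refine ⟨fun ξ hξ => ?_, fun ξ η hξ hη => ?_, fun ξ hξ => ?_⟩
  · rw [leftDer_eq hF hx hA hξ]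
    exact h.traceless_map ξ hξ
  · rw [leftDer_eq hF hx hA hξ, leftDer_eq hF hx hA hη]
    exact h.metric_map ξ η hξ hη
  · rw [leftDer_eq hF hx hA hξ, leftDer_eq hF hx hA hξ.frameJ]
    exact h.frameJ_map ξ hξ

end Lift

/-! ### The canonical Hermitian connection: linear algebra at a point. -/

section Pointwise

/-- The commutator of pairs of matrices. -/
def br : (Mat × Mat) →ₗ[ℝ] (Mat × Mat) →ₗ[ℝ] (Mat × Mat) :=
  LinearMap.mul ℝ (Mat × Mat) - (LinearMap.mul ℝ (Mat × Mat)).flip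

lemma br_apply (ξ η : Mat × Mat) : br ξ η = ξ * η - η * ξ := rfl

lemma br_swap (ξ η : Mat × Mat) : br ξ η = -br η ξ := by
  rw [br_apply, br_apply, neg_sub]

lemma br_br (a b c : Mat × Mat) : br (br a b) c = br a (br b c) - br b (br a c) := by
  simp only [br_apply]
  noncomm_ring

lemma traceless_br (ξ η : Mat × Mat) : Traceless (br ξ η) := traceless_commutator ξ η

/-- The projection to the diagonal `(α, β) ↦ ((α + β) / 3, (α + β) / 3)`, which describes the
canonical Hermitian connection in the left-invariant frame. -/
def diagPart : (Mat × Mat) →ₗ[ℝ] (Mat × Mat) where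
  toFun ξ := ((1 / 3 : ℝ) • (ξ.1 + ξ.2), (1 / 3 : ℝ) • (ξ.1 + ξ.2))
  map_add' ξ η := by ext1 <;> simp only [Prod.fst_add, Prod.snd_add] <;> module
  map_smul' c ξ := by
    ext1 <;> simp only [Prod.smul_fst, Prod.smul_snd, RingHom.id_apply] <;> module

lemma diagPart_apply (ξ : Mat × Mat) :
    diagPart ξ = ((1 / 3 : ℝ) • (ξ.1 + ξ.2), (1 / 3 : ℝ) • (ξ.1 + ξ.2)) := rfl

lemma Traceless.diagPart {ξ : Mat × Mat} (h : Traceless ξ) : Traceless (diagPart ξ) := by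
  simp [Traceless, diagPart_apply, h.1, h.2]

lemma br_mk (a b c d : Mat) : br (a, b) (c, d) = (a * c - c * a, b * d - d * b) := rfl

/-- `diagPart` is equivariant under the diagonal copy of sl(2, ℝ). -/
lemma diagPart_br (ξ η : Mat × Mat) :
    diagPart (br (diagPart ξ) η) = br (diagPart ξ) (diagPart η) := by
  obtain ⟨a, b⟩ := ξ
  obtain ⟨c, d⟩ := η
  simp only [diagPart_apply, br_mk, Prod.mk.injEq, and_self]
  simp only [mul_add, add_mul, smul_mul_assoc, mul_smul_comm, smul_add, smul_sub]
  module

/-- Diagonal brackets act on the factor sl(2, ℝ) of ℂ ⊗ sl(2, ℝ), while J acts on ℂ. Thus J is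
parallel; `frameMetric_br` is the same fact for g. -/
lemma frameJ_br (ξ η : Mat × Mat) : br (diagPart ξ) (frameJ η) = frameJ (br (diagPart ξ) η) := by
  obtain ⟨a, b⟩ := ξ
  obtain ⟨c, d⟩ := η
  simp only [diagPart_apply, br_mk, frameJ_apply, Prod.mk.injEq]
  simp only [mul_add, add_mul, mul_sub, sub_mul, smul_mul_assoc, mul_smul_comm, smul_add, smul_sub]
  constructor <;> module

/-- The torsion of the canonical Hermitian connection. -/
def torsion (ξ η : Mat × Mat) : Mat × Mat := br ξ η - br (diagPart ξ) η + br (diagPart η) ξ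

/-- In complex terms the torsion of z α and w γ is one third of the conjugate of z w, times [α, γ].
This antilinearity is what makes the connection rigid under isometries. -/
lemma torsion_frameJ (ξ η : Mat × Mat) : torsion (frameJ ξ) η = -frameJ (torsion ξ η) := by
  obtain ⟨a, b⟩ := ξ
  obtain ⟨c, d⟩ := η
  simp only [torsion, diagPart_apply, br_mk, frameJ_apply, Prod.mk_add_mk, Prod.mk_sub_mk,
    Prod.neg_mk, Prod.mk.injEq]
  simp only [mul_add, add_mul, mul_sub, sub_mul, smul_mul_assoc, mul_smul_comm, smul_add, smul_sub]
  constructor <;> module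

/-- The curvature of the canonical Hermitian connection. -/
def curv (ξ η : Mat × Mat) : Mat × Mat := br (diagPart ξ) (diagPart η) - diagPart (br ξ η)

lemma inn_symm (a b : Mat) : inn a b = inn b a := by
  simp only [inn_eq]
  ring

lemma inn_comm_left (k a b : Mat) : inn (k * a - a * k) b + inn a (k * b - b * k) = 0 := by
  simp only [inn_eq, Matrix.sub_apply, Matrix.mul_apply, Fin.sum_univ_two]
  ring

lemma frameMetric_symm (ξ η : Mat × Mat) : frameMetric ξ η = frameMetric η ξ := by
  simp only [frameMetric_apply, inn_symm η.1, inn_symm η.2]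
  ring

lemma frameMetric_br (ζ ξ η : Mat × Mat) :
    frameMetric (br (diagPart ζ) ξ) η + frameMetric ξ (br (diagPart ζ) η) = 0 := by
  set k : Mat := (1 / 3 : ℝ) • (ζ.1 + ζ.2) with hk
  have h11 := inn_comm_left k ξ.1 η.1
  have h12 := inn_comm_left k ξ.1 η.2
  have h21 := inn_comm_left k ξ.2 η.1
  have h22 := inn_comm_left k ξ.2 η.2
  have hb : ∀ ξ : Mat × Mat, br (diagPart ζ) ξ = (k * ξ.1 - ξ.1 * k, k * ξ.2 - ξ.2 * k) :=
    fun _ => rfl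
  rw [hb, hb, frameMetric_apply, frameMetric_apply]
  linear_combination 2 / 3 * (h11 + h22) - 1 / 3 * (h12 + h21)

lemma frameMetric_nondeg {ξ : Mat × Mat} (hξ : Traceless ξ)
    (h : ∀ η, Traceless η → frameMetric ξ η = 0) : ξ = 0 := by
  have hone : ∀ w : Mat, inn (1 : SL(2, ℝ)) w = -(1 / 2) * w.trace := fun w => by
    simp [inn]
  have h1 : (2 : ℝ) • ξ.1 - ξ.2 = 0 := by
    refine inn_nondeg 1 _ ?_ fun w hw => ?_
    · rw [hone]; simp [hξ.1, hξ.2]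
    · have := h (w, 0) ⟨by rw [hone] at hw; linarith, by simp⟩
      simp only [frameMetric_apply, inn_eq, Matrix.sub_apply, Matrix.smul_apply, smul_eq_mul,
        Matrix.zero_apply] at this ⊢
      linarith
  have h2 : (2 : ℝ) • ξ.2 - ξ.1 = 0 := by
    refine inn_nondeg 1 _ ?_ fun w hw => ?_
    · rw [hone]; simp [hξ.1, hξ.2]
    · have := h (0, w) ⟨by simp, by rw [hone] at hw; linarith⟩
      simp only [frameMetric_apply, inn_eq, Matrix.sub_apply, Matrix.smul_apply, smul_eq_mul,
        Matrix.zero_apply] at this ⊢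
      linarith
  have h3 : ξ.1 = 0 := by
    have : ξ.1 = (2 / 3 : ℝ) • ((2 : ℝ) • ξ.1 - ξ.2) + (1 / 3 : ℝ) • ((2 : ℝ) • ξ.2 - ξ.1) := by
      module
    rw [this, h1, h2]; simp
  have h4 : ξ.2 = 0 := by
    rw [h3, smul_zero, zero_sub, neg_eq_zero] at h1
    exact h1
  exact Prod.ext h3 h4

/-- The traceless pairs, as a submodule. -/
def tracelessSubmodule : Submodule ℝ (Mat × Mat) where
  carrier := {ξ | Traceless ξ}
  zero_mem' := by simp [Traceless]
  add_mem' := Traceless.add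
  smul_mem' c _ h := h.smul c

lemma FrameIsometry.surjective {ε : ℝ} {A : (Mat × Mat) →ₗ[ℝ] (Mat × Mat)}
    (hA : FrameIsometry ε A) {η : Mat × Mat} (hη : Traceless η) :
    ∃ ξ, Traceless ξ ∧ A ξ = η := by
  let B : tracelessSubmodule →ₗ[ℝ] tracelessSubmodule := A.restrict hA.traceless_map
  have hinj : Function.Injective B := by
    rw [← LinearMap.ker_eq_bot, LinearMap.ker_eq_bot']
    rintro ⟨u, hu⟩ h
    have h0 : A u = 0 := congrArg Subtype.val h
    apply Subtype.ext
    refine frameMetric_nondeg hu fun w hw => ?_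
    rw [← hA.metric_map u w hu hw, h0]
    simp
  obtain ⟨⟨u, hu⟩, h⟩ := LinearMap.injective_iff_surjective.1 hinj ⟨η, hη⟩
  exact ⟨u, hu, congrArg Subtype.val h⟩

/-- The structure equation determines the derivative `D` of the differential `A` of an isometry,
and forces `A` to preserve the torsion. -/
lemma FrameIsometry.first_order {A : (Mat × Mat) →ₗ[ℝ] (Mat × Mat)} (hA : FrameIsometry 1 A)
    {D : Mat × Mat → Mat × Mat → Mat × Mat}
    (hDt : ∀ ζ ξ, Traceless ζ → Traceless ξ → Traceless (D ζ ξ))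
    (hDJ : ∀ ζ ξ, Traceless ζ → Traceless ξ → D ζ (frameJ ξ) = frameJ (D ζ ξ))
    (hDg : ∀ ζ ξ η, Traceless ζ → Traceless ξ → Traceless η →
      frameMetric (D ζ ξ) (A η) + frameMetric (A ξ) (D ζ η) = 0)
    (hD : ∀ ζ ξ, Traceless ζ → Traceless ξ →
      D ζ ξ - D ξ ζ = A (br ζ ξ) - br (A ζ) (A ξ))
    {ζ ξ : Mat × Mat} (hζ : Traceless ζ) (hξ : Traceless ξ) :
    D ζ ξ = A (br (diagPart ζ) ξ) - br (diagPart (A ζ)) (A ξ) ∧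
      A (torsion ζ ξ) = torsion (A ζ) (A ξ) := by
  -- S is the covariant derivative of A for the canonical connections at source and target. Both
  -- claims follow from S = 0.
  set S : Mat × Mat → Mat × Mat → Mat × Mat :=
    fun ζ ξ => D ζ ξ - A (br (diagPart ζ) ξ) + br (diagPart (A ζ)) (A ξ) with hS
  have hAJ : ∀ ξ, Traceless ξ → A (frameJ ξ) = frameJ (A ξ) := fun ξ h => by
    rw [hA.frameJ_map ξ h, one_smul]
  have hSt : ∀ ζ ξ, Traceless ζ → Traceless ξ → Traceless (S ζ ξ) := fun ζ ξ h k =>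
    ((hDt ζ ξ h k).sub (hA.traceless_map _ (traceless_br _ _))).add (traceless_br _ _)
  have hSJ : ∀ ζ ξ, Traceless ζ → Traceless ξ → S ζ (frameJ ξ) = frameJ (S ζ ξ) := by
    intro ζ ξ h k
    simp only [hS]
    rw [hDJ ζ ξ h k, frameJ_br, hAJ ξ k, frameJ_br, hAJ _ (traceless_br _ _), map_add, map_sub]
  have hSE : ∀ ζ ξ, Traceless ζ → Traceless ξ →
      S ζ ξ - S ξ ζ = A (torsion ζ ξ) - torsion (A ζ) (A ξ) := by
    intro ζ ξ h k
    simp only [hS, torsion, map_add, map_sub]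
    rw [show ∀ a b c d e f : Mat × Mat, a - b + c - (d - e + f) = (a - d) - b + c + e - f from
      fun a b c d e f => by abel, hD ζ ξ h k]
    abel
  have hSEJ : ∀ ζ ξ, Traceless ζ → Traceless ξ →
      S (frameJ ζ) ξ - S ξ (frameJ ζ) = - frameJ (S ζ ξ - S ξ ζ) := by
    intro ζ ξ h k
    rw [hSE _ _ h.frameJ k, hSE _ _ h k, hAJ ζ h, torsion_frameJ, torsion_frameJ, map_neg,
      hAJ (torsion ζ ξ) (((traceless_br _ _).sub (traceless_br _ _)).add (traceless_br _ _)),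
      map_sub]
    abel
  have hSJ1 : ∀ ζ ξ, Traceless ζ → Traceless ξ →
      S (frameJ ζ) ξ = (2 : ℝ) • frameJ (S ξ ζ) - frameJ (S ζ ξ) := by
    intro ζ ξ h k
    have := hSEJ ζ ξ h k
    rw [hSJ ξ ζ k h, map_sub, sub_eq_iff_eq_add] at this
    rw [this, two_smul]
    abel
  -- S is J-linear in its second argument, whereas its skew part is a difference of torsions and so
  -- J-antilinear. Expanding S(Jζ, Jξ) from either argument, with `frameJ` squaring to -3, shows
  -- that 12 times the skew part vanishes.
  have hSsymm : ∀ ζ ξ, Traceless ζ → Traceless ξ → S ζ ξ = S ξ ζ := by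
    intro ζ ξ h k
    have h1 : S (frameJ ζ) (frameJ ξ) = (6 : ℝ) • S ζ ξ - (9 : ℝ) • S ζ ξ
        - (6 : ℝ) • S ζ ξ + (6 : ℝ) • S ξ ζ := by
      rw [hSJ1 ζ _ h k.frameJ, hSJ1 ξ ζ k h, hSJ ζ ξ h k, map_sub, map_smul, frameJ_frameJ,
        frameJ_frameJ]
      module
    have h2 : S (frameJ ζ) (frameJ ξ) = (3 : ℝ) • S ζ ξ - (6 : ℝ) • S ξ ζ := by
      rw [hSJ _ ξ h.frameJ k, hSJ1 ζ ξ h k, map_sub, map_smul, frameJ_frameJ, frameJ_frameJ]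
      module
    have h3 : (12 : ℝ) • (S ζ ξ - S ξ ζ) = 0 := by
      have : (12 : ℝ) • (S ζ ξ - S ξ ζ) = ((3 : ℝ) • S ζ ξ - (6 : ℝ) • S ξ ζ)
        - ((6 : ℝ) • S ζ ξ - (9 : ℝ) • S ζ ξ - (6 : ℝ) • S ζ ξ + (6 : ℝ) • S ξ ζ) := by module
      rw [this, ← h1, ← h2, sub_self]
    exact sub_eq_zero.1 ((smul_eq_zero.1 h3).resolve_left (by norm_num))
  have hSg : ∀ ζ ξ η, Traceless ζ → Traceless ξ → Traceless η →
      frameMetric (S ζ ξ) (A η) + frameMetric (S ζ η) (A ξ) = 0 := by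
    intro ζ ξ η h k l
    have h1 := hDg ζ ξ η h k l
    have h2 := frameMetric_br (A ζ) (A ξ) (A η)
    have h3 := frameMetric_br ζ ξ η
    rw [← hA.metric_map _ _ (traceless_br _ _) l, ← hA.metric_map _ _ k (traceless_br _ _)] at h3
    rw [frameMetric_symm (A ξ)] at h1 h2 h3
    simp only [hS, map_add, map_sub, LinearMap.add_apply, LinearMap.sub_apply]
    linear_combination h1 + h2 - h3
  -- The Koszul argument: g(S(ζ, ξ), Aη) is symmetric in ζ, ξ and skew in ξ, η, hence zero.
  -- Surjectivity of A and nondegeneracy of g then give S = 0.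
  have hS0 : ∀ ζ ξ, Traceless ζ → Traceless ξ → S ζ ξ = 0 := by
    intro ζ ξ h k
    refine frameMetric_nondeg (hSt ζ ξ h k) fun w hw => ?_
    obtain ⟨η, hη, rfl⟩ := hA.surjective hw
    have e1 := hSg ζ ξ η h k hη
    have e2 := hSg η ζ ξ hη h k
    have e3 := hSg ξ η ζ k hη h
    rw [hSsymm η ζ hη h, hSsymm η ξ hη k] at e2
    rw [hSsymm ξ ζ k h] at e3
    linarith
  constructor
  · have := hS0 ζ ξ hζ hξ
    simp only [hS] at this
    rw [← sub_eq_zero, ← this]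
    abel
  · have := hSE ζ ξ hζ hξ
    rw [hS0 _ _ hζ hξ, hS0 _ _ hξ hζ, sub_zero] at this
    exact (sub_eq_zero.1 this.symm)

end Pointwise

/-! ### Isometries preserve torsion and curvature. -/

section Local

variable {F : Space → Space}

lemma differentiableAt_of_contDiffOn {E : Type*} [NormedAddCommGroup E] [NormedSpace ℝ E]
    {φ : Mat × Mat → E} (h : ContDiffOn ℝ ∞ φ posDet) {x : Mat × Mat} (hx : x ∈ posDet) :
    DifferentiableAt ℝ φ x :=
  (h.contDiffAt (isOpen_posDet.mem_nhds hx)).differentiableAt (by simp)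

/-- The Maurer--Cartan equation for the differential of `F`. -/
lemma leftDer_structure (hF : IsSmooth F) {x : Mat × Mat} (hx : x ∈ posDet) (ζ ξ : Mat × Mat) :
    lieD ζ (fun y => leftDer F y ξ) x - lieD ξ (fun y => leftDer F y ζ) x
      = leftDer F x (br ζ ξ) - br (leftDer F x ζ) (leftDer F x ξ) := by
  have h1 : ∀ ζ ξ, lieD ζ (lieD ξ (lift F)) x = lift F x * lieD ζ (fun y => leftDer F y ξ) x
      + lift F x * leftDer F x ζ * leftDer F x ξ := by
    intro ζ ξ
    rw [lift_mul_leftDer, ← lieD_mul (differentiableAt_of_contDiffOn (contDiffOn_lift hF) hx)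
      (differentiableAt_of_contDiffOn (contDiffOn_leftDer hF ξ) hx)]
    simp only [lift_mul_leftDer]
  have h2 := lieD_comm isOpen_posDet (contDiffOn_lift hF) hx ζ ξ
  rw [h1, h1, ← lift_mul_leftDer, ← br_apply] at h2
  have h3 := congrArg (fun v => emb (F (rescale x))⁻¹ * v) h2
  simp only [mul_add, mul_sub, ← mul_assoc, lift, emb_inv_mul, one_mul] at h3
  rw [← h3, br_apply]
  abel

/-- The two traces. -/
def traces : (Mat × Mat) →ₗ[ℝ] ℝ × ℝ :=
  (Matrix.traceLinearMap (Fin 2) ℝ ℝ).prodMap (Matrix.traceLinearMap (Fin 2) ℝ ℝ)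

lemma traces_eq_zero {ξ : Mat × Mat} : traces ξ = 0 ↔ Traceless ξ := by
  simp [traces, Traceless, Prod.ext_iff]

/-- Differentiating the pointwise identities for `leftDer` on the open set supplies the hypotheses
of `FrameIsometry.first_order`, the last one being the Maurer–Cartan equation. -/
lemma lieD_leftDer_and_torsion (hF : IsSmooth F) (hP : Preserves 1 F) {x : Mat × Mat}
    (hx : x ∈ posDet) {ζ ξ : Mat × Mat} (hζ : Traceless ζ) (hξ : Traceless ξ) :
    lieD ζ (fun y => leftDer F y ξ) x
        = leftDer F x (br (diagPart ζ) ξ) - br (diagPart (leftDer F x ζ)) (leftDer F x ξ) ∧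
      leftDer F x (torsion ζ ξ) = torsion (leftDer F x ζ) (leftDer F x ξ) := by
  have hd : ∀ ξ, DifferentiableAt ℝ (fun y => leftDer F y ξ) x := fun ξ =>
    differentiableAt_of_contDiffOn (contDiffOn_leftDer hF ξ) hx
  have hI := fun (y : Mat × Mat) (hy : y ∈ posDet) => frameIsometry_leftDer hF hP hy
  refine (hI x hx).first_order (D := fun ζ ξ => lieD ζ (fun y => leftDer F y ξ) x)
    ?_ ?_ ?_ (fun ζ ξ _ _ => leftDer_structure hF hx ζ ξ) hζ hξ
  · intro ζ ξ _ hξ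
    rw [← traces_eq_zero, ← lieD_linear traces (hd ξ), ← lieD_const ζ (0 : ℝ × ℝ) x]
    exact lieD_congr isOpen_posDet (fun y hy => traces_eq_zero.2 ((hI y hy).traceless_map ξ hξ)) hx ζ
  · intro ζ ξ _ hξ
    rw [← lieD_linear frameJ (hd ξ)]
    exact lieD_congr isOpen_posDet
      (fun y hy => ((hI y hy).frameJ_map ξ hξ).trans (one_smul _ _)) hx ζ
  · intro ζ ξ η _ hξ hη
    rw [add_comm, ← lieD_bilinear frameMetric (hd ξ) (hd η),
      ← lieD_const ζ (frameMetric ξ η) x]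
    exact lieD_congr isOpen_posDet (fun y hy => (hI y hy).metric_map ξ η hξ hη) hx ζ

/-- The differential of an isometry preserves the curvature. -/
lemma leftDer_curv (hF : IsSmooth F) (hP : Preserves 1 F) {x : Mat × Mat}
    (hx : x ∈ posDet) {υ ζ ξ : Mat × Mat} (hυ : Traceless υ) (hζ : Traceless ζ)
    (hξ : Traceless ξ) :
    leftDer F x (br (curv υ ζ) ξ) = br (curv (leftDer F x υ) (leftDer F x ζ)) (leftDer F x ξ) := by
  have hd : ∀ ξ, DifferentiableAt ℝ (fun y => leftDer F y ξ) x := fun ξ =>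
    differentiableAt_of_contDiffOn (contDiffOn_leftDer hF ξ) hx
  have h1 : ∀ {ζ ξ}, Traceless ζ → Traceless ξ → lieD ζ (fun y => leftDer F y ξ) x
        = leftDer F x (br (diagPart ζ) ξ) - br (diagPart (leftDer F x ζ)) (leftDer F x ξ) :=
    fun h k => (lieD_leftDer_and_torsion hF hP hx h k).1
  -- The first-order formula is differentiated once more; the curvature identity is its
  -- integrability condition.
  have h2 : ∀ {υ ζ}, Traceless υ → Traceless ζ → lieD υ (lieD ζ (fun y => leftDer F y ξ)) x
      = lieD υ (fun y => leftDer F y (br (diagPart ζ) ξ)) x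
        - (br (diagPart (leftDer F x ζ)) (lieD υ (fun y => leftDer F y ξ) x)
          + br (diagPart (lieD υ (fun y => leftDer F y ζ) x)) (leftDer F x ξ)) := by
    intro υ ζ _ hζ
    rw [lieD_congr isOpen_posDet (fun y hy => (lieD_leftDer_and_torsion hF hP hy hζ hξ).1) hx υ]
    have hb := lieD_bilinear (br ∘ₗ diagPart) (hd ζ) (hd ξ) υ
    have hs : DifferentiableAt ℝ
        (fun y => (br ∘ₗ diagPart) (leftDer F y ζ) (leftDer F y ξ)) x :=
      differentiableAt_of_contDiffOn (contDiffOn_bilinear (br ∘ₗ diagPart)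
        (contDiffOn_leftDer hF ζ) (contDiffOn_leftDer hF ξ)) hx
    have := (hd (br (diagPart ζ) ξ)).hasFDerivAt.sub hs.hasFDerivAt
    unfold lieD at hb ⊢
    erw [this.fderiv]
    exact congrArg₂ (· - ·) rfl hb
  have h3 := lieD_comm isOpen_posDet (contDiffOn_leftDer hF ξ) hx υ ζ
  rw [← br_apply, h1 (traceless_br υ ζ) hξ, h2 hυ hζ, h2 hζ hυ, h1 hυ (traceless_br _ _),
    h1 hυ hξ, h1 hυ hζ, h1 hζ (traceless_br _ _), h1 hζ hξ, h1 hζ hυ] at h3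
  have ht := (lieD_leftDer_and_torsion hF hP hx hυ hζ).2
  generalize leftDer F x = A at *
  -- Integrability involves the diagonal part of A[υ, ζ], but the curvature at the target involves
  -- that of [Aυ, Aζ]. Preservation of torsion exchanges the two.
  have ht' := congrArg diagPart ht
  simp only [torsion, map_add, map_sub, diagPart_br] at ht'
  simp only [curv, map_sub, LinearMap.sub_apply, diagPart_br,
    br_br (diagPart _) (diagPart _)] at h3 ht' ⊢
  have h4 := congrArg (fun v => br v (A ξ)) ht'
  simp only [map_add, map_sub, LinearMap.add_apply, LinearMap.sub_apply,
    br_br (diagPart _) (diagPart _)] at h4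
  rw [← sub_eq_zero] at h3 h4 ⊢
  rw [← sub_zero (0 : Mat × Mat)]
  nth_rw 1 [← h3]
  rw [← h4]
  abel

end Local

/-! ### Intertwiners and automorphisms of sl(2, ℝ). -/

section SlTwo

/-- The nilpotent matrix with upper right entry `1`. -/
def eMat : Mat := !![0, 1; 0, 0]

/-- The nilpotent matrix with lower left entry `1`. -/
def fMat : Mat := !![0, 0; 1, 0]

lemma trace_iMat : iMat.trace = 0 := by simp [iMat, Matrix.trace_fin_two]
lemma trace_eMat : eMat.trace = 0 := by simp [eMat, Matrix.trace_fin_two]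
lemma trace_fMat : fMat.trace = 0 := by simp [fMat, Matrix.trace_fin_two]

lemma iMat_comm_eMat : iMat * eMat - eMat * iMat = (2 : ℝ) • eMat := by
  ext i j; fin_cases i <;> fin_cases j <;> simp [iMat, eMat]; norm_num

lemma iMat_comm_fMat : iMat * fMat - fMat * iMat = (-2 : ℝ) • fMat := by
  ext i j; fin_cases i <;> fin_cases j <;> simp [iMat, fMat]; norm_num

lemma eMat_comm_fMat : eMat * fMat - fMat * eMat = iMat := by
  ext i j; fin_cases i <;> fin_cases j <;> simp [iMat, eMat, fMat]

lemma traceless_decomp {X : Mat} (h : X.trace = 0) :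
    X = X 0 0 • iMat + X 0 1 • eMat + X 1 0 • fMat := by
  rw [Matrix.trace_fin_two] at h
  ext i j; fin_cases i <;> fin_cases j <;> simp [iMat, eMat, fMat]
  linarith

lemma trace_comm (X Y : Mat) : (X * Y - Y * X).trace = 0 := by
  rw [Matrix.trace_sub, Matrix.trace_mul_comm, sub_self]

lemma eq_zero_of_comm {Z : Mat} (hZ : Z.trace = 0)
    (h : ∀ Y : Mat, Y.trace = 0 → Z * Y - Y * Z = 0) : Z = 0 := by
  have h1 := h eMat trace_eMat
  have h2 := h fMat trace_fMat
  rw [Matrix.trace_fin_two] at hZ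
  have a := congrFun (congrFun h1 0) 0
  have b := congrFun (congrFun h1 0) 1
  have c := congrFun (congrFun h2 0) 0
  simp [eMat, fMat, Matrix.mul_apply, Fin.sum_univ_two, Matrix.vecMul, dotProduct] at a b c
  ext i j; fin_cases i <;> fin_cases j <;> simp <;> linarith

/-- The polarized Cayley–Hamilton identity. -/
lemma anticomm_of_traceless {X Y : Mat} (hX : X.trace = 0) (hY : Y.trace = 0) :
    X * Y + Y * X = (X * Y).trace • 1 := by
  rw [Matrix.trace_fin_two] at *
  have h1 : X 1 1 = -X 0 0 := by linarith
  have h2 : Y 1 1 = -Y 0 0 := by linarith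
  ext i j; fin_cases i <;> fin_cases j <;>
    simp [Matrix.mul_apply, Fin.sum_univ_two, h1, h2] <;> ring

/-- The eigenvector relations in a two-dimensional representation of `sl(2)`. -/
lemma mul_of_comm {H X : Mat} (hH : H.trace = 0) (hX : X.trace = 0) {c : ℝ} (hc : c ≠ 0)
    (h : H * X - X * H = c • X) : H * X = (c / 2) • X ∧ X * X = 0 := by
  -- Replacing c X by [H, X] and using cyclicity kills the traces of X² and HX. Then X² = 0, and H
  -- and X anticommute, so HX is half of [H, X].
  have h1 : (X * X).trace = 0 := by
    have : c • (X * X).trace = 0 := by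
      rw [← Matrix.trace_smul, ← smul_mul_assoc, ← h, sub_mul, Matrix.trace_sub,
        Matrix.trace_mul_comm (X * H) X, ← mul_assoc X X H, Matrix.trace_mul_comm (X * X) H,
        mul_assoc H X X, sub_self]
    exact (smul_eq_zero.1 this).resolve_left hc
  have h2 : (H * X).trace = 0 := by
    have : c • (H * X).trace = 0 := by
      rw [← Matrix.trace_smul, ← mul_smul_comm, ← h, mul_sub, Matrix.trace_sub,
        Matrix.trace_mul_comm H (X * H), ← mul_assoc H H X, Matrix.trace_mul_comm (H * H) X,
        mul_assoc X H H, sub_self]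
    exact (smul_eq_zero.1 this).resolve_left hc
  have h3 := anticomm_of_traceless hX hX
  have h4 := anticomm_of_traceless hH hX
  rw [h1, zero_smul] at h3
  rw [h2, zero_smul] at h4
  constructor
  · have : H * X = (1 / 2 : ℝ) • ((H * X - X * H) + (H * X + X * H)) := by module
    rw [this, h, h4]
    module
  · have : X * X = (1 / 2 : ℝ) • (X * X + X * X) := by module
    rw [this, h3, smul_zero]

/-- Every `sl(2)`-triple of real `2 × 2` matrices is conjugate to the standard one. -/
lemma exists_conj_of_triple {H E F : Mat} (hH : H.trace = 0) (hE : E.trace = 0) (hF : F.trace = 0)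
    (hHE : H * E - E * H = (2 : ℝ) • E) (hHF : H * F - F * H = (-2 : ℝ) • F)
    (hEF : E * F - F * E = H) (hne : E ≠ 0) :
    ∃ g : Mat, g.det ≠ 0 ∧ g * iMat = H * g ∧ g * eMat = E * g ∧ g * fMat = F * g := by
  obtain ⟨a1, a2⟩ := mul_of_comm hH hE two_ne_zero hHE
  obtain ⟨b1, b2⟩ := mul_of_comm hH hF (by norm_num) hHF
  have a1' : H * E = E := by rw [a1]; norm_num
  have b1' : H * F = -F := by rw [b1]; norm_num
  have hEFE : E * F * E = E := by
    have : E * F = H + F * E := by rw [← hEF]; abel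
    rw [this, add_mul, a1', mul_assoc, a2, mul_zero, add_zero]
  obtain ⟨j, hj⟩ : ∃ j, ∃ i, E i j ≠ 0 := by
    by_contra! hcon
    exact hne (by ext i j; exact hcon j i)
  obtain ⟨i, hij⟩ := hj
  -- With v the j-th basis vector, P and Q have v as first and second column, so g = EP + FEQ has
  -- columns Ev and FEv. Here Ev is a highest weight vector, nonzero by the choice of j.
  set P : Mat := Matrix.single j 0 1 with hP
  set Q : Mat := Matrix.single j 1 1 with hQ
  have p1 : P * iMat = P := by
    ext k l; fin_cases l <;> simp [hP, iMat, Matrix.mul_apply, Fin.sum_univ_two, Matrix.single]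
  have p2 : P * eMat = Q := by
    ext k l; fin_cases l <;> simp [hP, hQ, eMat, Matrix.mul_apply, Fin.sum_univ_two, Matrix.single]
  have p3 : P * fMat = 0 := by
    ext k l; fin_cases l <;> simp [hP, fMat, Matrix.mul_apply, Fin.sum_univ_two, Matrix.single]
  have q1 : Q * iMat = -Q := by
    ext k l; fin_cases l <;> simp [hQ, iMat, Matrix.mul_apply, Fin.sum_univ_two, Matrix.single]
    split_ifs <;> simp
  have q2 : Q * eMat = 0 := by
    ext k l; fin_cases l <;> simp [hQ, eMat, Matrix.mul_apply, Fin.sum_univ_two, Matrix.single]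
  have q3 : Q * fMat = P := by
    ext k l; fin_cases l <;> simp [hP, hQ, fMat, Matrix.mul_apply, Fin.sum_univ_two, Matrix.single]
  have gi : (E * P + F * E * Q) * iMat = H * (E * P + F * E * Q) := by
    rw [add_mul, mul_add, mul_assoc E, p1, mul_assoc (F * E), q1, ← mul_assoc H, a1',
      ← mul_assoc H, ← mul_assoc H, b1']
    simp
  have ge : (E * P + F * E * Q) * eMat = E * (E * P + F * E * Q) := by
    rw [add_mul, mul_add, mul_assoc E, p2, mul_assoc (F * E), q2, ← mul_assoc E, a2,
      ← mul_assoc E, ← mul_assoc E, hEFE]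
    simp
  have gf : (E * P + F * E * Q) * fMat = F * (E * P + F * E * Q) := by
    rw [add_mul, mul_add, mul_assoc E, p3, mul_assoc (F * E), q3, ← mul_assoc F E,
      ← mul_assoc F, ← mul_assoc F, b2]
    simp
  refine ⟨E * P + F * E * Q, fun hdet => ?_, gi, ge, gf⟩
  have g0 : (E * P + F * E * Q) i 0 = E i j := by
    simp [hP, hQ, Matrix.mul_apply, Matrix.single, Fin.sum_univ_two]
  set g : Mat := E * P + F * E * Q with hg
  -- The intertwining relations make the kernel of g stable under the standard triple. Applying
  -- `eMat` to z isolates the first column of g, whose i-th entry is not zero.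
  obtain ⟨z, hz, hgz⟩ := Matrix.exists_mulVec_eq_zero_iff.2 hdet
  have k1 : g.mulVec (iMat.mulVec z) = 0 := by
    rw [Matrix.mulVec_mulVec, gi, ← Matrix.mulVec_mulVec, hgz, Matrix.mulVec_zero]
  have k2 : g.mulVec (fMat.mulVec z) = 0 := by
    rw [Matrix.mulVec_mulVec, gf, ← Matrix.mulVec_mulVec, hgz, Matrix.mulVec_zero]
  have k3 : g.mulVec (eMat.mulVec z) = 0 := by
    rw [Matrix.mulVec_mulVec, ge, ← Matrix.mulVec_mulVec, hgz, Matrix.mulVec_zero]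
  have l0 := congrFun hgz i
  have l1 := congrFun k1 i
  have l3 := congrFun k3 i
  simp [Matrix.mulVec, dotProduct, Fin.sum_univ_two, iMat, eMat] at l0 l1 l3
  rw [g0] at l0 l1 l3
  have z1 : z 1 = 0 := l3.resolve_left hij
  have z0 : z 0 = 0 := by
    rw [z1] at l0
    simpa [hij] using l0
  exact hz (by ext k; fin_cases k <;> simp [z0, z1])

lemma exists_conj_normalized {g : Mat} (hg : g.det ≠ 0) :
    ∃ (s : SL(2, ℝ)) (t : Mat) (c : ℝ), (t = 1 ∨ t = iMat) ∧ c ≠ 0 ∧ g = c • ((s : Mat) * t) := by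
  rcases lt_or_gt_of_ne hg with h | h
  · have h1 : 0 < (g * iMat).det := by
      rw [Matrix.det_mul]
      simp [iMat, Matrix.det_fin_two]
      rw [Matrix.det_fin_two] at h
      linarith
    refine ⟨rescaleFactor (g * iMat), iMat, Real.sqrt (g * iMat).det, Or.inr rfl,
      (Real.sqrt_pos.2 h1).ne', ?_⟩
    rw [coe_rescaleFactor h1, smul_mul_assoc, smul_smul, mul_inv_cancel₀ (Real.sqrt_pos.2 h1).ne',
      one_smul, mul_assoc, iMat_sq, mul_one]
  · refine ⟨rescaleFactor g, 1, Real.sqrt g.det, Or.inl rfl, (Real.sqrt_pos.2 h).ne', ?_⟩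
    rw [coe_rescaleFactor h, mul_one, smul_smul, mul_inv_cancel₀ (Real.sqrt_pos.2 h).ne', one_smul]

/-- A linear map intertwining the adjoint representation with a twist is, up to a factor,
conjugation. -/
lemma schur_conj {N φ : Mat →ₗ[ℝ] Mat} (hNt : ∀ X, X.trace = 0 → (N X).trace = 0)
    (hN : ∀ k η, k.trace = 0 → η.trace = 0 → N (k * η - η * k) = φ k * N η - N η * φ k)
    {P Q : Mat} (hPQ : P * Q = 1) (hφ : ∀ k, k.trace = 0 → φ k = P * k * Q) :
    ∃ c : ℝ, ∀ X, X.trace = 0 → N X = c • (P * X * Q) := by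
  have hQP : Q * P = 1 := mul_eq_one_comm.1 hPQ
  set Y : Mat := Q * N iMat * P with hY
  have hNY : N iMat = P * Y * Q := by
    simp only [hY, mul_assoc, hPQ, mul_one]
    rw [← mul_assoc, hPQ, one_mul]
  have hconj : ∀ k : Mat, P * k * Q * (P * Y * Q) - P * Y * Q * (P * k * Q)
      = P * (k * Y - Y * k) * Q := by
    intro k
    have : ∀ a b : Mat, P * a * Q * (P * b * Q) = P * (a * b) * Q := fun a b => by
      rw [show P * a * Q * (P * b * Q) = P * a * (Q * P) * b * Q by simp only [mul_assoc], hQP]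
      simp only [mul_assoc, one_mul]
    rw [this, this, mul_sub, sub_mul]
  have hcancel : ∀ Z : Mat, P * Z * Q = 0 → Z = 0 := fun Z hZ => by
    have : Z = Q * (P * Z * Q) * P := by
      rw [show Q * (P * Z * Q) * P = Q * P * Z * (Q * P) by simp only [mul_assoc], hQP]
      simp
    rw [this, hZ]; simp
  -- N(i), conjugated back, commutes with i and so is a multiple c i. The brackets of e and f with i
  -- then determine N on the rest of sl(2, ℝ).
  have h1 : iMat * Y - Y * iMat = 0 := by
    apply hcancel
    rw [← hconj, ← hφ _ trace_iMat, ← hNY, ← hN _ _ trace_iMat trace_iMat, sub_self, map_zero]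
  have hYt : Y.trace = 0 := by
    rw [hY, Matrix.trace_mul_comm, ← mul_assoc, hPQ, one_mul]
    exact hNt _ trace_iMat
  have hYc : Y = Y 0 0 • iMat := by
    have a := congrFun (congrFun h1 0) 1
    have b := congrFun (congrFun h1 1) 0
    simp [iMat, Matrix.mul_apply, Fin.sum_univ_two, Matrix.vecMul, dotProduct] at a b
    have a' : Y 0 1 = 0 := by linarith
    have b' : Y 1 0 = 0 := by linarith
    conv_lhs => rw [traceless_decomp hYt, a', b']
    simp
  set c := Y 0 0
  have key : ∀ k : Mat, k.trace = 0 → N (k * iMat - iMat * k)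
      = c • (P * (k * iMat - iMat * k) * Q) := by
    intro k hk
    rw [hN _ _ hk trace_iMat, hφ _ hk, hNY, hconj, hYc]
    simp only [mul_smul_comm, smul_mul_assoc, ← smul_sub]
  have hi : N iMat = c • (P * iMat * Q) := by
    rw [hNY, hYc]
    simp
  have he : N eMat = c • (P * eMat * Q) := by
    have := key eMat trace_eMat
    rw [← neg_sub, iMat_comm_eMat] at this
    simp only [map_neg, map_smul, mul_neg, neg_mul, mul_smul_comm, smul_mul_assoc, smul_neg,
      neg_inj] at this
    rw [smul_comm c] at this
    exact smul_right_injective _ (two_ne_zero (α := ℝ)) this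
  have hf : N fMat = c • (P * fMat * Q) := by
    have := key fMat trace_fMat
    rw [← neg_sub, iMat_comm_fMat] at this
    simp only [map_neg, map_smul, mul_neg, neg_mul, mul_smul_comm, smul_mul_assoc, smul_neg,
      neg_inj] at this
    rw [smul_comm c] at this
    exact smul_right_injective _ (by norm_num : (-2 : ℝ) ≠ 0) this
  refine ⟨c, fun X hX => ?_⟩
  rw [traceless_decomp hX]
  simp only [map_add, map_smul, hi, he, hf, mul_add, add_mul, mul_smul_comm, smul_mul_assoc]
  module

/-- The traceless matrices, as a submodule. -/
def slSubmodule : Submodule ℝ Mat := LinearMap.ker (Matrix.traceLinearMap (Fin 2) ℝ ℝ)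

lemma mem_slSubmodule {X : Mat} : X ∈ slSubmodule ↔ X.trace = 0 := by
  simp [slSubmodule]

/-- The kernel of N on sl(2, ℝ) is an ideal, and bracketing an element twice with e or with f
isolates its coordinates, so the kernel is zero. Surjectivity follows by dimension. -/
lemma intertwiner_surjective {N φ : Mat →ₗ[ℝ] Mat} (hNt : ∀ X, X.trace = 0 → (N X).trace = 0)
    (hN : ∀ k η, k.trace = 0 → η.trace = 0 → N (k * η - η * k) = φ k * N η - N η * φ k)
    (h0 : N iMat ≠ 0) {Y : Mat} (hY : Y.trace = 0) : ∃ X : Mat, X.trace = 0 ∧ N X = Y := by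
  have hker : ∀ k η : Mat, k.trace = 0 → η.trace = 0 → N η = 0 → N (k * η - η * k) = 0 := by
    intro k η hk hη h
    rw [hN k η hk hη, h]; simp
  have hzero : ∀ X : Mat, X.trace = 0 → N X = 0 → X = 0 := by
    intro X hX h
    have hNe : N eMat ≠ 0 := fun h => h0 <| by
      have := hker fMat eMat trace_fMat trace_eMat h
      rwa [← neg_sub, eMat_comm_fMat, map_neg, neg_eq_zero] at this
    have hNf : N fMat ≠ 0 := fun h => h0 <| by
      have := hker eMat fMat trace_eMat trace_fMat h
      rwa [eMat_comm_fMat] at this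
    have htr := hX
    rw [Matrix.trace_fin_two] at htr
    have hc : X 1 0 = 0 := by
      have := hker eMat _ trace_eMat (trace_comm _ _) (hker eMat X trace_eMat hX h)
      have e : eMat * (eMat * X - X * eMat) - (eMat * X - X * eMat) * eMat
          = (-2 * X 1 0) • eMat := by
        ext i j; fin_cases i <;> fin_cases j <;>
          simp [eMat, Matrix.mul_apply, Fin.sum_univ_two, Matrix.vecMul, dotProduct]
        ring
      rw [e, map_smul] at this
      have := (smul_eq_zero.1 this).resolve_right hNe
      linarith
    have hb : X 0 1 = 0 := by
      have := hker fMat _ trace_fMat (trace_comm _ _) (hker fMat X trace_fMat hX h)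
      have e : fMat * (fMat * X - X * fMat) - (fMat * X - X * fMat) * fMat
          = (-2 * X 0 1) • fMat := by
        ext i j; fin_cases i <;> fin_cases j <;>
          simp [fMat, Matrix.mul_apply, Fin.sum_univ_two, Matrix.vecMul, dotProduct]
        ring
      rw [e, map_smul] at this
      have := (smul_eq_zero.1 this).resolve_right hNf
      linarith
    have e := traceless_decomp hX
    rw [hb, hc, zero_smul, zero_smul, add_zero, add_zero] at e
    rw [e, map_smul] at h
    rw [e, (smul_eq_zero.1 h).resolve_right h0, zero_smul]
  let B : slSubmodule →ₗ[ℝ] slSubmodule := N.restrict (fun X hX =>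
    mem_slSubmodule.2 (hNt X (mem_slSubmodule.1 hX)))
  have hinj : Function.Injective B := by
    rw [← LinearMap.ker_eq_bot, LinearMap.ker_eq_bot']
    rintro ⟨u, hu⟩ h
    exact Subtype.ext (hzero u (mem_slSubmodule.1 hu) (congrArg Subtype.val h))
  obtain ⟨⟨u, hu⟩, h⟩ := LinearMap.injective_iff_surjective.1 hinj ⟨Y, mem_slSubmodule.2 hY⟩
  exact ⟨u, mem_slSubmodule.1 hu, congrArg Subtype.val h⟩

/-- The twist of a nonzero intertwiner of the adjoint representation is inner in `GL(2)`. -/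
lemma exists_conj_of_intertwiner {N φ : Mat →ₗ[ℝ] Mat}
    (hNt : ∀ X, X.trace = 0 → (N X).trace = 0) (hφt : ∀ X, X.trace = 0 → (φ X).trace = 0)
    (hN : ∀ k η, k.trace = 0 → η.trace = 0 → N (k * η - η * k) = φ k * N η - N η * φ k)
    (h0 : N iMat ≠ 0) :
    ∃ (s : SL(2, ℝ)) (t : Mat), (t = 1 ∨ t = iMat) ∧
      ∀ k, k.trace = 0 → φ k = (s : Mat) * t * k * (t * (s⁻¹ : SL(2, ℝ))) := by
  -- By the Jacobi identity both sides have the same bracket with every N η. These exhaust sl(2, ℝ),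
  -- whose centre is trivial, so φ is a Lie algebra homomorphism.
  have hφ : ∀ k l : Mat, k.trace = 0 → l.trace = 0 →
      φ (k * l - l * k) = φ k * φ l - φ l * φ k := by
    intro k l hk hl
    rw [← sub_eq_zero]
    refine eq_zero_of_comm ?_ fun Y hY => ?_
    · rw [Matrix.trace_sub, hφt _ (trace_comm k l), trace_comm, sub_zero]
    · obtain ⟨η, hη, rfl⟩ := intertwiner_surjective hNt hN h0 hY
      have h1 := hN _ η (trace_comm k l) hη
      have h2 : N ((k * l - l * k) * η - η * (k * l - l * k))
          = N (k * (l * η - η * l) - (l * η - η * l) * k)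
            - N (l * (k * η - η * k) - (k * η - η * k) * l) := by
        rw [← map_sub]
        congr 1
        noncomm_ring
      rw [hN k _ hk (trace_comm _ _), hN l _ hl (trace_comm _ _), hN l η hl hη, hN k η hk hη,
        h1] at h2
      have h3 : (φ (k * l - l * k) - (φ k * φ l - φ l * φ k)) * N η
          - N η * (φ (k * l - l * k) - (φ k * φ l - φ l * φ k))
          = (φ (k * l - l * k) * N η - N η * φ (k * l - l * k))
            - ((φ k * φ l - φ l * φ k) * N η - N η * (φ k * φ l - φ l * φ k)) := by
        noncomm_ring
      rw [h3, h2]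
      noncomm_ring
  have hE : φ eMat ≠ 0 := fun h => h0 <| by
    have := hN eMat fMat trace_eMat trace_fMat
    rwa [eMat_comm_fMat, h, zero_mul, mul_zero, sub_zero] at this
  obtain ⟨g, hg, g1, g2, g3⟩ := exists_conj_of_triple (hφt _ trace_iMat) (hφt _ trace_eMat)
    (hφt _ trace_fMat) (by rw [← hφ _ _ trace_iMat trace_eMat, iMat_comm_eMat, map_smul])
    (by rw [← hφ _ _ trace_iMat trace_fMat, iMat_comm_fMat, map_smul])
    (by rw [← hφ _ _ trace_eMat trace_fMat, eMat_comm_fMat]) hE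
  obtain ⟨s, t, c, ht, hc, rfl⟩ := exists_conj_normalized hg
  refine ⟨s, t, ht, fun k hk => ?_⟩
  have htt : t * t = 1 := by
    rcases ht with rfl | rfl
    · rw [one_mul]
    · exact iMat_sq
  have hss : (s : Mat) * ((s⁻¹ : SL(2, ℝ)) : Mat) = 1 := by
    rw [← Matrix.SpecialLinearGroup.coe_mul, mul_inv_cancel, Matrix.SpecialLinearGroup.coe_one]
  have hgk : (s : Mat) * t * k = φ k * ((s : Mat) * t) := by
    apply smul_right_injective _ hc
    simp only [smul_mul_assoc, mul_smul_comm] at g1 g2 g3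
    change c • _ = c • _
    rw [traceless_decomp hk]
    simp only [map_add, map_smul, mul_add, add_mul, smul_add, mul_smul_comm, smul_mul_assoc,
      smul_comm c, g1, g2, g3]
  rw [hgk, show φ k * ((s : Mat) * t) * (t * ((s⁻¹ : SL(2, ℝ)) : Mat))
    = φ k * ((s : Mat) * (t * t) * ((s⁻¹ : SL(2, ℝ)) : Mat)) by simp only [mul_assoc], htt, mul_one,
    hss, mul_one]

end SlTwo

/-! ### Classification of the possible differentials. -/

section Classification

lemma curv_inl (α γ : Mat) : curv (α, 0) (γ, 0)
    = (-(2 / 9) : ℝ) • (α * γ - γ * α, α * γ - γ * α) := by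
  simp only [curv, diagPart_apply, br_mk, Prod.mk_sub_mk, Prod.smul_mk, Prod.mk.injEq, mul_zero,
    sub_zero, add_zero, smul_mul_assoc, mul_smul_comm, and_self]
  module

/-- The coefficients are those of one third of the conjugate of (a + bω)(c + dω). -/
lemma torsion_mul_smul (α γ : Mat) (a b c d : ℝ) : torsion (a • α, b • α) (c • γ, d • γ)
    = (((a * c - b * c - a * d) / 3) • (α * γ - γ * α),
      ((b * d - b * c - a * d) / 3) • (α * γ - γ * α)) := by
  simp only [torsion, diagPart_apply, br_mk, Prod.mk_sub_mk, Prod.mk_add_mk, Prod.mk.injEq,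
    mul_add, add_mul, smul_mul_assoc, mul_smul_comm]
  constructor <;> module

lemma curv_eq (ξ η : Mat × Mat) : ∃ m : Mat, m.trace = 0 ∧ curv ξ η = (m, m) := by
  refine ⟨(curv ξ η).1, ?_, rfl⟩
  exact ((traceless_br _ _).sub (traceless_br _ _).diagPart).1

lemma inn_conj {P Q : Mat} (hQP : Q * P = 1) {a b : Mat} (ha : a.trace = 0) :
    inn (P * a * Q) (P * b * Q) = inn a b := by
  have h1 : (P * a * Q).trace = 0 := by
    rw [Matrix.trace_mul_comm, ← mul_assoc, hQP, one_mul, ha]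
  have h2 : (P * a * Q * (P * b * Q)).trace = (a * b).trace := by
    rw [show P * a * Q * (P * b * Q) = P * a * (Q * P) * b * Q by simp only [mul_assoc], hQP,
      Matrix.trace_mul_comm, mul_one,
      show Q * (P * a * b) = Q * P * a * b by simp only [mul_assoc], hQP, one_mul]
  unfold inn
  rw [adjugate_eq, adjugate_eq, h1, ha, zero_smul, zero_sub, zero_sub, neg_mul (P * a * Q),
    neg_mul a, Matrix.trace_neg, Matrix.trace_neg, h2]

lemma frameMetric_smul (a b c d : ℝ) (X Y : Mat) :
    frameMetric (a • X, b • X) (c • Y, d • Y)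
      = (2 / 3 * (a * c + b * d) - 1 / 3 * (b * c + a * d)) * inn X Y := by
  simp only [frameMetric_apply, inn_eq, Matrix.smul_apply, smul_eq_mul]
  ring

lemma inn_iMat : inn iMat iMat = 1 := by
  norm_num [inn_eq, iMat]

lemma frameMetric_iMat : frameMetric (iMat, 0) (iMat, 0) = 2 / 3 := by
  have := frameMetric_smul 1 0 1 0 iMat iMat
  simp only [one_smul, zero_smul, inn_iMat] at this
  rw [this]
  norm_num

lemma FrameIsometry.rot_map {A : (Mat × Mat) →ₗ[ℝ] (Mat × Mat)} (hA : FrameIsometry 1 A)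
    {ξ : Mat × Mat} (h : Traceless ξ) : A (rot ξ) = rot (A ξ) := by
  have h1 := hA.frameJ_map ξ h
  simp only [frameJ, LinearMap.add_apply, LinearMap.id_apply, LinearMap.smul_apply, map_add,
    map_smul, one_smul, add_right_inj] at h1
  exact smul_right_injective _ (two_ne_zero (α := ℝ)) h1

/-- The matrices `1` and `i`, which represent the components of `GL(2, ℝ)`. -/
def IsComponentRep (t : Mat) : Prop := t = 1 ∨ t = iMat

lemma IsComponentRep.mul_self {t : Mat} (h : IsComponentRep t) : t * t = 1 := by
  rcases h with rfl | rfl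
  · rw [one_mul]
  · exact iMat_sq

/-- The conjugation of `X` by `s t`. -/
def conjMat (s : SL(2, ℝ)) (t X : Mat) : Mat := (s : Mat) * t * X * (t * (s⁻¹ : SL(2, ℝ)))

lemma conj_inverse (s : SL(2, ℝ)) {t : Mat} (ht : IsComponentRep t) :
    t * ((s⁻¹ : SL(2, ℝ)) : Mat) * ((s : Mat) * t) = 1 := by
  rw [show t * ((s⁻¹ : SL(2, ℝ)) : Mat) * ((s : Mat) * t)
    = t * (((s⁻¹ : SL(2, ℝ)) : Mat) * (s : Mat)) * t by simp only [mul_assoc],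
    ← Matrix.SpecialLinearGroup.coe_mul, inv_mul_cancel, Matrix.SpecialLinearGroup.coe_one,
    mul_one, ht.mul_self]

lemma conjMat_sub (s : SL(2, ℝ)) (t X Y : Mat) :
    conjMat s t (X - Y) = conjMat s t X - conjMat s t Y := by
  simp only [conjMat, mul_sub, sub_mul]

lemma conjMat_mul (s : SL(2, ℝ)) {t : Mat} (ht : IsComponentRep t) (X Y : Mat) :
    conjMat s t (X * Y) = conjMat s t X * conjMat s t Y := by
  unfold conjMat
  rw [show (s : Mat) * t * X * (t * ((s⁻¹ : SL(2, ℝ)) : Mat)) *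
    ((s : Mat) * t * Y * (t * ((s⁻¹ : SL(2, ℝ)) : Mat)))
    = (s : Mat) * t * X * (t * ((s⁻¹ : SL(2, ℝ)) : Mat) * ((s : Mat) * t)) * Y
      * (t * ((s⁻¹ : SL(2, ℝ)) : Mat)) by simp only [mul_assoc], conj_inverse s ht, mul_one]
  simp only [mul_assoc]

/-- The pairs `(c, d)` for which `c + d ω` is a cube root of unity. -/
def IsCubeRoot (c d : ℝ) : Prop := (c = 1 ∧ d = 0) ∨ (c = 0 ∧ d = 1) ∨ (c = -1 ∧ d = -1)

/-- A linear isometry which commutes with `J` and preserves the torsion and the curvature is a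
conjugation times a cube root of unity. -/
lemma FrameIsometry.classify {A : (Mat × Mat) →ₗ[ℝ] (Mat × Mat)} (hA : FrameIsometry 1 A)
    (ht : ∀ ζ ξ, Traceless ζ → Traceless ξ → A (torsion ζ ξ) = torsion (A ζ) (A ξ))
    (hc : ∀ υ ζ ξ, Traceless υ → Traceless ζ → Traceless ξ →
      A (br (curv υ ζ) ξ) = br (curv (A υ) (A ζ)) (A ξ)) :
    ∃ (s : SL(2, ℝ)) (t : Mat) (c d : ℝ), IsComponentRep t ∧ IsCubeRoot c d ∧
      ∀ X : Mat, X.trace = 0 → A (X, 0) = (c • conjMat s t X, d • conjMat s t X) := by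
  have hinl : ∀ X : Mat, X.trace = 0 → Traceless (X, 0) := fun X hX => ⟨hX, by simp⟩
  -- Curvature on the first factor is -2/9 times the diagonal bracket, and every curvature value is
  -- diagonal. So A turns the adjoint action of a commutator into that of some diagonal (m, m); the
  -- factor -9/2 undoes -2/9.
  have hcomm : ∀ α γ : Mat, α.trace = 0 → γ.trace = 0 → ∃ m : Mat, m.trace = 0 ∧
      ∀ η : Mat, η.trace = 0 →
        A ((α * γ - γ * α) * η - η * (α * γ - γ * α), 0) = br (m, m) (A (η, 0)) := by
    intro α γ hα hγ
    obtain ⟨m, hm, hmc⟩ := curv_eq (A (α, 0)) (A (γ, 0))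
    refine ⟨(-(9 / 2) : ℝ) • m, by rw [Matrix.trace_smul, hm, smul_zero], fun η hη => ?_⟩
    have h1 := hc _ _ _ (hinl α hα) (hinl γ hγ) (hinl η hη)
    rw [hmc, curv_inl, map_smul, LinearMap.smul_apply, map_smul, br_mk, mul_zero, zero_mul,
      sub_zero] at h1
    have h2 : (((-(9 / 2) : ℝ) • m, (-(9 / 2) : ℝ) • m) : Mat × Mat)
        = (-(9 / 2) : ℝ) • (m, m) := rfl
    rw [h2, map_smul, LinearMap.smul_apply, ← h1, smul_smul]
    norm_num
  have hsmul : ∀ (r : ℝ) (k : Mat), (∃ m : Mat, m.trace = 0 ∧ ∀ η : Mat, η.trace = 0 →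
        A (k * η - η * k, 0) = br (m, m) (A (η, 0))) → ∃ m : Mat, m.trace = 0 ∧
      ∀ η : Mat, η.trace = 0 →
        A ((r • k) * η - η * (r • k), 0) = br (m, m) (A (η, 0)) := by
    rintro r k ⟨m, hm, h⟩
    refine ⟨r • m, by rw [Matrix.trace_smul, hm, smul_zero], fun η hη => ?_⟩
    have h2 : ((r • m, r • m) : Mat × Mat) = r • (m, m) := rfl
    have h3 : (((r • k) * η - η * (r • k), 0) : Mat × Mat) = r • (k * η - η * k, 0) := by
      simp [smul_sub]
    rw [h2, h3, map_smul, map_smul, LinearMap.smul_apply, h η hη]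
  obtain ⟨mi, hmi, hi⟩ := hcomm eMat fMat trace_eMat trace_fMat
  rw [eMat_comm_fMat] at hi
  obtain ⟨me, hme, he⟩ := hsmul (1 / 2) _ (hcomm iMat eMat trace_iMat trace_eMat)
  rw [iMat_comm_eMat, smul_smul, show (1 / 2 : ℝ) * 2 = 1 by norm_num, one_smul] at he
  obtain ⟨mf, hmf, hf⟩ := hsmul (-(1 / 2)) _ (hcomm iMat fMat trace_iMat trace_fMat)
  rw [iMat_comm_fMat, smul_smul, show (-(1 / 2) : ℝ) * (-2) = 1 by norm_num, one_smul] at hf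
  -- As i, e and f are multiples of commutators, choosing m for each of them defines the twist φ
  -- linearly.
  let φ : Mat →ₗ[ℝ] Mat :=
    { toFun := fun X => X 0 0 • mi + X 0 1 • me + X 1 0 • mf
      map_add' := fun X Y => by simp only [Matrix.add_apply]; module
      map_smul' := fun r X => by
        simp only [Matrix.smul_apply, smul_eq_mul, RingHom.id_apply]; module }
  have hφ : ∀ X, φ X = X 0 0 • mi + X 0 1 • me + X 1 0 • mf := fun _ => rfl
  have hφt : ∀ X, X.trace = 0 → (φ X).trace = 0 := fun X _ => by
    simp [hφ, hmi, hme, hmf]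
  have hφA : ∀ k η : Mat, k.trace = 0 → η.trace = 0 →
      A (k * η - η * k, 0) = br (φ k, φ k) (A (η, 0)) := by
    intro k η hk hη
    have h1 : ((k * η - η * k, 0) : Mat × Mat) = k 0 0 • (iMat * η - η * iMat, 0)
        + k 0 1 • (eMat * η - η * eMat, 0) + k 1 0 • (fMat * η - η * fMat, 0) := by
      nth_rw 1 2 [traceless_decomp hk]
      ext1
      · simp only [Prod.fst_add, Prod.smul_fst, add_mul, mul_add, smul_mul_assoc, mul_smul_comm]
        module
      · simp
    have h2 : ((φ k, φ k) : Mat × Mat)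
        = k 0 0 • (mi, mi) + k 0 1 • (me, me) + k 1 0 • (mf, mf) := rfl
    rw [h1, h2]
    simp only [map_add, map_smul, LinearMap.add_apply, LinearMap.smul_apply, hi η hη, he η hη,
      hf η hη]
  let N₁ : Mat →ₗ[ℝ] Mat := LinearMap.fst ℝ Mat Mat ∘ₗ A ∘ₗ LinearMap.inl ℝ Mat Mat
  let N₂ : Mat →ₗ[ℝ] Mat := LinearMap.snd ℝ Mat Mat ∘ₗ A ∘ₗ LinearMap.inl ℝ Mat Mat
  have hN : ∀ X, A (X, 0) = (N₁ X, N₂ X) := fun _ => rfl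
  have h1t : ∀ X, X.trace = 0 → (N₁ X).trace = 0 := fun X hX =>
    (hA.traceless_map _ (hinl X hX)).1
  have h2t : ∀ X, X.trace = 0 → (N₂ X).trace = 0 := fun X hX =>
    (hA.traceless_map _ (hinl X hX)).2
  have h1 : ∀ k η, k.trace = 0 → η.trace = 0 →
      N₁ (k * η - η * k) = φ k * N₁ η - N₁ η * φ k := fun k η hk hη =>
    congrArg Prod.fst (hφA k η hk hη)
  have h2 : ∀ k η, k.trace = 0 → η.trace = 0 →
      N₂ (k * η - η * k) = φ k * N₂ η - N₂ η * φ k := fun k η hk hη =>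
    congrArg Prod.snd (hφA k η hk hη)
  have hmetric := hA.metric_map _ _ (hinl _ trace_iMat) (hinl _ trace_iMat)
  obtain ⟨s, t, hst, hconj⟩ : ∃ (s : SL(2, ℝ)) (t : Mat), IsComponentRep t ∧
      ∀ k, k.trace = 0 → φ k = (s : Mat) * t * k * (t * (s⁻¹ : SL(2, ℝ))) := by
    -- The two components cannot both kill i, because A preserves the nonzero length of (i, 0).
    by_cases h0 : N₁ iMat = 0
    · by_cases h0' : N₂ iMat = 0
      · rw [hN, h0, h0', frameMetric_iMat] at hmetric
        change frameMetric 0 0 = _ at hmetric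
        rw [map_zero] at hmetric
        norm_num at hmetric
      · exact exists_conj_of_intertwiner h2t hφt h2 h0'
    · exact exists_conj_of_intertwiner h1t hφt h1 h0
  have hQP := conj_inverse s hst
  have hPQ := mul_eq_one_comm.1 hQP
  obtain ⟨c, hc1⟩ := schur_conj h1t h1 hPQ hconj
  obtain ⟨d, hd1⟩ := schur_conj h2t h2 hPQ hconj
  have hAX : ∀ X : Mat, X.trace = 0 → A (X, 0) = (c • conjMat s t X, d • conjMat s t X) :=
    fun X hX => by rw [hN, hc1 X hX, hd1 X hX]; rfl
  refine ⟨s, t, c, d, hst, ?_, hAX⟩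
  -- With z = c + dω, the metric gives |z|² = 1, and the torsion gives below that z is the square of
  -- its conjugate. Together they say z³ = 1.
  have e1 : c * c + d * d - c * d = 1 := by
    rw [hAX _ trace_iMat, frameMetric_smul, frameMetric_iMat, conjMat, inn_conj hQP trace_iMat,
      inn_iMat] at hmetric
    linarith
  have e2 : c = c * c - 2 * (c * d) ∧ d = d * d - 2 * (c * d) := by
    have h3 := ht _ _ (hinl _ trace_iMat) (hinl _ trace_eMat)
    have h4 := torsion_mul_smul iMat eMat 1 0 1 0
    simp only [one_smul, zero_smul] at h4
    rw [h4, iMat_comm_eMat, hAX _ trace_iMat, hAX _ trace_eMat, torsion_mul_smul] at h3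
    have h5 : conjMat s t iMat * conjMat s t eMat - conjMat s t eMat * conjMat s t iMat
        = (2 : ℝ) • conjMat s t eMat := by
      rw [← conjMat_mul s hst, ← conjMat_mul s hst]
      unfold conjMat
      rw [← sub_mul, ← mul_sub, iMat_comm_eMat, mul_smul_comm, smul_mul_assoc]
    have h7 : conjMat s t eMat ≠ 0 := fun h => by
      have h8 : t * ((s⁻¹ : SL(2, ℝ)) : Mat) * conjMat s t eMat * ((s : Mat) * t) = eMat := by
        unfold conjMat
        rw [show t * ((s⁻¹ : SL(2, ℝ)) : Mat) *
          ((s : Mat) * t * eMat * (t * ((s⁻¹ : SL(2, ℝ)) : Mat))) * ((s : Mat) * t)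
          = t * ((s⁻¹ : SL(2, ℝ)) : Mat) * ((s : Mat) * t) * eMat *
            (t * ((s⁻¹ : SL(2, ℝ)) : Mat) * ((s : Mat) * t)) by simp only [mul_assoc], hQP,
          one_mul, mul_one]
      rw [h, mul_zero, zero_mul] at h8
      have := congrFun (congrFun h8 0) 1
      simp [eMat] at this
    rw [h5, show ((((1 : ℝ) * 1 - 0 * 1 - 1 * 0) / 3) • ((2 : ℝ) • eMat),
      (((0 : ℝ) * 0 - 0 * 1 - 1 * 0) / 3) • ((2 : ℝ) • eMat))
      = (2 / 3 : ℝ) • ((eMat, 0) : Mat × Mat) by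
        ext1 <;> simp [smul_smul]; norm_num,
      map_smul, hAX _ trace_eMat] at h3
    have h8 := congrArg Prod.fst h3
    have h9 := congrArg Prod.snd h3
    simp only [Prod.smul_fst, Prod.smul_snd, smul_smul] at h8 h9
    have h10 := smul_left_injective ℝ h7 h8
    have h11 := smul_left_injective ℝ h7 h9
    constructor <;> linarith
  obtain ⟨e2, e3⟩ := e2
  by_cases hc0 : c = 0
  · right; left
    refine ⟨hc0, ?_⟩
    rw [hc0] at e1 e3
    linarith
  · by_cases hd0 : d = 0
    · left
      refine ⟨?_, hd0⟩
      rw [hd0] at e1 e2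
      linarith
    · right; right
      have f1 : c - 2 * d = 1 := mul_left_cancel₀ hc0 (by linarith)
      have f2 : d - 2 * c = 1 := mul_left_cancel₀ hd0 (by linarith)
      constructor <;> linarith

lemma leftDer_classify {F : Space → Space} (hF : IsSmooth F) (hP : Preserves 1 F) {x : Mat × Mat}
    (hx : x ∈ posDet) :
    ∃ (s : SL(2, ℝ)) (t : Mat) (c d : ℝ), IsComponentRep t ∧ IsCubeRoot c d ∧
      ∀ X : Mat, X.trace = 0 →
        leftDer F x (X, 0) = (c • conjMat s t X, d • conjMat s t X) :=
  (frameIsometry_leftDer hF hP hx).classify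
    (fun _ _ h k => (lieD_leftDer_and_torsion hF hP hx h k).2)
    (fun _ _ _ h k l => leftDer_curv hF hP hx h k l)

end Classification

/-! ### An isometry is determined by its value and differential at the identity. -/

section Rigidity

/-- The complex conjugation of `α + ω β`. -/
def frameConj : (Mat × Mat) →ₗ[ℝ] (Mat × Mat) where
  toFun ξ := (ξ.1 - ξ.2, -ξ.2)
  map_add' ξ η := by ext1 <;> simp only [Prod.fst_add, Prod.snd_add] <;> abel
  map_smul' c ξ := by ext1 <;> simp [smul_sub]

lemma frameConj_smul (c d : ℝ) (X : Mat) :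
    frameConj (c • X, d • X) = ((c - d) • X, (-d) • X) := by
  change (c • X - d • X, -(d • X)) = _
  rw [sub_smul, neg_smul]

variable {F : Space → Space}

lemma inn_comm_self (m k : Mat) : inn (m * k - k * m) k = 0 := by
  have := inn_comm_left m k k
  rw [inn_symm k] at this
  linarith

/-- The cube root of unity in the differential of an isometry does not depend on the point. -/
lemma cubeRoot_invariant (hF : IsSmooth F) (hP : Preserves 1 F) (x : Space) :
    frameMetric (leftDer F (emb x) (iMat, 0)) (frameConj (leftDer F (emb x) (iMat, 0)))
      = frameMetric (leftDer F 1 (iMat, 0)) (frameConj (leftDer F 1 (iMat, 0))) := by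
  have hsm := contDiffOn_leftDer hF (iMat, 0)
  have hd : ∀ x, DifferentiableAt ℝ (fun y => leftDer F y (iMat, 0)) (emb x) := fun x =>
    differentiableAt_of_contDiffOn hsm (emb_mem_posDet x)
  have hd' : ∀ x, DifferentiableAt ℝ (fun y => frameConj (leftDer F y (iMat, 0))) (emb x) :=
    fun x => differentiableAt_of_contDiffOn (contDiffOn_linear frameConj hsm) (emb_mem_posDet x)
  refine const_of_lieD_eq_zero (φ := fun y => frameMetric (leftDer F y (iMat, 0))
    (frameConj (leftDer F y (iMat, 0)))) (fun x => ?_) (fun ζ hζ x => ?_) x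
  · exact differentiableAt_of_contDiffOn (contDiffOn_bilinear frameMetric hsm
      (contDiffOn_linear frameConj hsm)) (emb_mem_posDet x)
  -- The function equals 2/3 Re z². The derivative of A(i, 0) = z k is z(v - w), where v and w are
  -- brackets with k and so orthogonal to it; hence the derivative of the function is zero.
  · obtain ⟨s, t, c, d, ht, -, hA⟩ := leftDer_classify hF hP (emb_mem_posDet x)
    rw [lieD_bilinear frameMetric (hd x) (hd' x), lieD_linear frameConj (hd x),
      (lieD_leftDer_and_torsion hF hP (emb_mem_posDet x) hζ
        (⟨trace_iMat, by simp⟩ : Traceless (iMat, 0))).1]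
    obtain ⟨m, hm⟩ : ∃ m, diagPart ζ = (m, m) := ⟨_, rfl⟩
    obtain ⟨n, hn⟩ : ∃ n, diagPart (leftDer F (emb x) ζ) = (n, n) := ⟨_, rfl⟩
    set k := conjMat s t iMat with hk
    obtain ⟨w, hw, hwk⟩ : ∃ w : Mat, br (diagPart (leftDer F (emb x) ζ)) (c • k, d • k)
        = (c • w, d • w) ∧ inn w k = 0 :=
      ⟨n * k - k * n, by rw [hn, br_mk]; simp [smul_sub], inn_comm_self n k⟩
    obtain ⟨v, hv, hvk⟩ : ∃ v : Mat, leftDer F (emb x) (br (diagPart ζ) (iMat, 0))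
        = (c • v, d • v) ∧ inn v k = 0 := by
      refine ⟨conjMat s t (m * iMat - iMat * m), ?_, ?_⟩
      · rw [hm, br_mk, mul_zero, zero_mul, sub_zero, hA _ (trace_comm _ _)]
      · rw [conjMat_sub, conjMat_mul s ht, conjMat_mul s ht]
        exact inn_comm_self _ _
    have hvw : ((c • v, d • v) : Mat × Mat) - (c • w, d • w) = (c • (v - w), d • (v - w)) := by
      simp [smul_sub]
    have h0 : inn (v - w) k = 0 := by
      rw [← innB_apply, map_sub, LinearMap.sub_apply, innB_apply, innB_apply, hvk, hwk, sub_zero]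
    rw [hA _ trace_iMat, hw, hv, hvw, frameConj_smul, frameConj_smul, frameMetric_smul,
      frameMetric_smul, inn_symm k, h0]
    simp

lemma frameMetric_frameConj (c d : ℝ) (X : Mat) :
    frameMetric (c • X, d • X) (frameConj (c • X, d • X))
      = (2 / 3 * (c * c - c * d) - 1 / 3 * (d * d)) * inn X X := by
  rw [frameConj_smul, frameMetric_smul]
  ring

lemma inn_conjMat_iMat (s : SL(2, ℝ)) {t : Mat} (ht : IsComponentRep t) :
    inn (conjMat s t iMat) (conjMat s t iMat) = 1 := by
  rw [conjMat, inn_conj (conj_inverse s ht) trace_iMat, inn_iMat]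

lemma leftDer_inr (hF : IsSmooth F) (hP : Preserves 1 F) {x : Mat × Mat} (hx : x ∈ posDet)
    {X : Mat} (hX : X.trace = 0) : leftDer F x (0, X) = rot (leftDer F x (X, 0)) := by
  rw [← (frameIsometry_leftDer hF hP hx).rot_map (⟨hX, by simp⟩ : Traceless (X, 0))]
  simp

/-- If the differential at the identity is trivial, it is trivial everywhere. -/
lemma leftDer_eq_self (hF : IsSmooth F) (hP : Preserves 1 F)
    (h1 : ∀ ξ, Traceless ξ → leftDer F 1 ξ = ξ) (x : Space) {ξ : Mat × Mat} (hξ : Traceless ξ) :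
    leftDer F (emb x) ξ = ξ := by
  have hconj : ∀ x : Space, ∃ (s : SL(2, ℝ)) (t : Mat), IsComponentRep t ∧
      ∀ ξ, Traceless ξ → leftDer F (emb x) ξ = (conjMat s t ξ.1, conjMat s t ξ.2) := by
    intro x
    obtain ⟨s, t, c, d, ht, hcd, hA⟩ := leftDer_classify hF hP (emb_mem_posDet x)
    have h2 := cubeRoot_invariant hF hP x
    rw [h1 _ ⟨trace_iMat, by simp⟩, hA _ trace_iMat, frameMetric_frameConj,
      inn_conjMat_iMat s ht] at h2
    have h3 := frameMetric_frameConj 1 0 iMat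
    rw [one_smul, zero_smul, inn_iMat] at h3
    rw [h3] at h2
    -- The invariant is 2/3 for z = 1 and -1/3 for the other two roots.
    have h4 : c = 1 ∧ d = 0 := by
      rcases hcd with h | ⟨rfl, rfl⟩ | ⟨rfl, rfl⟩
      · exact h
      · norm_num at h2
      · norm_num at h2
    obtain ⟨rfl, rfl⟩ := h4
    refine ⟨s, t, ht, fun ξ hξ => ?_⟩
    have h5 : ξ = (ξ.1, 0) + (0, ξ.2) := by simp
    conv_lhs => rw [h5]
    rw [map_add, leftDer_inr hF hP (emb_mem_posDet x) hξ.2, hA _ hξ.1, hA _ hξ.2]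
    simp
  have hd : ∀ x, DifferentiableAt ℝ (fun y => leftDer F y ξ) (emb x) := fun x =>
    differentiableAt_of_contDiffOn (contDiffOn_leftDer hF ξ) (emb_mem_posDet x)
  rw [const_of_lieD_eq_zero (φ := fun y => leftDer F y ξ) hd (fun ζ hζ x => ?_) x, h1 ξ hξ]
  rw [(lieD_leftDer_and_torsion hF hP (emb_mem_posDet x) hζ hξ).1]
  obtain ⟨s, t, ht, hA⟩ := hconj x
  rw [hA _ (traceless_br _ _), hA ζ hζ, hA ξ hξ]
  -- Conjugating both components alike commutes with `diagPart` and with brackets, so the two terms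
  -- of the first-order formula cancel.
  have h2 : diagPart (conjMat s t ζ.1, conjMat s t ζ.2)
      = (conjMat s t (diagPart ζ).1, conjMat s t (diagPart ζ).2) := by
    simp only [diagPart_apply, conjMat, mul_smul_comm, smul_mul_assoc, mul_add, add_mul]
  rw [h2, br_mk, br_mk, ← conjMat_mul s ht, ← conjMat_mul s ht, ← conjMat_mul s ht, ← conjMat_mul s ht,
    ← conjMat_sub, ← conjMat_sub]
  exact sub_self _

/-- An isometry which fixes the identity to first order is trivial. -/
lemma eq_self_of_leftDer (hF : IsSmooth F) (hP : Preserves 1 F) (hF1 : F 1 = 1)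
    (h1 : ∀ ξ, Traceless ξ → leftDer F 1 ξ = ξ) (x : Space) : F x = x := by
  have hs : ContDiffOn ℝ ∞ (fun y : Mat × Mat => adjPair y) posDet :=
    contDiffOn_linear adjPair contDiffOn_id
  have hl : ∀ x, lift F (emb x) = emb (F x) := fun x => by rw [lift, rescale_emb]
  -- On SL(2, ℝ) × SL(2, ℝ) this function is F(x) x⁻¹, the adjugate serving as a linear extension of
  -- the inverse.
  have h2 := const_of_lieD_eq_zero (φ := fun y => lift F y * adjPair y) (fun x => ?_)
    (fun ξ hξ x => ?_) x
  · rw [hl, ← emb_inv, ← emb_one, hl, hF1, ← emb_inv, ← emb_mul, ← emb_mul] at h2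
    have := emb_injective h2
    rwa [inv_one, mul_one, mul_inv_eq_one] at this
  · exact differentiableAt_of_contDiffOn (contDiffOn_bilinear (LinearMap.mul ℝ (Mat × Mat))
      (contDiffOn_lift hF) hs) (emb_mem_posDet x)
  · have h3 : lieD ξ (fun y : Mat × Mat => adjPair y) (emb x) = -ξ * adjPair (emb x) := by
      have := lieD_linear adjPair (φ := fun y : Mat × Mat => y) differentiableAt_id
        (x := emb x) ξ
      rw [this, ← adjPair_traceless hξ, ← adjPair_mul]
      unfold lieD
      erw [fderiv_fun_id]
      rfl
    rw [lieD_mul (differentiableAt_of_contDiffOn (contDiffOn_lift hF) (emb_mem_posDet x))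
      (differentiableAt_of_contDiffOn hs (emb_mem_posDet x)), h3, ← lift_mul_leftDer,
      leftDer_eq_self hF hP h1 x hξ]
    noncomm_ring

end Rigidity

/-! ### The generators and their differentials. -/

section Generators

lemma FrameIsometry.comp {ε δ : ℝ} {A B : (Mat × Mat) →ₗ[ℝ] (Mat × Mat)}
    (hB : FrameIsometry δ B) (hA : FrameIsometry ε A) : FrameIsometry (δ * ε) (B ∘ₗ A) where
  traceless_map ξ h := hB.traceless_map _ (hA.traceless_map _ h)
  metric_map ξ η h k := by
    rw [LinearMap.comp_apply, LinearMap.comp_apply,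
      hB.metric_map _ _ (hA.traceless_map _ h) (hA.traceless_map _ k), hA.metric_map _ _ h k]
  frameJ_map ξ h := by
    rw [LinearMap.comp_apply, LinearMap.comp_apply, hA.frameJ_map _ h, map_smul,
      hB.frameJ_map _ (hA.traceless_map _ h), smul_smul, mul_comm]

/-- The map `ξ ↦ P ξ Q` on both components. -/
def conjPair (P Q : Mat) : (Mat × Mat) →ₗ[ℝ] (Mat × Mat) :=
  LinearMap.mulLeft ℝ ((P, P) : Mat × Mat) ∘ₗ LinearMap.mulRight ℝ ((Q, Q) : Mat × Mat)

lemma conjPair_apply (P Q : Mat) (ξ : Mat × Mat) :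
    conjPair P Q ξ = (P * ξ.1 * Q, P * ξ.2 * Q) := by
  change (P * (ξ.1 * Q), P * (ξ.2 * Q)) = _
  rw [mul_assoc, mul_assoc]

lemma frameIsometry_conjPair {P Q : Mat} (h : Q * P = 1) : FrameIsometry 1 (conjPair P Q) where
  traceless_map ξ hξ := by
    rw [conjPair_apply]
    constructor
    · change (P * ξ.1 * Q).trace = 0
      rw [Matrix.trace_mul_comm, ← mul_assoc, h, one_mul, hξ.1]
    · change (P * ξ.2 * Q).trace = 0
      rw [Matrix.trace_mul_comm, ← mul_assoc, h, one_mul, hξ.2]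
  metric_map ξ η hξ hη := by
    rw [conjPair_apply, conjPair_apply, frameMetric_apply, frameMetric_apply]
    simp only [inn_conj h hξ.1, inn_conj h hξ.2]
  frameJ_map ξ hξ := by
    rw [one_smul]
    simp only [conjPair_apply, frameJ_apply, mul_sub, sub_mul, mul_smul_comm, smul_mul_assoc]

/-- The differential of the exchange of the factors. -/
def swapPair : (Mat × Mat) →ₗ[ℝ] (Mat × Mat) :=
  (LinearMap.snd ℝ Mat Mat).prod (LinearMap.fst ℝ Mat Mat)

lemma swapPair_apply (ξ : Mat × Mat) : swapPair ξ = (ξ.2, ξ.1) := rfl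

lemma frameIsometry_swapPair : FrameIsometry (-1) swapPair where
  traceless_map ξ hξ := ⟨hξ.2, hξ.1⟩
  metric_map ξ η _ _ := by
    simp only [swapPair_apply, frameMetric_apply]
    ring
  frameJ_map ξ _ := by
    simp only [swapPair_apply, frameJ_apply]
    ext1
    · change (2 : ℝ) • ξ.1 - ξ.2 = (-1 : ℝ) • (ξ.2 - (2 : ℝ) • ξ.1)
      module
    · change ξ.1 - (2 : ℝ) • ξ.2 = (-1 : ℝ) • ((2 : ℝ) • ξ.2 - ξ.1)
      module

/-- The differential at the identity of `(p, q) ↦ (p⁻¹, q p⁻¹)`. -/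
def reflPair : (Mat × Mat) →ₗ[ℝ] (Mat × Mat) :=
  (-LinearMap.fst ℝ Mat Mat).prod (LinearMap.snd ℝ Mat Mat - LinearMap.fst ℝ Mat Mat)

lemma reflPair_apply (ξ : Mat × Mat) : reflPair ξ = (-ξ.1, ξ.2 - ξ.1) := rfl

lemma frameIsometry_reflPair : FrameIsometry (-1) reflPair where
  traceless_map ξ hξ := by
    constructor <;> simp [reflPair_apply, hξ.1, hξ.2]
  metric_map ξ η _ _ := by
    simp only [reflPair_apply, frameMetric_apply, inn_eq, Matrix.sub_apply, Matrix.neg_apply]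
    ring
  frameJ_map ξ _ := by
    simp only [reflPair_apply, frameJ_apply]
    ext1
    · change -(ξ.1 - (2 : ℝ) • ξ.2) = (-1 : ℝ) • (-ξ.1 - (2 : ℝ) • (ξ.2 - ξ.1))
      module
    · change (2 : ℝ) • ξ.1 - ξ.2 - (ξ.1 - (2 : ℝ) • ξ.2)
        = (-1 : ℝ) • ((2 : ℝ) • (-ξ.1) - (ξ.2 - ξ.1))
      module

lemma isSmooth_of_contDiff {F : Space → Space} {f : Mat × Mat → Mat × Mat}
    (hf : ContDiff ℝ ∞ f) (h : ∀ x, f (emb x) = emb (F x)) : IsSmooth F := fun _ =>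
  ⟨Set.univ, f, isOpen_univ, Set.mem_univ _, hf.contDiffOn, fun y _ => h y⟩

lemma isSmooth_of_linear {F : Space → Space} {T : (Mat × Mat) →ₗ[ℝ] (Mat × Mat)}
    (h : ∀ x, T (emb x) = emb (F x)) : IsSmooth F :=
  isSmooth_of_contDiff (LinearMap.toContinuousLinearMap T).contDiff h

lemma hasLeftDeriv_of_linear {F : Space → Space} {T : (Mat × Mat) →ₗ[ℝ] (Mat × Mat)}
    (h : ∀ x, T (emb x) = emb (F x)) {x : Space} {A : (Mat × Mat) →ₗ[ℝ] (Mat × Mat)}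
    (hA : ∀ ξ, T (emb x * ξ) = emb (F x) * A ξ) : HasLeftDeriv F x A := by
  intro γ ξ _ _ hγ
  have h1 := (LinearMap.toContinuousLinearMap T).hasFDerivAt.comp_hasDerivAt (0 : ℝ) hγ
  rw [← hA]
  have h2 : (fun t => emb (F (γ t))) = fun t => T (emb (γ t)) := by
    funext t
    rw [h]
  rw [h2]
  exact h1

/-- The map `(p, q) ↦ (a p c⁻¹, b q c⁻¹)`. -/
def translate (a b c : SL(2, ℝ)) (x : Space) : Space := (a * x.1 * c⁻¹, b * x.2 * c⁻¹)

/-- The linear extension of `translate a b c`. -/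
def translateLin (a b c : SL(2, ℝ)) : (Mat × Mat) →ₗ[ℝ] (Mat × Mat) :=
  LinearMap.mulLeft ℝ (emb (a, b)) ∘ₗ LinearMap.mulRight ℝ (emb (c⁻¹, c⁻¹))

lemma translateLin_emb (a b c : SL(2, ℝ)) (x : Space) :
    translateLin a b c (emb x) = emb (translate a b c x) := by
  change emb (a, b) * (emb x * emb (c⁻¹, c⁻¹)) = _
  rw [← emb_mul, ← emb_mul, ← mul_assoc]
  rfl

lemma isSmooth_translate (a b c : SL(2, ℝ)) : IsSmooth (translate a b c) :=
  isSmooth_of_linear (translateLin_emb a b c)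

lemma coe_inv_mul (c : SL(2, ℝ)) : ((c⁻¹ : SL(2, ℝ)) : Mat) * (c : Mat) = 1 := by
  rw [← Matrix.SpecialLinearGroup.coe_mul, inv_mul_cancel, Matrix.SpecialLinearGroup.coe_one]

lemma hasLeftDeriv_translate (a b c : SL(2, ℝ)) (x : Space) :
    HasLeftDeriv (translate a b c) x (conjPair c (c⁻¹ : SL(2, ℝ))) := by
  refine hasLeftDeriv_of_linear (translateLin_emb a b c) fun ξ => ?_
  have h1 : emb (translate a b c x) = emb (a, b) * emb x * emb (c⁻¹, c⁻¹) := by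
    rw [← emb_mul, ← emb_mul]
    rfl
  have h2 : emb (c⁻¹, c⁻¹) * emb (c, c) = 1 := by
    rw [← emb_mul, Prod.mk_mul_mk, inv_mul_cancel]
    exact emb_one
  have h3 : conjPair c (c⁻¹ : SL(2, ℝ)) ξ = emb (c, c) * ξ * emb (c⁻¹, c⁻¹) := by
    rw [conjPair_apply]
    rfl
  change emb (a, b) * (emb x * ξ * emb (c⁻¹, c⁻¹)) = _
  rw [h1, h3, show emb (a, b) * emb x * emb (c⁻¹, c⁻¹) * (emb (c, c) * ξ * emb (c⁻¹, c⁻¹))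
    = emb (a, b) * emb x * (emb (c⁻¹, c⁻¹) * emb (c, c)) * ξ * emb (c⁻¹, c⁻¹) by
      simp only [mul_assoc], h2, mul_one]
  simp only [mul_assoc]

lemma preserves_translate (a b c : SL(2, ℝ)) : Preserves 1 (translate a b c) :=
  FrameIsometry.preserves fun x =>
    ⟨_, hasLeftDeriv_translate a b c x, frameIsometry_conjPair (coe_inv_mul c)⟩

/-- The map `(p, q) ↦ (i p i⁻¹, i q i⁻¹)`. -/
def conjI (x : Space) : Space := (iConj x.1, iConj x.2)

lemma conjPair_emb (x : Space) : conjPair iMat iMat (emb x) = emb (conjI x) :=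
  conjPair_apply _ _ _

lemma isSmooth_conjI : IsSmooth conjI := isSmooth_of_linear conjPair_emb

lemma hasLeftDeriv_conjI (x : Space) : HasLeftDeriv conjI x (conjPair iMat iMat) := by
  refine hasLeftDeriv_of_linear conjPair_emb fun ξ => ?_
  have h : ∀ a b : Mat, iMat * (a * b) * iMat = iMat * a * iMat * (iMat * b * iMat) := by
    intro a b
    rw [show iMat * a * iMat * (iMat * b * iMat) = iMat * a * (iMat * iMat) * b * iMat by
      simp only [mul_assoc], iMat_sq]
    simp only [mul_assoc, one_mul]
  rw [← conjPair_emb, conjPair_apply, conjPair_apply, conjPair_apply, Prod.mk_mul_mk]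
  exact Prod.ext (h _ _) (h _ _)

lemma preserves_conjI : Preserves 1 conjI :=
  FrameIsometry.preserves fun x => ⟨_, hasLeftDeriv_conjI x, frameIsometry_conjPair iMat_sq⟩

lemma isSmooth_swap : IsSmooth Prod.swap :=
  isSmooth_of_linear (T := swapPair) fun _ => rfl

lemma hasLeftDeriv_swap (x : Space) : HasLeftDeriv Prod.swap x swapPair :=
  hasLeftDeriv_of_linear (T := swapPair) (fun _ => rfl) fun _ => rfl

lemma preserves_swap : Preserves (-1) Prod.swap :=
  FrameIsometry.preserves fun x => ⟨_, hasLeftDeriv_swap x, frameIsometry_swapPair⟩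

/-- The map `(p, q) ↦ (p⁻¹, q p⁻¹)`. -/
def reflect (x : Space) : Space := (x.1⁻¹, x.2 * x.1⁻¹)

/-- The adjugate as a linear map. -/
def adjLin : Mat →ₗ[ℝ] Mat where
  toFun a := a.adjugate
  map_add' a b := by simp only [adjugate_eq, Matrix.trace_add]; module
  map_smul' c a := by
    simp only [adjugate_eq, Matrix.trace_smul, smul_eq_mul, RingHom.id_apply]; module

lemma emb_reflect (x : Space) :
    (adjLin (emb x).1, LinearMap.mul ℝ Mat (emb x).2 (adjLin (emb x).1)) = emb (reflect x) := by
  unfold emb reflect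
  rw [Matrix.SpecialLinearGroup.coe_mul, Matrix.SpecialLinearGroup.coe_inv]
  rfl

lemma isSmooth_reflect : IsSmooth reflect := by
  refine isSmooth_of_contDiff (f := fun y => (adjLin y.1, LinearMap.mul ℝ Mat y.2 (adjLin y.1)))
    ?_ emb_reflect
  have h1 : ContDiff ℝ ∞ (fun y : Mat × Mat => adjLin y.1) :=
    (LinearMap.toContinuousLinearMap adjLin).contDiff.comp contDiff_fst
  exact h1.prodMk (contDiffOn_univ.1 (contDiffOn_bilinear (LinearMap.mul ℝ Mat)
    contDiff_snd.contDiffOn h1.contDiffOn))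

/-- Inverting p turns the velocity p α into -α p⁻¹ = p⁻¹ (p(-α)p⁻¹), whence the conjugation by p;
the second component uses the product rule. -/
lemma hasLeftDeriv_reflect (x : Space) :
    HasLeftDeriv reflect x (conjPair x.1 (x.1⁻¹ : SL(2, ℝ)) ∘ₗ reflPair) := by
  intro γ ξ h0 hξ hγ
  have h1 : HasDerivAt (fun t => (emb (γ t)).1) ((x.1 : Mat) * ξ.1) 0 :=
    (hasFDerivAt_fst (𝕜 := ℝ) (E := Mat) (F := Mat)).comp_hasDerivAt (0 : ℝ) hγ
  have h2 : HasDerivAt (fun t => (emb (γ t)).2) ((x.2 : Mat) * ξ.2) 0 :=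
    (hasFDerivAt_snd (𝕜 := ℝ) (E := Mat) (F := Mat)).comp_hasDerivAt (0 : ℝ) hγ
  have h3 : HasDerivAt (fun t => adjLin (emb (γ t)).1) (adjLin ((x.1 : Mat) * ξ.1)) 0 :=
    (LinearMap.toContinuousLinearMap adjLin).hasFDerivAt.comp_hasDerivAt (0 : ℝ) h1
  have h4 : HasDerivAt (fun t => LinearMap.mul ℝ Mat (emb (γ t)).2 (adjLin (emb (γ t)).1))
      ((emb (γ 0)).2 * adjLin ((x.1 : Mat) * ξ.1) + (x.2 : Mat) * ξ.2 * adjLin (emb (γ 0)).1) 0 :=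
    (LinearMap.mul ℝ Mat).toContinuousBilinearMap.hasDerivAt_of_bilinear (fun _ => h2) (fun _ => h3)
  have h5 := h3.prodMk h4
  simp only [emb_reflect] at h5
  refine h5.congr_deriv ?_
  have ha : adjLin ξ.1 = -ξ.1 := by
    change ξ.1.adjugate = _
    rw [adjugate_eq, hξ.1]
    simp
  have hm : adjLin ((x.1 : Mat) * ξ.1) = -(ξ.1 * ((x.1⁻¹ : SL(2, ℝ)) : Mat)) := by
    have : adjLin ((x.1 : Mat) * ξ.1) = adjLin ξ.1 * ((x.1⁻¹ : SL(2, ℝ)) : Mat) := by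
      rw [Matrix.SpecialLinearGroup.coe_inv]
      exact Matrix.adjugate_mul_distrib _ _
    rw [this, ha, neg_mul]
  have hi : adjLin (emb (γ 0)).1 = ((x.1⁻¹ : SL(2, ℝ)) : Mat) := by
    rw [h0, Matrix.SpecialLinearGroup.coe_inv]
    rfl
  have hinv := coe_inv_mul x.1
  rw [hm, hi, h0, LinearMap.comp_apply, conjPair_apply, reflPair_apply]
  have he : emb (reflect x) = (((x.1⁻¹ : SL(2, ℝ)) : Mat), (x.2 : Mat) * ((x.1⁻¹ : SL(2, ℝ)) : Mat)) := by
    unfold emb reflect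
    rw [Matrix.SpecialLinearGroup.coe_mul]
  rw [he, Prod.mk_mul_mk]
  have hcancel : ∀ a b c : Mat, a * ((x.1⁻¹ : SL(2, ℝ)) : Mat) * ((x.1 : Mat) * b * c)
      = a * b * c := fun a b c => by
    rw [show a * ((x.1⁻¹ : SL(2, ℝ)) : Mat) * ((x.1 : Mat) * b * c)
      = a * (((x.1⁻¹ : SL(2, ℝ)) : Mat) * (x.1 : Mat)) * b * c by simp only [mul_assoc], hinv,
      mul_one]
  rw [hcancel, ← one_mul ((x.1⁻¹ : SL(2, ℝ)) : Mat), hcancel]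
  ext1
  · change -(ξ.1 * (1 * ((x.1⁻¹ : SL(2, ℝ)) : Mat))) = 1 * -ξ.1 * (1 * ((x.1⁻¹ : SL(2, ℝ)) : Mat))
    noncomm_ring
  · change (x.2 : Mat) * -(ξ.1 * (1 * ((x.1⁻¹ : SL(2, ℝ)) : Mat)))
      + (x.2 : Mat) * ξ.2 * (1 * ((x.1⁻¹ : SL(2, ℝ)) : Mat))
      = (x.2 : Mat) * (ξ.2 - ξ.1) * (1 * ((x.1⁻¹ : SL(2, ℝ)) : Mat))
    noncomm_ring

lemma preserves_reflect : Preserves (-1) reflect :=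
  FrameIsometry.preserves fun x => ⟨_, hasLeftDeriv_reflect x, by
    simpa using (frameIsometry_conjPair (coe_inv_mul x.1)).comp frameIsometry_reflPair⟩

end Generators

/-! ### The action on the quotient of triples by the diagonal. -/

section Action

/-- The full group `SL(2, ℝ)³ ⋊ (ℤ₂ × S₃)`. -/
abbrev FullGroup : Type := TripleSL ⋊[tripleAut] FinGroup

/-- The projection `SL(2, ℝ)³ → SL(2, ℝ)³ / SL(2, ℝ)`, the quotient being identified with
`SL(2, ℝ) × SL(2, ℝ)`. -/
def quot (x : TripleSL) : Space := (x 0 * (x 2)⁻¹, x 1 * (x 2)⁻¹)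

/-- A section of `quot`. -/
def sec (x : Space) : TripleSL := ![x.1, x.2, 1]

lemma quot_sec (x : Space) : quot (sec x) = x := by
  ext1 <;> simp [quot, sec]

lemma quot_mul_const (x : TripleSL) (c : SL(2, ℝ)) : quot (x * fun _ => c) = quot x := by
  simp [quot, mul_assoc]

lemma sec_quot (x : TripleSL) : sec (quot x) = x * fun _ => (x 2)⁻¹ := by
  funext j
  fin_cases j <;> simp [quot, sec]

lemma tripleAut_apply (s : FinGroup) (x : TripleSL) (j : Fin 3) :
    tripleAut s x j = (iConj ^ (s.1.toAdd).val) (x (s.2⁻¹ j)) := rfl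

/-- The action of the full group on `SL(2, ℝ) × SL(2, ℝ)`. -/
def act (w : FullGroup) (x : Space) : Space := quot (w.left * tripleAut w.right (sec x))

/-- The action descends because the automorphisms map constant triples to constant triples.
Multiplicativity of `act` then follows from the semidirect product law. -/
lemma act_quot (w : FullGroup) (x : TripleSL) :
    act w (quot x) = quot (w.left * tripleAut w.right x) := by
  have : tripleAut w.right (fun _ => (x 2)⁻¹)
      = fun _ => (iConj ^ (w.right.1.toAdd).val) (x 2)⁻¹ := rfl
  rw [act, sec_quot, map_mul, this, ← mul_assoc, quot_mul_const]

/-- The action of the full group, as a homomorphism to the permutations. -/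
def actHom : FullGroup →* Equiv.Perm Space :=
  MonoidHom.toHomPerm
    { toFun := act
      map_one' := by
        funext x
        change quot (1 * tripleAut 1 (sec x)) = x
        rw [map_one, one_mul, MulAut.one_apply, quot_sec]
      map_mul' := fun v w => by
        funext x
        change act (v * w) x = act v (act w x)
        rw [← quot_sec x, act_quot, act_quot, act_quot, SemidirectProduct.mul_left,
          SemidirectProduct.mul_right, map_mul, map_mul, MulAut.mul_apply, mul_assoc] }

lemma actHom_apply (w : FullGroup) (x : Space) : actHom w x = act w x := rfl

lemma actHom_inl (a b c : SL(2, ℝ)) :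
    ⇑(actHom (SemidirectProduct.inl ![a, b, c])) = translate a b c := by
  funext x
  change quot (![a, b, c] * tripleAut 1 (sec x)) = _
  rw [map_one, MulAut.one_apply]
  simp [quot, sec, translate]

lemma actHom_conj :
    ⇑(actHom (SemidirectProduct.inr (Multiplicative.ofAdd 1, 1))) = conjI := by
  funext x
  change quot (1 * tripleAut (Multiplicative.ofAdd 1, 1) (sec x)) = _
  have h : ((1 : ZMod 2)).val = 1 := rfl
  simp [quot, sec, conjI, tripleAut_apply, h]

lemma actHom_swap : ⇑(actHom (SemidirectProduct.inr (1, Equiv.swap 0 1))) = Prod.swap := by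
  funext x
  change quot (1 * tripleAut (1, Equiv.swap 0 1) (sec x)) = _
  have h : (Equiv.swap (0 : Fin 3) 1) 2 = 2 := by decide
  simp [quot, sec, tripleAut_apply, h, Prod.swap]

lemma actHom_reflect : ⇑(actHom (SemidirectProduct.inr (1, Equiv.swap 0 2))) = reflect := by
  funext x
  change quot (1 * tripleAut (1, Equiv.swap 0 2) (sec x)) = _
  have h : (Equiv.swap (0 : Fin 3) 2) 1 = 1 := by decide
  simp [quot, sec, tripleAut_apply, h, reflect]

lemma mem_isometryGroup_of_involution {F : Equiv.Perm Space} (h : F * F = 1) (hs : IsSmooth F)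
    (hP : Preserves 1 F ∨ Preserves (-1) F) : F ∈ isometryGroup := by
  have : F.symm = F := inv_eq_of_mul_eq_one_left h
  exact ⟨hs, by rw [this]; exact hs, hP⟩

lemma triple_eq (n : TripleSL) : n = ![n 0, n 1, n 2] := by
  funext j
  fin_cases j <;> rfl

lemma actHom_inl_mem (n : TripleSL) : actHom (SemidirectProduct.inl n) ∈ isometryGroup := by
  have h : ∀ n : TripleSL, IsSmooth (actHom (SemidirectProduct.inl n)) := fun n => by
    rw [triple_eq n, actHom_inl]
    exact isSmooth_translate _ _ _
  refine ⟨h n, ?_, Or.inl ?_⟩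
  · have : (actHom (SemidirectProduct.inl n)).symm = actHom (SemidirectProduct.inl n⁻¹) := by
      rw [map_inv, map_inv]
      rfl
    rw [this]
    exact h _
  · rw [triple_eq n, actHom_inl]
    exact preserves_translate _ _ _

lemma inr_mul_self {s : FinGroup} (h : s * s = 1) :
    actHom (SemidirectProduct.inr s) * actHom (SemidirectProduct.inr s) = 1 := by
  rw [← map_mul, ← map_mul, h, map_one, map_one]

lemma perm_three_cases (σ : Equiv.Perm (Fin 3)) :
    σ = 1 ∨ σ = Equiv.swap 0 1 ∨ σ = Equiv.swap 0 2 ∨ σ = Equiv.swap 0 1 * Equiv.swap 0 2 ∨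
      σ = Equiv.swap 0 2 * Equiv.swap 0 1 ∨
      σ = Equiv.swap 0 1 * Equiv.swap 0 2 * Equiv.swap 0 1 := by
  revert σ
  decide

lemma zmod_two_cases (e : Multiplicative (ZMod 2)) : e = 1 ∨ e = Multiplicative.ofAdd 1 := by
  revert e
  decide

lemma actHom_mem (w : FullGroup) : actHom w ∈ isometryGroup := by
  have hi : actHom (SemidirectProduct.inr (Multiplicative.ofAdd 1, 1)) ∈ isometryGroup :=
    mem_isometryGroup_of_involution (inr_mul_self (by decide))
      (by rw [actHom_conj]; exact isSmooth_conjI)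
      (Or.inl (by rw [actHom_conj]; exact preserves_conjI))
  have hs : actHom (SemidirectProduct.inr (1, Equiv.swap 0 1)) ∈ isometryGroup :=
    mem_isometryGroup_of_involution (inr_mul_self (by decide))
      (by rw [actHom_swap]; exact isSmooth_swap)
      (Or.inr (by rw [actHom_swap]; exact preserves_swap))
  have hr : actHom (SemidirectProduct.inr (1, Equiv.swap 0 2)) ∈ isometryGroup :=
    mem_isometryGroup_of_involution (inr_mul_self (by decide))
      (by rw [actHom_reflect]; exact isSmooth_reflect)
      (Or.inr (by rw [actHom_reflect]; exact preserves_reflect))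
  let K : Subgroup (Equiv.Perm (Fin 3)) := isometryGroup.comap
    ((actHom.comp SemidirectProduct.inr).comp (MonoidHom.inr (Multiplicative (ZMod 2)) _))
  have ks : Equiv.swap 0 1 ∈ K := hs
  have kr : Equiv.swap 0 2 ∈ K := hr
  have hK : ∀ σ, σ ∈ K := by
    intro σ
    rcases perm_three_cases σ with h | h | h | h | h | h <;> rw [h]
    · exact K.one_mem
    · exact ks
    · exact kr
    · exact K.mul_mem ks kr
    · exact K.mul_mem kr ks
    · exact K.mul_mem (K.mul_mem ks kr) ks
  have he : ∀ e, actHom (SemidirectProduct.inr (e, 1)) ∈ isometryGroup := by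
    intro e
    rcases zmod_two_cases e with h | h <;> rw [h]
    · rw [← Prod.one_eq_mk, map_one, map_one]
      exact isometryGroup.one_mem
    · exact hi
  have h1 : w.right = (w.right.1, 1) * (1, w.right.2) := by simp
  rw [← SemidirectProduct.inl_left_mul_inr_right w, map_mul, h1, map_mul, map_mul]
  exact isometryGroup.mul_mem (actHom_inl_mem _) (isometryGroup.mul_mem (he _) (hK w.right.2))

end Action

/-! ### The kernel of the action. -/

section Kernel

lemma scalar_of_commute_unipotent {M : Mat}
    (hU : M * (upper 1 : Mat) = (upper 1 : Mat) * M)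
    (hL : M * (lower 1 : Mat) = (lower 1 : Mat) * M) : M = M 0 0 • 1 := by
  have a := congrFun (congrFun hU 0) 0
  have b := congrFun (congrFun hU 0) 1
  have c := congrFun (congrFun hL 0) 0
  simp [upper, lower, Matrix.mul_apply, Fin.sum_univ_two] at a b c
  ext i j
  fin_cases i <;> fin_cases j <;> simp <;> linarith

lemma one_ne_neg_one : (1 : SL(2, ℝ)) ≠ -1 := fun h => by
  have := congrArg (fun a : SL(2, ℝ) => (a : Mat) 0 0) h
  simp at this
  linarith

lemma eq_one_or_neg_one_of_central {n : SL(2, ℝ)} (h : ∀ u, n * u = u * n) :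
    n = 1 ∨ n = -1 := by
  have h1 : ∀ u : SL(2, ℝ), (n : Mat) * u = u * n := fun u => by
    rw [← Matrix.SpecialLinearGroup.coe_mul, h, Matrix.SpecialLinearGroup.coe_mul]
  have h2 := scalar_of_commute_unipotent (h1 _) (h1 _)
  have h3 : (n : Mat).det = 1 := n.2
  rw [h2, Matrix.det_smul, Matrix.det_one, mul_one, Fintype.card_fin, sq_eq_one_iff] at h3
  rcases h3 with h | h <;> rw [h] at h2
  · left
    apply Subtype.ext
    rw [h2, one_smul, Matrix.SpecialLinearGroup.coe_one]
  · right
    apply Subtype.ext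
    rw [h2, neg_smul, one_smul, Matrix.SpecialLinearGroup.coe_neg,
      Matrix.SpecialLinearGroup.coe_one]

/-- Otherwise n i would commute with all of SL(2, ℝ) and be a real scalar, whose determinant is a
square, while det(n i) = -1. -/
lemma not_intertwines_iConj (n : SL(2, ℝ)) : ¬ ∀ u, n * iConj u = u * n := by
  intro h
  have h1 : ∀ u : SL(2, ℝ), (n : Mat) * iMat * u = u * ((n : Mat) * iMat) := fun u => by
    have h2 : (n : Mat) * (iMat * u * iMat) = u * n := by
      have := congrArg (fun a : SL(2, ℝ) => (a : Mat)) (h u)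
      simp only [Matrix.SpecialLinearGroup.coe_mul] at this
      exact this
    rw [← mul_assoc, ← h2, show (n : Mat) * (iMat * u * iMat) * iMat
      = n * iMat * u * (iMat * iMat) by simp only [mul_assoc], iMat_sq, mul_one]
  have h2 := scalar_of_commute_unipotent (h1 _) (h1 _)
  have h3 : ((n : Mat) * iMat).det = -1 := by
    have hn : (n : Mat).det = 1 := n.2
    rw [Matrix.det_mul, hn]
    simp [iMat, Matrix.det_fin_two]
  rw [h2, Matrix.det_smul, Matrix.det_one, mul_one, Fintype.card_fin] at h3
  nlinarith

/-- Two triples with the same image differ by right multiplication by a constant triple. -/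
lemma inv_mul_eq_of_quot_eq {x y : TripleSL} (h : quot y = quot x) (j k : Fin 3) :
    (x j)⁻¹ * y j = (x k)⁻¹ * y k := by
  have h0 : ∀ a b c d : SL(2, ℝ), a * b⁻¹ = c * d⁻¹ → c⁻¹ * a = d⁻¹ * b := fun a b c d h => by
    rw [mul_inv_eq_iff_eq_mul] at h
    rw [h]
    group
  have h1 := h0 _ _ _ _ (congrArg Prod.fst h)
  have h2 := h0 _ _ _ _ (congrArg Prod.snd h)
  have h3 : ∀ j, (x j)⁻¹ * y j = (x 2)⁻¹ * y 2 := by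
    intro j
    fin_cases j
    · exact h1
    · exact h2
    · rfl
  rw [h3, h3 k]

/-- With j moved by σ, k is an index other than j and σ j. A triple equal to 1 except for u in
position j then enters the two compared expressions only through u⁻¹, which cannot be independent of
u. -/
lemma perm_three_ne_one {σ : Equiv.Perm (Fin 3)} (h : σ ≠ 1) :
    ∃ j k, j ≠ k ∧ σ⁻¹ j ≠ j ∧ σ⁻¹ k ≠ j := by
  revert σ
  decide

/-- The kernel of the action. -/
lemma actHom_eq_one_iff (w : FullGroup) :
    actHom w = 1 ↔ w = 1 ∨ w = SemidirectProduct.inl ![-1, -1, -1] := by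
  constructor
  · intro h
    obtain ⟨n, e, σ⟩ := w
    have h1 : ∀ (x : TripleSL) (j k : Fin 3),
        (x j)⁻¹ * (n j * (iConj ^ (e.toAdd).val) (x (σ⁻¹ j)))
          = (x k)⁻¹ * (n k * (iConj ^ (e.toAdd).val) (x (σ⁻¹ k))) := fun x j k => by
      have h2 := congrArg (fun F : Equiv.Perm Space => F (quot x)) h
      simp only [actHom_apply, act_quot] at h2
      exact inv_mul_eq_of_quot_eq h2 j k
    have hσ : σ = 1 := by
      by_contra hne
      obtain ⟨j, k, hjk, hj, hk⟩ := perm_three_ne_one hne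
      have h2 : ∀ u, u⁻¹ * n j = n k := fun u => by
        have := h1 (Function.update 1 j u) j k
        rwa [Function.update_self, Function.update_of_ne hj, Function.update_of_ne hk,
          Function.update_of_ne hjk.symm, Pi.one_apply, Pi.one_apply, Pi.one_apply, map_one,
          mul_one, mul_one, inv_one, one_mul] at this
      have h3 : (1 : SL(2, ℝ))⁻¹ * n j = (-1)⁻¹ * n j := (h2 1).trans (h2 (-1)).symm
      exact one_ne_neg_one (inv_injective (mul_right_cancel h3))
    subst hσ
    have h2 : ∀ (j k : Fin 3), j ≠ k → ∀ u,
        u⁻¹ * (n j * (iConj ^ (e.toAdd).val) u) = n k := fun j k hjk u => by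
      have := h1 (Function.update 1 j u) j k
      rwa [inv_one, Equiv.Perm.one_apply, Equiv.Perm.one_apply, Function.update_self,
        Function.update_of_ne hjk.symm, Pi.one_apply, map_one,
        mul_one, inv_one, one_mul] at this
    have h3 : ∀ j k, n j = n k := fun j k => by
      by_cases hjk : j = k
      · rw [hjk]
      · have := h2 j k hjk 1
        rwa [map_one, mul_one, inv_one, one_mul] at this
    have h4 : ∀ u, n 0 * (iConj ^ (e.toAdd).val) u = u * n 0 := fun u => by
      have := h2 0 1 (by decide) u
      rw [h3 1 0, inv_mul_eq_iff_eq_mul] at this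
      exact this
    rcases zmod_two_cases e with rfl | rfl
    · have h5 : ∀ u, n 0 * u = u * n 0 := fun u => by simpa using h4 u
      rcases eq_one_or_neg_one_of_central h5 with h6 | h6
      · left
        refine SemidirectProduct.ext ?_ rfl
        funext j
        exact (h3 j 0).trans h6
      · right
        refine SemidirectProduct.ext ?_ rfl
        funext j
        change n j = ![-1, -1, -1] j
        rw [h3 j 0, h6]
        fin_cases j <;> rfl
    · have hv : ((1 : ZMod 2)).val = 1 := rfl
      exact (not_intertwines_iConj (n 0) fun u => by simpa [hv] using h4 u).elim
  · rintro (rfl | rfl)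
    · exact map_one _
    · ext1 x
      rw [actHom_inl]
      simp [translate]

end Kernel

/-! ### Every isometry comes from the group. -/

section Surjectivity

/-- `actHom w` preserves `J`, fixes the identity and has the differential `B` there. -/
structure FixesIdentity (w : FullGroup) (B : (Mat × Mat) →ₗ[ℝ] (Mat × Mat)) : Prop where
  fixes : actHom w 1 = 1
  preserves : Preserves 1 (actHom w)
  hasLeftDeriv : HasLeftDeriv (actHom w) 1 B
  frameIsometry : FrameIsometry 1 B

lemma FixesIdentity.mul {v w : FullGroup} {A B : (Mat × Mat) →ₗ[ℝ] (Mat × Mat)}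
    (hv : FixesIdentity v B) (hw : FixesIdentity w A) : FixesIdentity (v * w) (B ∘ₗ A) where
  fixes := by rw [map_mul, Equiv.Perm.mul_apply, hw.fixes, hv.fixes]
  preserves := by
    have := hv.preserves.comp hw.preserves
    rw [mul_one] at this
    rwa [map_mul, Equiv.Perm.coe_mul]
  hasLeftDeriv := by
    rw [map_mul, Equiv.Perm.coe_mul]
    refine HasLeftDeriv.comp ?_ hw.hasLeftDeriv hw.frameIsometry.traceless_map
    rw [hw.fixes]
    exact hv.hasLeftDeriv
  frameIsometry := by
    have := hv.frameIsometry.comp hw.frameIsometry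
    rwa [mul_one] at this

lemma fixesIdentity_one : FixesIdentity 1 LinearMap.id where
  fixes := by rw [map_one actHom]; rfl
  preserves := by
    rw [map_one]
    exact Preserves.id
  hasLeftDeriv := by
    rw [map_one]
    intro γ ξ h0 _ hγ
    exact hγ
  frameIsometry := ⟨fun _ h => h, fun _ _ _ _ => rfl, fun _ _ => (one_smul _ _).symm⟩

lemma fixesIdentity_inl (c : SL(2, ℝ)) :
    FixesIdentity (SemidirectProduct.inl ![c, c, c]) (conjPair c (c⁻¹ : SL(2, ℝ))) where
  fixes := by rw [actHom_inl]; simp [translate]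
  preserves := by rw [actHom_inl]; exact preserves_translate _ _ _
  hasLeftDeriv := by rw [actHom_inl]; exact hasLeftDeriv_translate _ _ _ _
  frameIsometry := frameIsometry_conjPair (coe_inv_mul c)

lemma fixesIdentity_conj :
    FixesIdentity (SemidirectProduct.inr (Multiplicative.ofAdd 1, 1)) (conjPair iMat iMat) where
  fixes := by rw [actHom_conj]; simp [conjI]
  preserves := by rw [actHom_conj]; exact preserves_conjI
  hasLeftDeriv := by rw [actHom_conj]; exact hasLeftDeriv_conjI _
  frameIsometry := frameIsometry_conjPair iMat_sq

/-- The product of two transpositions is a 3-cycle. Each factor reverses J, so the product preserves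
it, and its differential at the identity is multiplication by ω. -/
lemma exists_fixesIdentity_rot : ∃ w, FixesIdentity w rot := by
  have h1 : conjPair ((1 : Space).1 : Mat) (((1 : Space).1⁻¹ : SL(2, ℝ)) : Mat) ∘ₗ reflPair
      = reflPair := by
    refine LinearMap.ext fun ξ => ?_
    rw [LinearMap.comp_apply, conjPair_apply]
    simp
  have h2 : rot = reflPair ∘ₗ swapPair := rfl
  refine ⟨SemidirectProduct.inr (1, Equiv.swap 0 2) * SemidirectProduct.inr (1, Equiv.swap 0 1),
    ?_, ?_, ?_, ?_⟩ <;>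
    try rw [map_mul, Equiv.Perm.coe_mul, actHom_reflect, actHom_swap]
  · simp [reflect, Prod.swap]
  · simpa using preserves_reflect.comp preserves_swap
  · rw [h2]
    refine HasLeftDeriv.comp ?_ (hasLeftDeriv_swap 1) frameIsometry_swapPair.traceless_map
    rw [← h1]
    exact hasLeftDeriv_reflect 1
  · rw [h2]
    simpa using frameIsometry_reflPair.comp frameIsometry_swapPair

/-- An isometry which preserves `J` and fixes the identity has there the same differential as an
element of the full group. -/
lemma exists_fixesIdentity_inverse {F : Space → Space} (hF : IsSmooth F) (hP : Preserves 1 F) :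
    ∃ w B, FixesIdentity w B ∧ ∀ ξ, Traceless ξ → B (leftDer F 1 ξ) = ξ := by
  have h1 : (1 : Mat × Mat) ∈ posDet := emb_one ▸ emb_mem_posDet 1
  obtain ⟨s, t, c, d, ht, hcd, hA⟩ := leftDer_classify hF hP h1
  have hrot : ∀ ξ, Traceless ξ → leftDer F 1 (rot ξ) = rot (leftDer F 1 ξ) := fun ξ hξ =>
    (frameIsometry_leftDer hF hP h1).rot_map hξ
  have hB : ∃ w B, FixesIdentity w B ∧ (∀ ξ, B (rot ξ) = rot (B ξ)) ∧
      ∀ X : Mat, B (conjMat s t X, 0) = (X, 0) := by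
    have hcomm : ∀ (P Q : Mat) ξ, conjPair P Q (rot ξ) = rot (conjPair P Q ξ) := fun P Q ξ => by
      simp only [conjPair_apply, rot_apply, mul_sub, sub_mul, mul_neg, neg_mul]
    have hs : ∀ X : Mat, conjPair ((s⁻¹ : SL(2, ℝ)) : Mat) ((s⁻¹⁻¹ : SL(2, ℝ)) : Mat)
        (conjMat s t X, 0) = (t * X * t, 0) := fun X => by
      rw [conjPair_apply, inv_inv, conjMat]
      rw [show ((s⁻¹ : SL(2, ℝ)) : Mat) * ((s : Mat) * t * X * (t * ((s⁻¹ : SL(2, ℝ)) : Mat))) * s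
        = (((s⁻¹ : SL(2, ℝ)) : Mat) * (s : Mat)) * t * X * t *
          (((s⁻¹ : SL(2, ℝ)) : Mat) * (s : Mat)) by simp only [mul_assoc], coe_inv_mul]
      simp
    rcases ht with rfl | rfl
    · refine ⟨_, _, fixesIdentity_inl s⁻¹, hcomm _ _, fun X => ?_⟩
      rw [hs, one_mul, mul_one]
    · refine ⟨_, _, fixesIdentity_conj.mul (fixesIdentity_inl s⁻¹), fun ξ => ?_, fun X => ?_⟩
      · rw [LinearMap.comp_apply, LinearMap.comp_apply, hcomm, hcomm]
      · rw [LinearMap.comp_apply, hs, conjPair_apply,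
          show iMat * (iMat * X * iMat) * iMat = iMat * iMat * X * (iMat * iMat) by
            simp only [mul_assoc], iMat_sq]
        simp
  have hR : ∃ w R, FixesIdentity w R ∧ (∀ ξ, R (rot ξ) = rot (R ξ)) ∧
      ∀ X : Mat, R (c • X, d • X) = (X, 0) := by
    obtain ⟨r, hr⟩ := exists_fixesIdentity_rot
    -- The cases are z = 1, ω, ω²; their inverses 1, ω², ω are realized by the identity, `rot` twice
    -- and `rot` once.
    rcases hcd with ⟨rfl, rfl⟩ | ⟨rfl, rfl⟩ | ⟨rfl, rfl⟩
    · exact ⟨_, _, fixesIdentity_one, fun _ => rfl, fun X => by simp⟩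
    · exact ⟨_, _, hr.mul hr, fun _ => rfl, fun X => by simp⟩
    · exact ⟨_, _, hr, fun _ => rfl, fun X => by simp⟩
  obtain ⟨v, B, hv, hBr, hB⟩ := hB
  obtain ⟨w, R, hw, hRr, hR⟩ := hR
  refine ⟨_, _, hv.mul hw, ?_⟩
  have h2 : ∀ X : Mat, X.trace = 0 → (B ∘ₗ R) (leftDer F 1 (X, 0)) = (X, 0) := fun X hX => by
    rw [hA X hX, LinearMap.comp_apply, hR, hB]
  intro ξ hξ
  have h3 : ξ = (ξ.1, 0) + rot (ξ.2, 0) := by simp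
  conv_lhs => rw [h3]
  rw [map_add, map_add, hrot _ ⟨hξ.2, by simp⟩, h2 _ hξ.1, LinearMap.comp_apply, hRr, hBr,
    ← LinearMap.comp_apply B, h2 _ hξ.2, ← h3]

lemma actHom_surjective {F : Equiv.Perm Space} (hF : F ∈ isometryGroup) :
    ∃ w, actHom w = F := by
  -- If F reverses J, composing with the exchange of the factors restores it.
  obtain ⟨u, hu⟩ : ∃ u, Preserves 1 (actHom u ∘ F) := by
    rcases hF.2.2 with h | h
    · refine ⟨1, ?_⟩
      rw [map_one]
      exact h
    · refine ⟨SemidirectProduct.inr (1, Equiv.swap 0 1), ?_⟩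
      rw [actHom_swap]
      simpa using preserves_swap.comp h
  set p := (actHom u * F) 1 with hp
  set v : FullGroup := SemidirectProduct.inl ![p.1⁻¹, p.2⁻¹, 1] with hv
  set G : Equiv.Perm Space := actHom v * (actHom u * F) with hG
  have hG1 : G 1 = 1 := by
    rw [hG, Equiv.Perm.mul_apply, ← hp, hv, actHom_inl]
    simp [translate]
  have hGs : IsSmooth G :=
    (isometryGroup.mul_mem (actHom_mem v) (isometryGroup.mul_mem (actHom_mem u) hF)).1
  have hGP : Preserves 1 G := by
    have h := (preserves_translate p.1⁻¹ p.2⁻¹ 1).comp hu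
    rw [mul_one, ← actHom_inl] at h
    exact h
  obtain ⟨w, B, hw, hB⟩ := exists_fixesIdentity_inverse hGs hGP
  obtain ⟨A, hA, hAi⟩ := hGP.exists_frameIsometry 1
  have h1 : (1 : Mat × Mat) ∈ posDet := emb_one ▸ emb_mem_posDet 1
  have hr : rescale 1 = 1 := by rw [← emb_one, rescale_emb]
  have hGA : ∀ ξ, Traceless ξ → leftDer G 1 ξ = A ξ := fun ξ hξ =>
    leftDer_eq hGs h1 (by rwa [hr]) hξ
  have hKs : IsSmooth (actHom w ∘ G) := (actHom_mem w).1.comp hGs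
  have hKP : Preserves 1 (actHom w ∘ G) := by
    have h := hw.preserves.comp hGP
    rwa [mul_one] at h
  have hKd : HasLeftDeriv (actHom w ∘ G) (rescale 1) (B ∘ₗ A) := by
    rw [hr]
    refine HasLeftDeriv.comp ?_ hA hAi.traceless_map
    rw [hG1]
    exact hw.hasLeftDeriv
  -- The corrected map fixes the identity and has identity differential there, so rigidity applies.
  have hK : actHom w * G = 1 := by
    ext1 x
    refine eq_self_of_leftDer hKs hKP ?_ (fun ξ hξ => ?_) x
    · rw [Function.comp_apply, hG1, hw.fixes]
    · rw [leftDer_eq hKs h1 hKd hξ, LinearMap.comp_apply, ← hGA ξ hξ, hB ξ hξ]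
  refine ⟨(w * v * u)⁻¹, ?_⟩
  rw [map_inv, inv_eq_iff_mul_eq_one, map_mul, map_mul, mul_assoc, mul_assoc]
  exact hK

end Surjectivity

end SLNearlyKahler

end

open SLNearlyKahler in
theorem theorem1 :
    ∃ Φ : TripleSL ⋊[tripleAut] FinGroup →* isometryGroup,
      (∀ a b c p q : SL(2, ℝ),
        (Φ (SemidirectProduct.inl ![a, b, c])).1 (p, q) = (a * p * c⁻¹, b * q * c⁻¹)) ∧
      (∀ p q : SL(2, ℝ),
        (Φ (SemidirectProduct.inr (Multiplicative.ofAdd 1, 1))).1 (p, q)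
          = (iConj p, iConj q)) ∧
      (∀ p q : SL(2, ℝ),
        (Φ (SemidirectProduct.inr (1, Equiv.swap 0 1))).1 (p, q) = (q, p)) ∧
      (∀ p q : SL(2, ℝ),
        (Φ (SemidirectProduct.inr (1, Equiv.swap 0 2))).1 (p, q) = (p⁻¹, q * p⁻¹)) ∧
      Function.Surjective Φ ∧
      (Φ.ker : Set (TripleSL ⋊[tripleAut] FinGroup))
        = {1, SemidirectProduct.inl ![-1, -1, -1]} := by
  refine ⟨actHom.codRestrict isometryGroup actHom_mem, fun a b c p q => ?_, fun p q => ?_,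
    fun p q => ?_, fun p q => ?_, fun F => ?_, ?_⟩
  · exact congrFun (actHom_inl a b c) (p, q)
  · exact congrFun actHom_conj (p, q)
  · exact congrFun actHom_swap (p, q)
  · exact congrFun actHom_reflect (p, q)
  · obtain ⟨w, hw⟩ := actHom_surjective F.2
    exact ⟨w, Subtype.ext hw⟩
  · ext w
    rw [SetLike.mem_coe, MonoidHom.mem_ker, Set.mem_insert_iff, Set.mem_singleton_iff,
      ← actHom_eq_one_iff, Subtype.ext_iff]
    rfl
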